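/- **Setting.** Let $\zeta_{0,n},\dots,\zeta_{n,n}$ $(n\ge 1)$ be a triangular array of random variables on a probability space $(\Omega,\mathcal F,\mathbb P)$ with values in measurable spaces $\mathcal X_{j,n}$, let $g_{j,n}:\mathcal X_{j,n}\to\mathbb R$ be measurable, and let $\xi_{j,n}=g_{j,n}(\zeta_{j,n})$ be (essentially) bounded with $\mathbb E[\xi_{j,n}]=0$ for $1\le j\le n$. Put $S_n=\sum_{j=1}^n\xi_{j,n}$, $\sigma_n=\sqrt{\operatorname{Var}(S_n)}$, $K_{\infty,n}=\max_{1\le j\le n}\|\xi_{j,n}\|_\infty$, and assume $\sigma_n\to\infty$. Let $\mathcal F^{(n)}_{a,b}$ be the $\sigma$-algebra generated by $\zeta_{j,n}$, $a\le j\le b$. For $\sigma$-algebras $\mathcal G,\mathcal H\subset\mathcal F$ let $$\phi(\mathcal G,\mathcal H)=\sup\{|\mathbb P(B|A)-\mathbb P(B)|: A\in\mathcal G,\ B\in\mathcal H,\ \mathbb P(A)>0\},\qquad \rho(\mathcal G,\mathcal H)=\sup|\mathbb E[fg]|,$$ the last supremum being over square integrable $\mathcal G$-measurable $f$ and $\mathcal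 H$-measurable $g$ with mean $0$ and second moment $1$. Let $\phi_n(j)$ and $\rho_n(j)$ be the suprema over $k\ge0$ with $k+j\le n$ of $\phi(\mathcal F^{(n)}_{0,k},\mathcal F^{(n)}_{k+j,n})$ and $\rho(\mathcal F^{(n)}_{0,k},\mathcal F^{(n)}_{k+j,n})$, and $\phi(j)=\sup_{n\ge j}\phi_n(j)$. Fix $a,\eta>0$. Call real sequences $(K_n)$, $(A_n)$ and an integer sequence $(r_n)$ *admissible* if, for all $n\ge1$, $\max_{1\le j\le n}\|\xi_{j,n}\|_2\le K_n$, $1\le r_n\le n$, $A_n\ge1$, $\phi_n(j)\le A_ne^{-aj^\eta}$ for $1\le j\le n$; if $\sum_{m=1}^{\lfloor n/r_n\rfloor}\rho_n(r_nm)\le\frac14$ for all large $n$; and if, with $$C_n=2K_n\sum_{j=1}^n\rho_n(j),\quad D_n=1+2\sum_{j=1}^n\rho_n(j),\quad Q_n=2K_n^2D_nr_n+4C_nK_n\sqrt{D_nr_n},$$ $$j_n=1+\big(\ln(3A_n)/a\big)^{1/\eta},\qquad R_n=Q_n^{1/2}(K_{\infty,n}+j_n+1)A_n,$$ one has $Q_n\ge\varepsilon_0$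 for all $n\ge1$ and some $\varepsilon_0>0$, $Q_n=o(\sigma_n^2)$, $j_n=o(n)$, and there is a sequence $a_n\to\infty$ with $a_n\,(\sigma_n/R_n^{3})^{-1/(1+2\gamma)}\to0$, where $\gamma=1+\eta^{-1}$ (that is, $R_n^3=o(\sigma_n)$). **Theorem.** Let $Z$ be a standard normal random variable. 1. For all admissible $(K_n),(r_n),(A_n)$ there is a constant $C>0$ such that for every integer $p>2$ and every $n\ge1$ $$\left|\mathbb E[S_n^p]-\sigma_n^p\,\mathbb E[Z^p]\right|\le R_nC^p(p!)^{2+\eta^{-1}}\sum_{1\le u\le (p-1)/2}\frac{R_n^u\sigma_n^{2u}p^u}{(u!)^2},$$ and, for every fixed integer $p>2$, the right-hand side is $O(R_n^p\sigma_n^{p-1})$ as $n\to\infty$. 2. For all admissible sequences and every integer $p>2$: if $R_n^p/\sigma_n\to0$, then $\lim_{n\to\infty}\mathbb E[(S_n/\sigma_n)^p]=\mathbb E[Z^p]$. 3. For all admissible sequences for which $(R_n)$ is bounded, $\lim_{n\to\infty}\mathbb E[(S_n/\sigma_n)^p]=\mathbb E[Z^p]$ for every $p\in\mathbb N$. 4.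 If $\sup_nK_{\infty,n}<\infty$ and $\phi(j)\le A e^{-aj^\eta}$ for all $j\ge1$ and some constant $A>0$, then there are admissible sequences for which $(R_n)$ is bounded; consequently $\lim_{n\to\infty}\mathbb E[(S_n/\sigma_n)^p]=\mathbb E[Z^p]$ for every $p\in\mathbb N$. -/

import Mathlib

open MeasureTheory ProbabilityTheory Filter Topology Asymptotics
open scoped Nat

noncomputable section

namespace MixArray

/-- The `φ`-mixing coefficient of two sub-`σ`-algebras,
`sup {|P(B|A) - P(B)| : A ∈ G, B ∈ H, P(A) > 0}`. -/
def phiCoeff {Ω : Type*} (G H : MeasurableSpace Ω) {mΩ : MeasurableSpace Ω}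
    (P : Measure Ω) : ℝ :=
  sSup {x : ℝ | ∃ A B : Set Ω, MeasurableSet[G] A ∧ MeasurableSet[H] B ∧ 0 < P.real A ∧
    x = |P.real (A ∩ B) / P.real A - P.real B|}

/-- Membership in `B_{0,2}(G)`: square integrable, `G`-measurable, mean zero and second
moment one. -/
def IsUnitCentered {Ω : Type*} (G : MeasurableSpace Ω) {mΩ : MeasurableSpace Ω}
    (P : Measure Ω) (f : Ω → ℝ) : Prop :=
  Measurable[G] f ∧ MemLp f 2 P ∧ ∫ ω, f ω ∂P = 0 ∧ ∫ ω, f ω ^ 2 ∂P = 1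

/-- The `ρ`-mixing coefficient (maximal correlation) of two sub-`σ`-algebras,
`sup {|E[f g]| : f ∈ B_{0,2}(G), g ∈ B_{0,2}(H)}`. -/
def rhoCoeff {Ω : Type*} (G H : MeasurableSpace Ω) {mΩ : MeasurableSpace Ω}
    (P : Measure Ω) : ℝ :=
  sSup {x : ℝ | ∃ f h : Ω → ℝ, IsUnitCentered G P f ∧ IsUnitCentered H P h ∧
    x = |∫ ω, f ω * h ω ∂P|}

section Array

variable {Ω : Type*} {X : ℕ → ℕ → Type*} [mX : ∀ n j, MeasurableSpace (X n j)]

/-- `F_{a,b}^{(n)}`, the `σ`-algebra generated by `ζ_{j,n}`, `a ≤ j ≤ b`.  The row index `n`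
is written first throughout: `ζ n j` is `ζ_{j,n}`. -/
@[reducible] def rowSigma (ζ : ∀ n j, Ω → X n j) (n a b : ℕ) : MeasurableSpace Ω :=
  ⨆ j ∈ Set.Icc a b, MeasurableSpace.comap (ζ n j) (mX n j)

/-- `ξ_{j,n} = g_{j,n}(ζ_{j,n})`. -/
def xi (ζ : ∀ n j, Ω → X n j) (g : ∀ n j, X n j → ℝ) (n j : ℕ) : Ω → ℝ :=
  fun ω => g n j (ζ n j ω)

/-- `S_n = ∑_{j=1}^n ξ_{j,n}`. -/
def rowSum (ζ : ∀ n j, Ω → X n j) (g : ∀ n j, X n j → ℝ) (n : ℕ) : Ω → ℝ :=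
  fun ω => ∑ j ∈ Finset.Icc 1 n, xi ζ g n j ω

variable [mΩ : MeasurableSpace Ω]

/-- `φ_n(j) = sup {φ(F_{0,k}^{(n)}, F_{k+j,n}^{(n)}) : k ≥ 0, k + j ≤ n}`. -/
def phiRow (P : Measure Ω) (ζ : ∀ n j, Ω → X n j) (n j : ℕ) : ℝ :=
  sSup {x : ℝ | ∃ k : ℕ, k + j ≤ n ∧
    x = phiCoeff (rowSigma ζ n 0 k) (rowSigma ζ n (k + j) n) P}

/-- `ρ_n(j) = sup {ρ(F_{0,k}^{(n)}, F_{k+j,n}^{(n)}) : k ≥ 0, k + j ≤ n}`. -/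
def rhoRow (P : Measure Ω) (ζ : ∀ n j, Ω → X n j) (n j : ℕ) : ℝ :=
  sSup {x : ℝ | ∃ k : ℕ, k + j ≤ n ∧
    x = rhoCoeff (rowSigma ζ n 0 k) (rowSigma ζ n (k + j) n) P}

/-- The uniform coefficient `φ(j) = sup_{n ≥ j} φ_n(j)`. -/
def phiUnif (P : Measure Ω) (ζ : ∀ n j, Ω → X n j) (j : ℕ) : ℝ :=
  sSup {x : ℝ | ∃ n : ℕ, j ≤ n ∧ x = phiRow P ζ n j}

/-- `σ_n = √Var(S_n)`. -/
def sigma (P : Measure Ω) (ζ : ∀ n j, Ω → X n j) (g : ∀ n j, X n j → ℝ) (n : ℕ) : ℝ :=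
  Real.sqrt (variance (rowSum ζ g n) P)

/-- `K_{∞,n} = max_{1 ≤ j ≤ n} ‖ξ_{j,n}‖_∞`. -/
def Kinf (P : Measure Ω) (ζ : ∀ n j, Ω → X n j) (g : ∀ n j, X n j → ℝ) (n : ℕ) : ℝ :=
  ((Finset.Icc 1 n).sup fun j => eLpNorm (xi ζ g n j) ⊤ P).toReal

/-- `C_n = 2 K_n ∑_{j=1}^n ρ_n(j)`. -/
def Cseq (P : Measure Ω) (ζ : ∀ n j, Ω → X n j) (K : ℕ → ℝ) (n : ℕ) : ℝ :=
  2 * K n * ∑ j ∈ Finset.Icc 1 n, rhoRow P ζ n j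

/-- `D_n = 1 + 2 ∑_{j=1}^n ρ_n(j)`. -/
def Dseq (P : Measure Ω) (ζ : ∀ n j, Ω → X n j) (n : ℕ) : ℝ :=
  1 + 2 * ∑ j ∈ Finset.Icc 1 n, rhoRow P ζ n j

/-- `Q_n = 2 K_n² D_n r_n + 4 C_n K_n √(D_n r_n)`. -/
def Qseq (P : Measure Ω) (ζ : ∀ n j, Ω → X n j) (K : ℕ → ℝ) (r : ℕ → ℕ) (n : ℕ) : ℝ :=
  2 * K n ^ 2 * Dseq P ζ n * r n +
    4 * Cseq P ζ K n * K n * Real.sqrt (Dseq P ζ n * r n)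

/-- `j_n = 1 + (ln(3 A_n) / a)^{1/η}`. -/
def jseq (A : ℕ → ℝ) (a η : ℝ) (n : ℕ) : ℝ :=
  1 + (Real.log (3 * A n) / a) ^ (1 / η)

/-- `R_n = Q_n^{1/2} (K_{∞,n} + j_n + 1) A_n`. -/
def Rseq (P : Measure Ω) (ζ : ∀ n j, Ω → X n j) (g : ∀ n j, X n j → ℝ)
    (K : ℕ → ℝ) (r : ℕ → ℕ) (A : ℕ → ℝ) (a η : ℝ) (n : ℕ) : ℝ :=
  Real.sqrt (Qseq P ζ K r n) * (Kinf P ζ g n + jseq A a η n + 1) * A n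

/-- A triangular array of bounded centered variables `ξ_{j,n} = g_{j,n}(ζ_{j,n})`, for which
`σ_n → ∞`. -/
structure IsBoundedArray (P : Measure Ω) (ζ : ∀ n j, Ω → X n j)
    (g : ∀ n j, X n j → ℝ) : Prop where
  measurable_zeta : ∀ n j, j ≤ n → Measurable (ζ n j)
  measurable_g : ∀ n j, j ≤ n → Measurable (g n j)
  bounded : ∀ n j, 1 ≤ j → j ≤ n → MemLp (xi ζ g n j) ⊤ P
  centered : ∀ n j, 1 ≤ j → j ≤ n → ∫ ω, xi ζ g n j ω ∂P = 0
  sigma_tendsto : Tendsto (sigma P ζ g) atTop atTop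

/-- The choices of `K_n`, `r_n`, `A_n` that enter `Q_n` and `R_n`, with the growth restrictions
on `Q_n`, the mixing rate `φ_n(j) ≤ A_n e^{-a j^η}`, and the growth condition of moderate
deviations: there are speeds `b_n → ∞` with `b_n = o((σ_n / R_n³)^{1/(1+2γ)})`,
`γ = 1 + 1/η`.  Since the condition on `r_n` may be impossible to meet in the first
few rows, it is only imposed for large `n`. -/
structure IsAdmissible (P : Measure Ω) (ζ : ∀ n j, Ω → X n j) (g : ∀ n j, X n j → ℝ)
    (K : ℕ → ℝ) (r : ℕ → ℕ) (A : ℕ → ℝ) (a η : ℝ) : Prop where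
  norm_le : ∀ n j, 1 ≤ j → j ≤ n → (eLpNorm (xi ζ g n j) 2 P).toReal ≤ K n
  r_pos : ∀ n, 1 ≤ n → 1 ≤ r n
  r_le : ∀ n, 1 ≤ n → r n ≤ n
  sum_rho_le : ∀ᶠ n in atTop, ∑ m ∈ Finset.Icc 1 (n / r n), rhoRow P ζ n (r n * m) ≤ 1 / 4
  Q_lower : ∃ ε₀ : ℝ, 0 < ε₀ ∧ ∀ n, 1 ≤ n → ε₀ ≤ Qseq P ζ K r n
  Q_isLittleO : Qseq P ζ K r =o[atTop] fun n => sigma P ζ g n ^ 2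
  one_le_A : ∀ n, 1 ≤ n → 1 ≤ A n
  phi_le : ∀ n j : ℕ, 1 ≤ j → j ≤ n → phiRow P ζ n j ≤ A n * Real.exp (-(a * (j : ℝ) ^ η))
  j_isLittleO : jseq A a η =o[atTop] fun n : ℕ => (n : ℝ)
  exists_speed : ∃ b : ℕ → ℝ, Tendsto b atTop atTop ∧
    Tendsto (fun n => b n * (sigma P ζ g n / Rseq P ζ g K r A a η n ^ 3) ^
      (-(1 / (1 + 2 * (1 + 1 / η))))) atTop (𝓝 0)

/-- `E[S_n^p]`. -/
def rowMoment (P : Measure Ω) (ζ : ∀ n j, Ω → X n j) (g : ∀ n j, X n j → ℝ) (p n : ℕ) : ℝ :=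
  ∫ ω, rowSum ζ g n ω ^ p ∂P

/-- `E[(S_n / σ_n)^p]`. -/
def normMoment (P : Measure Ω) (ζ : ∀ n j, Ω → X n j) (g : ∀ n j, X n j → ℝ) (p n : ℕ) : ℝ :=
  ∫ ω, (rowSum ζ g n ω / sigma P ζ g n) ^ p ∂P

end Array

/-- `E[Z^p]` for a standard normal `Z`. -/
def gaussMoment (p : ℕ) : ℝ := ∫ x : ℝ, x ^ p ∂(gaussianReal 0 1)

/-- The bound `R C^p (p!)^{2+1/η} ∑_{1 ≤ u ≤ (p-1)/2} R^u σ^{2u} p^u / (u!)²`. -/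
def rosenthalBound (C η R s : ℝ) (p : ℕ) : ℝ :=
  R * C ^ p * (p ! : ℝ) ^ (2 + 1 / η) *
    ∑ u ∈ Finset.Icc 1 ((p - 1) / 2), R ^ u * s ^ (2 * u) * (p : ℝ) ^ u / (u ! : ℝ) ^ 2

end MixArray

end

open MixArray

/-!
The moments of a row sum `S` are compared with those of the normal distribution through the
cumulants. If `E S = 0`, `Var S = s²` and the cumulants satisfy
`|κ_k| ≤ s² R^{k-2} (C k^b)^k` for `k ≥ 3`, then in the expansion of `E S^p` into products of
cumulants over the set partitions of `p` points the pair partitions give `s^p E Z^p`, and every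
other partition loses at least a factor `R / s`. The recursion between moments and cumulants
(`abs_moment_sub_gauss_le`) makes this precise for orders with `p! ≤ s⁴`: there the powers `k^{bk}`,
`k ≤ p`, are absorbed by `(R / s)^{k-4}`, because a fixed power of `k` is at most a constant times
`k!`, and `R³ ≤ s`. For larger `p` the crude bound `E |S|^p ≤ C^p p! s^p` is enough: the claimed
bound contains `(p!)²`, and the spare factorial makes up for the missing powers of `s`. Both regimes
are in `exists_moment_bound`.

Crude bounds and cumulant bounds come from the same tail estimate. For a `φ`-mixing sequence of
variables bounded by `K`, whose partial sums have variances at most `v`, an inequality of Ottaviani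
type together with the Hoffmann-Jørgensen argument shows that the tail of the maximal partial sum
decays geometrically in units of `√v + J K`, where `J` is a distance at which the `φ`-coefficients
have dropped below `1/3`. Hence the moments of a partial sum grow like those of an exponential variable
(`integral_abs_ivlSum_pow_le`).

For the cumulants the row is cut greedily into blocks whose variance is comparable with `Q`. As the
correlations at multiples of `r` are summable with a small sum, the variances of the blocks nearly
add up, so there are at most a constant times `s² / Q` blocks (`IsBlocks.card_mul_le`). A joint
cumulant of blocks is small if the blocks split into two groups with a large gap between them,
because the joint moments nearly factorize across the gap (`abs_jointCumulant_le_of_split`), and a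
covariance is controlled by the `ρ`-coefficient, which is at most `2 √φ`. Summation over all
tuples of blocks then costs only a constant power of `k` per factor, and each cumulant is
linear in the number of blocks (`abs_cumulantSeq_le`). The rows that are too short for this
argument are finitely many, and a large constant takes care of them.

Under a uniform mixing rate the correlation coefficients are summable uniformly in the row, so
constant sequences are admissible (`IsBoundedArray.exists_isAdmissible`).
-/

noncomputable section

namespace MixArray

/-! ### Joint cumulants of a moment function -/

section Cumulant

variable {ι : Type*} [LinearOrder ι]

/-- The joint cumulants belonging to a family `μ B` of joint moments, indexed by finite sets of
labels.  They are defined through `μ s = ∑ κ B * μ (s \ B)`, the sum being over the subsets `B`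
of `s` that contain the least element of `s`; the cumulant of the empty set is `0`. -/
def jointCumulant (μ : Finset ι → ℝ) (s : Finset ι) : ℝ :=
  if h : s.Nonempty then
    μ s - ∑ B ∈ (s.erase (s.min' h)).ssubsets.attach,
      jointCumulant μ (insert (s.min' h) B.1) * μ (s.erase (s.min' h) \ B.1)
  else 0
termination_by s.card
decreasing_by
  have h1 := Finset.card_lt_card (Finset.mem_ssubsets.1 B.2)
  have h2 := Finset.card_insert_le (s.min' h) B.1
  have h3 := Finset.card_erase_add_one (s.min'_mem h)
  omega

lemma jointCumulant_eq (μ : Finset ι → ℝ) {s : Finset ι} (h : s.Nonempty) :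
    jointCumulant μ s = μ s - ∑ B ∈ (s.erase (s.min' h)).ssubsets,
      jointCumulant μ (insert (s.min' h) B) * μ (s.erase (s.min' h) \ B) := by
  rw [jointCumulant, dif_pos h]
  congr 1
  exact Finset.sum_attach (s.erase (s.min' h)).ssubsets
    (fun B => jointCumulant μ (insert (s.min' h) B) * μ (s.erase (s.min' h) \ B))

lemma moment_eq_sum_jointCumulant (μ : Finset ι → ℝ) (h0 : μ ∅ = 1) {s : Finset ι}
    (h : s.Nonempty) :
    μ s = ∑ B ∈ (s.erase (s.min' h)).powerset,
      jointCumulant μ (insert (s.min' h) B) * μ (s.erase (s.min' h) \ B) := by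
  have key := jointCumulant_eq μ h
  have hp : (s.erase (s.min' h)).powerset
      = insert (s.erase (s.min' h)) (s.erase (s.min' h)).ssubsets := by
    rw [Finset.ssubsets, Finset.insert_erase]
    exact Finset.mem_powerset_self _
  rw [hp, Finset.sum_insert (by simp [Finset.mem_ssubsets]),
    Finset.insert_erase (s.min'_mem h), Finset.sdiff_self, h0, key]
  ring

/-- The parts `insert (min s) B` that occur in the recursion are smaller subsets of `s`, which
makes induction on the cardinality possible. -/
lemma insert_min'_card_lt {s : Finset ι} (h : s.Nonempty) {B : Finset ι}
    (hB : B ∈ (s.erase (s.min' h)).ssubsets) :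
    (insert (s.min' h) B).card < s.card ∧ insert (s.min' h) B ⊆ s ∧ s.min' h ∉ B ∧
      (s.erase (s.min' h) \ B).Nonempty := by
  have hB' := Finset.mem_ssubsets.1 hB
  have h1 := Finset.card_lt_card hB'
  have h2 := Finset.card_insert_le (s.min' h) B
  have h3 := Finset.card_erase_add_one (s.min'_mem h)
  refine ⟨by omega, ?_, fun hm => ?_, ?_⟩
  · exact Finset.insert_subset (s.min'_mem h) (hB'.1.trans (Finset.erase_subset _ _))
  · exact Finset.notMem_erase _ _ (hB'.1 hm)
  · exact Finset.sdiff_nonempty.2 hB'.2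

lemma jointCumulant_congr {μ ν : Finset ι → ℝ} {s : Finset ι} (h : ∀ B ⊆ s, μ B = ν B) :
    jointCumulant μ s = jointCumulant ν s := by
  induction hn : s.card using Nat.strong_induction_on generalizing s with
  | _ n ih =>
  by_cases hs : s.Nonempty
  · rw [jointCumulant_eq μ hs, jointCumulant_eq ν hs, h s subset_rfl]
    congr 1
    refine Finset.sum_congr rfl fun B hB => ?_
    obtain ⟨h1, h2, -, -⟩ := insert_min'_card_lt hs hB
    rw [ih _ (hn ▸ h1) (fun C hC => h C (hC.trans h2)) rfl,
      h _ (Finset.sdiff_subset.trans (Finset.erase_subset _ _))]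
  · rw [jointCumulant, jointCumulant, dif_neg hs, dif_neg hs]

/-- If the moments of the sets containing a label `i` depend linearly on some data, while the
moments of the other sets do not depend on it, then so do the joint cumulants. -/
lemma jointCumulant_linear {μ μ₁ μ₂ : Finset ι → ℝ} {a b : ℝ} {i : ι}
    (hmem : ∀ B : Finset ι, i ∈ B → μ B = a * μ₁ B + b * μ₂ B)
    (h₁ : ∀ B : Finset ι, i ∉ B → μ₁ B = μ B) (h₂ : ∀ B : Finset ι, i ∉ B → μ₂ B = μ B)
    {s : Finset ι} (his : i ∈ s) :
    jointCumulant μ s = a * jointCumulant μ₁ s + b * jointCumulant μ₂ s := by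
  induction hn : s.card using Nat.strong_induction_on generalizing s with
  | _ n ih =>
  have hs : s.Nonempty := ⟨i, his⟩
  have key : ∑ B ∈ (s.erase (s.min' hs)).ssubsets,
      jointCumulant μ (insert (s.min' hs) B) * μ (s.erase (s.min' hs) \ B)
      = ∑ B ∈ (s.erase (s.min' hs)).ssubsets,
        (a * (jointCumulant μ₁ (insert (s.min' hs) B) * μ₁ (s.erase (s.min' hs) \ B)) +
         b * (jointCumulant μ₂ (insert (s.min' hs) B) * μ₂ (s.erase (s.min' hs) \ B))) := by
    refine Finset.sum_congr rfl fun B hB => ?_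
    obtain ⟨hlt, hsub, hnB, hne⟩ := insert_min'_card_lt hs hB
    by_cases hi : i ∈ insert (s.min' hs) B
    · have hi' : i ∉ s.erase (s.min' hs) \ B := by
        intro hh
        rw [Finset.mem_sdiff, Finset.mem_erase] at hh
        rw [Finset.mem_insert] at hi
        tauto
      rw [ih _ (hn ▸ hlt) hi rfl, h₁ _ hi', h₂ _ hi']
      ring
    · have hi' : i ∈ s.erase (s.min' hs) \ B := by
        rw [Finset.mem_sdiff, Finset.mem_erase]
        rw [Finset.mem_insert] at hi
        tauto
      have e₁ : jointCumulant μ₁ (insert (s.min' hs) B) = jointCumulant μ (insert (s.min' hs) B) :=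
        jointCumulant_congr fun C hC => h₁ C fun hh => hi (hC hh)
      have e₂ : jointCumulant μ₂ (insert (s.min' hs) B) = jointCumulant μ (insert (s.min' hs) B) :=
        jointCumulant_congr fun C hC => h₂ C fun hh => hi (hC hh)
      rw [hmem _ hi', e₁, e₂]
      ring
  rw [jointCumulant_eq μ hs, jointCumulant_eq μ₁ hs, jointCumulant_eq μ₂ hs, hmem s his, key,
    Finset.sum_add_distrib, ← Finset.mul_sum, ← Finset.mul_sum]
  ring

/-- The combinatorial sum behind the factorial growth of joint cumulants. -/
lemma sum_ssubsets_factorial_le {T : Finset ι} {W : ℝ} (hW : 0 ≤ W) :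
    (∑ B ∈ T.ssubsets, W ^ (B.card + 1) * ((B.card + 1)! : ℝ) ^ 2 *
        (W ^ (T.card - B.card) * ((T.card - B.card)! : ℝ))) + W ^ (T.card + 1) * ((T.card + 1)! : ℝ)
      ≤ W ^ (T.card + 1) * ((T.card + 1)! : ℝ) ^ 2 := by
  set n := T.card with hn
  have hterm : ∀ j ∈ Finset.range n,
      (n.choose j : ℝ) * (W ^ (j + 1) * ((j + 1)! : ℝ) ^ 2 * (W ^ (n - j) * ((n - j)! : ℝ)))
        = W ^ (n + 1) * (n ! : ℝ) * (((j + 2)! : ℝ) - ((j + 1)! : ℝ)) := by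
    intro j hj
    have hj' : j < n := Finset.mem_range.1 hj
    have hc : (n.choose j : ℝ) * (j ! : ℝ) * ((n - j)! : ℝ) = (n ! : ℝ) := by
      exact_mod_cast Nat.choose_mul_factorial_mul_factorial hj'.le
    have hw : W ^ (j + 1) * W ^ (n - j) = W ^ (n + 1) := by
      rw [← pow_add]; congr 1; omega
    have e1 : ((j + 1)! : ℝ) = (j + 1) * (j ! : ℝ) := by
      rw [Nat.factorial_succ]; push_cast; ring
    have e2 : ((j + 2)! : ℝ) = (j + 2) * ((j + 1)! : ℝ) := by
      rw [Nat.factorial_succ (j + 1)]; push_cast; ring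
    rw [e2, ← hw, ← hc]
    rw [e1]
    ring
  have hsum : (∑ B ∈ T.ssubsets, W ^ (B.card + 1) * ((B.card + 1)! : ℝ) ^ 2 *
        (W ^ (n - B.card) * ((n - B.card)! : ℝ)))
      = W ^ (n + 1) * (n ! : ℝ) * (((n + 1)! : ℝ) - 1) := by
    have h1 := Finset.sum_powerset_apply_card (fun j : ℕ => W ^ (j + 1) * ((j + 1)! : ℝ) ^ 2 *
        (W ^ (n - j) * ((n - j)! : ℝ))) (x := T)
    have hp : T.powerset = insert T T.ssubsets := by
      rw [Finset.ssubsets, Finset.insert_erase]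
      exact Finset.mem_powerset_self _
    rw [hp, Finset.sum_insert (by simp [Finset.mem_ssubsets]), ← hn, Finset.sum_range_succ] at h1
    simp only [nsmul_eq_mul, Nat.choose_self, Nat.cast_one, one_mul] at h1
    rw [Finset.sum_congr rfl hterm, ← Finset.mul_sum, Finset.sum_range_sub
      (fun j => ((j + 1)! : ℝ))] at h1
    simp only [zero_add, Nat.factorial_one, Nat.cast_one] at h1
    linarith
  rw [hsum]
  have e1 : ((n + 1)! : ℝ) = (n + 1) * (n ! : ℝ) := by
    rw [Nat.factorial_succ]; push_cast; ring
  have hn1 : (1 : ℝ) ≤ (n ! : ℝ) := by exact_mod_cast Nat.one_le_iff_ne_zero.2 n.factorial_ne_zero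
  have hn0 : (0 : ℝ) ≤ n := Nat.cast_nonneg n
  have hWn : 0 ≤ W ^ (n + 1) * (n ! : ℝ) := by positivity
  have : (n + 1)! - 1 + (n + 1 : ℝ) ≤ (n + 1) * ((n + 1)! : ℝ) := by
    rw [e1]; nlinarith [mul_nonneg hn0 (sub_nonneg.2 hn1), mul_nonneg (mul_nonneg hn0 hn0) (sub_nonneg.2 hn1)]
  calc W ^ (n + 1) * (n ! : ℝ) * (((n + 1)! : ℝ) - 1) + W ^ (n + 1) * ((n + 1)! : ℝ)
      = W ^ (n + 1) * (n ! : ℝ) * (((n + 1)! : ℝ) - 1 + (n + 1 : ℝ)) := by rw [e1]; ring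
    _ ≤ W ^ (n + 1) * (n ! : ℝ) * ((n + 1) * ((n + 1)! : ℝ)) :=
        mul_le_mul_of_nonneg_left this hWn
    _ = _ := by rw [e1]; ring

variable {μ : Finset ι → ℝ} {W θ : ℝ}

lemma abs_jointCumulant_le (hW : 0 ≤ W) (hθ : 0 ≤ θ) (hθ1 : θ ≤ 1) {s : Finset ι}
    (hμ : ∀ B ⊆ s, B.Nonempty → |μ B| ≤ θ * (W ^ B.card * (B.card ! : ℝ))) :
    |jointCumulant μ s| ≤ θ * (W ^ s.card * (s.card ! : ℝ) ^ 2) := by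
  induction hn : s.card using Nat.strong_induction_on generalizing s with
  | _ n ih =>
  by_cases hs : s.Nonempty
  swap
  · rw [jointCumulant, dif_neg hs, abs_zero]; positivity
  have hcard : (s.erase (s.min' hs)).card + 1 = s.card := Finset.card_erase_add_one (s.min'_mem hs)
  have hsum := sum_ssubsets_factorial_le (T := s.erase (s.min' hs)) hW
  rw [hcard, hn] at hsum
  rw [jointCumulant_eq μ hs]
  have hterm : ∀ B ∈ (s.erase (s.min' hs)).ssubsets,
      |jointCumulant μ (insert (s.min' hs) B) * μ (s.erase (s.min' hs) \ B)| ≤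
      θ * (W ^ (B.card + 1) * ((B.card + 1)! : ℝ) ^ 2 *
        (W ^ ((s.erase (s.min' hs)).card - B.card) *
          (((s.erase (s.min' hs)).card - B.card)! : ℝ))) := by
    intro B hB
    obtain ⟨hlt, hsub, hnB, hne⟩ := insert_min'_card_lt hs hB
    have k1 := ih _ (hn ▸ hlt) (fun C hC => hμ C (hC.trans hsub)) rfl
    have k2 := hμ _ (Finset.sdiff_subset.trans (Finset.erase_subset _ _)) hne
    rw [Finset.card_insert_of_notMem hnB] at k1
    rw [Finset.card_sdiff_of_subset (Finset.mem_ssubsets.1 hB).1] at k2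
    rw [abs_mul]
    calc _ ≤ (W ^ (B.card + 1) * ((B.card + 1)! : ℝ) ^ 2) * _ := by
          refine mul_le_mul (k1.trans ?_) k2 (abs_nonneg _) (by positivity)
          exact mul_le_of_le_one_left (by positivity) hθ1
      _ = _ := by ring
  have h1 := hμ s subset_rfl hs
  calc _ ≤ |μ s| + |∑ B ∈ (s.erase (s.min' hs)).ssubsets,
        jointCumulant μ (insert (s.min' hs) B) * μ (s.erase (s.min' hs) \ B)| := abs_sub _ _
    _ ≤ θ * (W ^ n * (n ! : ℝ)) + _ := by
        refine add_le_add (by rwa [hn] at h1)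
          ((Finset.abs_sum_le_sum_abs _ _).trans (Finset.sum_le_sum hterm))
    _ ≤ _ := by
        rw [← Finset.mul_sum, ← mul_add, add_comm]
        exact mul_le_mul_of_nonneg_left hsum hθ

/-- Joint cumulants of a family that splits into two almost independent parts are small: this is
the quantitative form of the vanishing of mixed cumulants of independent families. -/
lemma abs_jointCumulant_le_of_split {ε : ℝ} (hW : 0 ≤ W) (hθ : 0 ≤ θ) (hθ1 : θ ≤ 1) (hε : 0 ≤ ε)
    (h0 : μ ∅ = 1) {s : Finset ι}
    (hμ : ∀ B ⊆ s, B.Nonempty → |μ B| ≤ θ * (W ^ B.card * (B.card ! : ℝ))) (p : ι → Prop)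
    [DecidablePred p]
    (hsplit : ∀ B ⊆ s, (∃ x ∈ B, p x) → (∃ x ∈ B, ¬ p x) →
      |μ B - μ (B.filter p) * μ (B.filter fun x => ¬ p x)| ≤
        ε * θ * (W ^ B.card * (B.card ! : ℝ)))
    (hp : ∃ x ∈ s, p x) (hq : ∃ x ∈ s, ¬ p x) :
    |jointCumulant μ s| ≤ ε * θ * (W ^ s.card * (s.card ! : ℝ) ^ 2) := by
  induction hn : s.card using Nat.strong_induction_on generalizing s p with
  | _ n ih =>
  have hs : s.Nonempty := ⟨hp.choose, hp.choose_spec.1⟩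
  -- by symmetry the least element may be taken to satisfy `p`
  wlog hx : p (s.min' hs) generalizing p
  · refine this (fun x => ¬ p x) ?_ hq (by simpa using hp) hx
    intro B hB h1 h2
    have := hsplit B hB (by simpa using h2) h1
    simp only [not_not]
    rwa [mul_comm (μ (B.filter fun x => ¬ p x))]
  set x := s.min' hs with hxdef
  set T := s.erase x with hT
  have hxs : x ∈ s := s.min'_mem hs
  have hcard : T.card + 1 = s.card := Finset.card_erase_add_one hxs
  have hsum := sum_ssubsets_factorial_le (T := T) hW
  rw [hcard, hn] at hsum
  set I := T.filter p with hI
  set I' := T.filter (fun y => ¬ p y) with hI'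
  obtain ⟨z, hzs, hz⟩ := hq
  have hzT : z ∈ T := Finset.mem_erase.2 ⟨fun h => hz (h ▸ hx), hzs⟩
  have hIT : I ⊂ T := by
    refine Finset.filter_ssubset.2 ⟨z, hzT, hz⟩
  have hsp : s.filter p = insert x I := by
    rw [hI, hT, Finset.filter_erase, Finset.insert_erase]
    exact Finset.mem_filter.2 ⟨hxs, hx⟩
  have hsq : s.filter (fun y => ¬ p y) = I' := by
    rw [hI', hT, Finset.filter_erase, Finset.erase_eq_of_notMem]
    simp [hx]
  -- the cumulant expansion of the moment of the first part
  have hmin : ∀ h : (insert x I).Nonempty, (insert x I).min' h = x := by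
    intro h
    refine le_antisymm (Finset.min'_le _ _ (Finset.mem_insert_self _ _)) ?_
    refine Finset.le_min' _ _ _ fun y hy => s.min'_le y ?_
    rcases Finset.mem_insert.1 hy with rfl | hy
    · exact hxs
    · exact Finset.mem_of_mem_erase (Finset.mem_filter.1 hy).1
  have hxI : x ∉ I := fun h => Finset.notMem_erase x s (Finset.mem_filter.1 h).1
  have hexp : μ (insert x I) = ∑ B ∈ I.powerset, jointCumulant μ (insert x B) * μ (I \ B) := by
    have hne : (insert x I).Nonempty := ⟨x, Finset.mem_insert_self _ _⟩
    have := moment_eq_sum_jointCumulant μ h0 hne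
    rwa [hmin hne, Finset.erase_insert hxI] at this
  have hexp' : μ (s.filter p) * μ (s.filter fun y => ¬ p y)
      = ∑ B ∈ T.ssubsets, jointCumulant μ (insert x B) *
          (if B ⊆ I then μ (I \ B) * μ I' else 0) := by
    rw [hsp, hsq, hexp, Finset.sum_mul]
    have hsubset : I.powerset ⊆ T.ssubsets := by
      intro B hB
      exact Finset.mem_ssubsets.2 (lt_of_le_of_lt (Finset.mem_powerset.1 hB) hIT)
    rw [← Finset.sum_subset hsubset (f := fun B => jointCumulant μ (insert x B) *
          (if B ⊆ I then μ (I \ B) * μ I' else 0))]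
    · refine Finset.sum_congr rfl fun B hB => ?_
      rw [if_pos (Finset.mem_powerset.1 hB), mul_assoc]
    · intro B _ hB
      rw [if_neg fun h => hB (Finset.mem_powerset.2 h), mul_zero]
  have hkey : jointCumulant μ s = (μ s - μ (s.filter p) * μ (s.filter fun y => ¬ p y)) -
      ∑ B ∈ T.ssubsets, jointCumulant μ (insert x B) *
        (μ (T \ B) - (if B ⊆ I then μ (I \ B) * μ I' else 0)) := by
    rw [jointCumulant_eq μ hs, hexp']
    simp only [mul_sub, Finset.sum_sub_distrib]
    ring
  have hterm : ∀ B ∈ T.ssubsets,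
      |jointCumulant μ (insert x B) * (μ (T \ B) - (if B ⊆ I then μ (I \ B) * μ I' else 0))| ≤
      ε * θ * (W ^ (B.card + 1) * ((B.card + 1)! : ℝ) ^ 2 *
        (W ^ (T.card - B.card) * ((T.card - B.card)! : ℝ))) := by
    intro B hB
    obtain ⟨hlt, hsub, hnB, hne⟩ := insert_min'_card_lt hs hB
    have hBT := (Finset.mem_ssubsets.1 hB).1
    have hTs : T ⊆ s := Finset.erase_subset _ _
    have hDs : T \ B ⊆ s := Finset.sdiff_subset.trans hTs
    rw [abs_mul]
    by_cases hBI : B ⊆ I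
    · rw [if_pos hBI]
      have k1 := abs_jointCumulant_le hW hθ hθ1 (s := insert x B)
        (fun C hC => hμ C (hC.trans hsub))
      rw [Finset.card_insert_of_notMem hnB] at k1
      have k1' : |jointCumulant μ (insert x B)| ≤ W ^ (B.card + 1) * ((B.card + 1)! : ℝ) ^ 2 :=
        k1.trans (mul_le_of_le_one_left (by positivity) hθ1)
      have e1 : (T \ B).filter p = I \ B := by
        ext y; simp only [hI, Finset.mem_filter, Finset.mem_sdiff]; tauto
      have e2 : (T \ B).filter (fun y => ¬ p y) = I' := by
        ext y
        simp only [hI', Finset.mem_filter, Finset.mem_sdiff]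
        constructor
        · tauto
        · intro hy
          exact ⟨⟨hy.1, fun hyB => hy.2 (Finset.mem_filter.1 (hBI hyB)).2⟩, hy.2⟩
      have k2 : |μ (T \ B) - μ (I \ B) * μ I'| ≤
          ε * θ * (W ^ (T.card - B.card) * ((T.card - B.card)! : ℝ)) := by
        by_cases hIB : (I \ B).Nonempty
        · obtain ⟨y, hy⟩ := hIB
          have hy' := Finset.mem_sdiff.1 hy
          have hyT := Finset.mem_filter.1 hy'.1
          have := hsplit (T \ B) hDs ⟨y, Finset.mem_sdiff.2 ⟨hyT.1, hy'.2⟩, hyT.2⟩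
            ⟨z, Finset.mem_sdiff.2 ⟨hzT, fun h => hz (Finset.mem_filter.1 (hBI h)).2⟩, hz⟩
          rwa [e1, e2, Finset.card_sdiff_of_subset hBT] at this
        · have e3 : I \ B = ∅ := Finset.not_nonempty_iff_eq_empty.1 hIB
          have e4 : T \ B = I' := by
            rw [← e2]
            refine (Finset.filter_true_of_mem (p := fun y => ¬ p y)
              fun y hy hpy => hIB ⟨y, ?_⟩).symm
            rw [← e1]; exact Finset.mem_filter.2 ⟨hy, hpy⟩
          rw [e3, e4, h0, one_mul, sub_self, abs_zero]
          positivity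
      calc _ ≤ (W ^ (B.card + 1) * ((B.card + 1)! : ℝ) ^ 2) * _ :=
            mul_le_mul k1' k2 (abs_nonneg _) (by positivity)
        _ = _ := by ring
    · rw [if_neg hBI, sub_zero]
      obtain ⟨y, hyB, hyI⟩ := Finset.not_subset.1 hBI
      have hpy : ¬ p y := fun h => hyI (Finset.mem_filter.2 ⟨hBT hyB, h⟩)
      have k1 := ih _ (hn ▸ hlt) (fun C hC => hμ C (hC.trans hsub)) p
        (fun C hC => hsplit C (hC.trans hsub)) ⟨x, Finset.mem_insert_self _ _, hx⟩
        ⟨y, Finset.mem_insert_of_mem hyB, hpy⟩ rfl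
      have k2 := hμ _ hDs hne
      rw [Finset.card_insert_of_notMem hnB] at k1
      rw [Finset.card_sdiff_of_subset hBT] at k2
      calc _ ≤ (ε * θ * (W ^ (B.card + 1) * ((B.card + 1)! : ℝ) ^ 2)) *
            (W ^ (T.card - B.card) * ((T.card - B.card)! : ℝ)) := by
            refine mul_le_mul k1 (k2.trans ?_) (abs_nonneg _) (by positivity)
            exact mul_le_of_le_one_left (by positivity) hθ1
        _ = _ := by ring
  rw [hkey]
  have h1 := hsplit s subset_rfl hp ⟨z, hzs, hz⟩
  rw [hn] at h1
  calc _ ≤ |μ s - μ (s.filter p) * μ (s.filter fun y => ¬ p y)| +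
        |∑ B ∈ T.ssubsets, jointCumulant μ (insert x B) *
        (μ (T \ B) - (if B ⊆ I then μ (I \ B) * μ I' else 0))| := abs_sub _ _
    _ ≤ ε * θ * (W ^ n * (n ! : ℝ)) + _ :=
        add_le_add h1 ((Finset.abs_sum_le_sum_abs _ _).trans (Finset.sum_le_sum hterm))
    _ ≤ _ := by
        rw [← Finset.mul_sum, ← mul_add, add_comm]
        exact mul_le_mul_of_nonneg_left hsum (by positivity)

/-- The cumulants belonging to a sequence of moments. -/
def cumulantSeq (m : ℕ → ℝ) : ℕ → ℝ
  | 0 => 0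
  | q + 1 => m (q + 1) - ∑ j : Fin q, (q.choose j : ℝ) * cumulantSeq m (j + 1) * m (q - j)

lemma moment_eq_sum_cumulantSeq (m : ℕ → ℝ) (h0 : m 0 = 1) (q : ℕ) :
    m (q + 1) = ∑ j ∈ Finset.range (q + 1),
      (q.choose j : ℝ) * cumulantSeq m (j + 1) * m (q - j) := by
  rw [Finset.sum_range_succ, Nat.sub_self, h0, Nat.choose_self, cumulantSeq,
    Finset.sum_range (fun j => (q.choose j : ℝ) * cumulantSeq m (j + 1) * m (q - j))]
  push_cast
  ring

lemma jointCumulant_card (m : ℕ → ℝ) (s : Finset ι) :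
    jointCumulant (fun B => m B.card) s = cumulantSeq m s.card := by
  induction hn : s.card using Nat.strong_induction_on generalizing s with
  | _ n ih =>
  by_cases hs : s.Nonempty
  swap
  · rw [jointCumulant, dif_neg hs]
    rw [Finset.not_nonempty_iff_eq_empty.1 hs, Finset.card_empty] at hn
    rw [← hn, cumulantSeq]
  have hcard : (s.erase (s.min' hs)).card + 1 = s.card := Finset.card_erase_add_one (s.min'_mem hs)
  set T := s.erase (s.min' hs) with hT
  obtain ⟨q, rfl⟩ : ∃ q, n = q + 1 := ⟨T.card, by omega⟩
  have hq : T.card = q := by omega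
  rw [jointCumulant_eq _ hs, cumulantSeq, hn]
  congr 1
  have h1 := Finset.sum_powerset_apply_card
    (fun j : ℕ => if j < q then cumulantSeq m (j + 1) * m (q - j) else 0) (x := T)
  have hp : T.powerset = insert T T.ssubsets := by
    rw [Finset.ssubsets, Finset.insert_erase]
    exact Finset.mem_powerset_self _
  rw [hp, Finset.sum_insert (by simp [Finset.mem_ssubsets]), hq, Finset.sum_range_succ] at h1
  simp only [lt_irrefl, if_false, zero_add, smul_zero, add_zero, nsmul_eq_mul] at h1
  rw [← Finset.sum_range (fun j => (q.choose j : ℝ) * cumulantSeq m (j + 1) * m (q - j))]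
  calc _ = ∑ B ∈ T.ssubsets, if B.card < q then cumulantSeq m (B.card + 1) * m (q - B.card) else 0 := by
        refine Finset.sum_congr rfl fun B hB => ?_
        obtain ⟨hlt, hsub, hnB, hne⟩ := insert_min'_card_lt hs hB
        have hBT := Finset.mem_ssubsets.1 hB
        have hlt' := Finset.card_lt_card hBT
        rw [if_pos (by omega), ih _ (by omega) _ rfl, Finset.card_insert_of_notMem hnB,
          Finset.card_sdiff_of_subset hBT.1, hq]
    _ = _ := by
        rw [h1]
        refine Finset.sum_congr rfl fun j hj => ?_
        rw [if_pos (Finset.mem_range.1 hj), mul_assoc]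

end Cumulant

section Multilinear

variable {ι : Type*} [LinearOrder ι] {V : Type*} [CommRing V] [Algebra ℝ V]

/-- The joint moments of the elements `X i` of an algebra under a linear functional `E`. -/
def jointMoment (E : V →ₗ[ℝ] ℝ) (X : ι → V) (B : Finset ι) : ℝ := E (∏ i ∈ B, X i)

lemma jointMoment_update_of_notMem (E : V →ₗ[ℝ] ℝ) (X : ι → V) {i : ι} (v : V) {B : Finset ι}
    (h : i ∉ B) : jointMoment E (Function.update X i v) B = jointMoment E X B := by
  unfold jointMoment
  congr 1
  refine Finset.prod_congr rfl fun j hj => ?_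
  rw [Function.update_of_ne]
  rintro rfl
  exact h hj

lemma jointMoment_update_of_mem (E : V →ₗ[ℝ] ℝ) (X : ι → V) {i : ι} (v : V) {B : Finset ι}
    (h : i ∈ B) : jointMoment E (Function.update X i v) B = E (v * ∏ j ∈ B.erase i, X j) := by
  unfold jointMoment
  rw [← Finset.mul_prod_erase B _ h, Function.update_self]
  congr 2
  refine Finset.prod_congr rfl fun j hj => ?_
  rw [Function.update_of_ne (Finset.ne_of_mem_erase hj)]

/-- The joint cumulant of all labels as a multilinear map. -/
def jointCumulantMultilinear [Fintype ι] (E : V →ₗ[ℝ] ℝ) :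
    MultilinearMap ℝ (fun _ : ι => V) ℝ where
  toFun X := jointCumulant (jointMoment E X) Finset.univ
  map_update_add' X i v w := by
    obtain rfl : ‹DecidableEq ι› = LinearOrder.toDecidableEq := Subsingleton.elim _ _
    have := jointCumulant_linear (μ := jointMoment E (Function.update X i (v + w)))
      (μ₁ := jointMoment E (Function.update X i v)) (μ₂ := jointMoment E (Function.update X i w))
      (a := 1) (b := 1) (i := i) (s := Finset.univ)
      (fun B hB => by
        simp only [jointMoment_update_of_mem E X _ hB, add_mul, map_add, one_mul])
      (fun B hB => by simp only [jointMoment_update_of_notMem E X _ hB])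
      (fun B hB => by simp only [jointMoment_update_of_notMem E X _ hB]) (Finset.mem_univ i)
    simpa using this
  map_update_smul' X i c v := by
    obtain rfl : ‹DecidableEq ι› = LinearOrder.toDecidableEq := Subsingleton.elim _ _
    have := jointCumulant_linear (μ := jointMoment E (Function.update X i (c • v)))
      (μ₁ := jointMoment E (Function.update X i v)) (μ₂ := jointMoment E (Function.update X i v))
      (a := c) (b := 0) (i := i) (s := Finset.univ)
      (fun B hB => by
        simp only [jointMoment_update_of_mem E X _ hB, smul_mul_assoc, map_smul, smul_eq_mul,
          zero_mul, add_zero])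
      (fun B hB => by simp only [jointMoment_update_of_notMem E X _ hB])
      (fun B hB => by simp only [jointMoment_update_of_notMem E X _ hB]) (Finset.mem_univ i)
    simpa using this

/-- The `k`-th cumulant of a sum is the sum of the joint cumulants of all `k`-tuples of
summands. -/
lemma cumulantSeq_sum (E : V →ₗ[ℝ] ℝ) {N : ℕ} (Y : Fin N → V) (k : ℕ) :
    cumulantSeq (fun q => E ((∑ i, Y i) ^ q)) k
      = ∑ f : Fin k → Fin N, jointCumulant (jointMoment E fun x => Y (f x)) Finset.univ := by
  have h := MultilinearMap.map_sum (jointCumulantMultilinear (ι := Fin k) E)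
    (fun _ (j : Fin N) => Y j)
  have e : jointCumulantMultilinear (ι := Fin k) E (fun _ => ∑ j, Y j)
      = cumulantSeq (fun q => E ((∑ i, Y i) ^ q)) k := by
    have h1 := jointCumulant_card (ι := Fin k) (fun q => E ((∑ i, Y i) ^ q)) Finset.univ
    rw [Finset.card_univ, Fintype.card_fin] at h1
    rw [← h1]
    refine jointCumulant_congr fun B _ => ?_
    simp [jointMoment, Finset.prod_const]
  rw [← e, h]
  rfl

end Multilinear

/-! ### Covariance inequalities for the mixing coefficients -/

section Covariance

variable {Ω : Type*} {G H : MeasurableSpace Ω} {mΩ : MeasurableSpace Ω} {P : Measure Ω}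

/-- The `L²` norm of a real random variable, as a real number. -/
def l2norm (P : Measure Ω) (f : Ω → ℝ) : ℝ := √(∫ ω, f ω ^ 2 ∂P)

lemma l2norm_nonneg (f : Ω → ℝ) : 0 ≤ l2norm P f := Real.sqrt_nonneg _

lemma l2norm_sq (f : Ω → ℝ) : l2norm P f ^ 2 = ∫ ω, f ω ^ 2 ∂P :=
  Real.sq_sqrt (integral_nonneg fun _ => sq_nonneg _)

lemma l2norm_const_mul (c : ℝ) (f : Ω → ℝ) :
    l2norm P (fun ω => c * f ω) = |c| * l2norm P f := by
  unfold l2norm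
  simp_rw [mul_pow]
  rw [integral_const_mul, Real.sqrt_mul (sq_nonneg c), Real.sqrt_sq_eq_abs]

lemma l2norm_eq_toReal_eLpNorm {f : Ω → ℝ} (hf : MemLp f 2 P) :
    l2norm P f = (eLpNorm f 2 P).toReal := by
  rw [hf.eLpNorm_eq_integral_rpow_norm (by norm_num) (by norm_num), ENNReal.toReal_ofReal
    (by positivity), l2norm, Real.sqrt_eq_rpow]
  norm_num

lemma abs_integral_mul_le_l2norm {f g : Ω → ℝ} (hf : MemLp f 2 P) (hg : MemLp g 2 P) :
    |∫ ω, f ω * g ω ∂P| ≤ l2norm P f * l2norm P g := by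
  have h1 := integral_mul_norm_le_Lp_mul_Lq (μ := P) (f := f) (g := g)
    (p := 2) (q := 2) ⟨by norm_num, by norm_num, by norm_num⟩ (by simpa using hf) (by simpa using hg)
  have h2 : |∫ ω, f ω * g ω ∂P| ≤ ∫ ω, ‖f ω‖ * ‖g ω‖ ∂P := by
    refine (abs_integral_le_integral_abs).trans (le_of_eq ?_)
    simp [abs_mul]
  refine h2.trans (h1.trans (le_of_eq ?_))
  unfold l2norm
  rw [Real.sqrt_eq_rpow, Real.sqrt_eq_rpow]
  norm_num

lemma l2norm_add_le {f g : Ω → ℝ} (hf : MemLp f 2 P) (hg : MemLp g 2 P) :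
    l2norm P (fun ω => f ω + g ω) ≤ l2norm P f + l2norm P g := by
  refine le_of_sq_le_sq ?_ (add_nonneg (l2norm_nonneg f) (l2norm_nonneg g))
  have h1 : ∫ ω, (f ω + g ω) ^ 2 ∂P
      = ∫ ω, f ω ^ 2 ∂P + 2 * ∫ ω, f ω * g ω ∂P + ∫ ω, g ω ^ 2 ∂P := by
    have hi : Integrable (fun ω => 2 * (f ω * g ω)) P := (hf.integrable_mul hg).const_mul 2
    rw [← integral_const_mul, ← integral_add hf.integrable_sq hi,
      ← integral_add (f := fun ω => f ω ^ 2 + 2 * (f ω * g ω))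
        (hf.integrable_sq.add hi) hg.integrable_sq]
    refine integral_congr_ae (Eventually.of_forall fun ω => ?_)
    ring
  have h2 := (abs_le.1 (abs_integral_mul_le_l2norm hf hg)).2
  rw [add_sq, l2norm_sq, l2norm_sq, l2norm_sq, h1]
  linarith

lemma l2norm_sub_le {f g : Ω → ℝ} (hf : MemLp f 2 P) (hg : MemLp g 2 P) :
    l2norm P (fun ω => f ω - g ω) ≤ l2norm P f + l2norm P g := by
  have h := l2norm_add_le hf (hg.const_mul (-1))
  rw [l2norm_const_mul] at h
  simpa [sub_eq_add_neg] using h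

lemma rhoCoeff_nonneg : 0 ≤ rhoCoeff G H P := by
  refine Real.sSup_nonneg ?_
  rintro x ⟨f, h, -, -, rfl⟩
  exact abs_nonneg _

lemma phiCoeff_nonneg : 0 ≤ phiCoeff G H P := by
  refine Real.sSup_nonneg ?_
  rintro x ⟨A, B, -, -, -, rfl⟩
  exact abs_nonneg _

lemma rho_term_le {f h : Ω → ℝ} (hf : IsUnitCentered G P f) (hh : IsUnitCentered H P h) :
    |∫ ω, f ω * h ω ∂P| ≤ 1 := by
  have := abs_integral_mul_le_l2norm hf.2.1 hh.2.1
  rwa [l2norm, l2norm, hf.2.2.2, hh.2.2.2, Real.sqrt_one, mul_one] at this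

lemma exists_finite_approx {Ω : Type*} {mΩ : MeasurableSpace Ω} {P : Measure Ω}
    {G : MeasurableSpace Ω} (hG : G ≤ mΩ) {f : Ω → ℝ} (hf : Measurable[G] f) (hf2 : MemLp f 2 P)
    {ε : ℝ} (hε : 0 < ε) : ∃ f' : Ω → ℝ, Measurable[G] f' ∧ (∃ s : Finset ℝ, ∀ ω, f' ω ∈ s) ∧
      l2norm P (fun ω => f ω - f' ω) ≤ ε := by
  have hsm : StronglyMeasurable[G] f := hf.stronglyMeasurable
  have h1 : MemLp f 2 (P.trim hG) :=
    ⟨hsm.aestronglyMeasurable, by rw [eLpNorm_trim hG hsm]; exact hf2.2⟩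
  obtain ⟨f', hf', hf'2⟩ := h1.exists_simpleFunc_eLpNorm_sub_lt (by norm_num)
    (ε := ENNReal.ofReal ε) (by simpa using hε)
  refine ⟨f', f'.measurable, ⟨f'.range, fun ω => SimpleFunc.mem_range_self f' ω⟩, ?_⟩
  have hm : StronglyMeasurable[G] (f - ⇑f') := hsm.sub f'.stronglyMeasurable
  rw [eLpNorm_trim hG hm] at hf'
  have hmem : MemLp (f - ⇑f') 2 P :=
    ⟨(hm.mono hG).aestronglyMeasurable, hf'.trans ENNReal.ofReal_lt_top⟩
  change l2norm P (f - ⇑f') ≤ ε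
  rw [l2norm_eq_toReal_eLpNorm hmem]
  exact ENNReal.toReal_le_of_le_ofReal hε.le hf'.le

lemma rhoCoeff_le_one : rhoCoeff G H P ≤ 1 := by
  refine Real.sSup_le ?_ zero_le_one
  rintro x ⟨f, h, hf, hh, rfl⟩
  exact rho_term_le hf hh

variable [IsProbabilityMeasure P]

lemma memLp_of_mem_finset {f : Ω → ℝ} (hf : Measurable f) {s : Finset ℝ} (hs : ∀ ω, f ω ∈ s)
    (p : ENNReal) : MemLp f p P := by
  refine MemLp.of_bound hf.aestronglyMeasurable (∑ x ∈ s, |x|) (Eventually.of_forall fun ω => ?_)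
  exact Finset.single_le_sum (f := fun x => |x|) (fun x _ => abs_nonneg x) (hs ω)

lemma l2norm_sub_integral_le {f : Ω → ℝ} (hf : MemLp f 2 P) :
    l2norm P (fun ω => f ω - ∫ ω', f ω' ∂P) ≤ l2norm P f := by
  unfold l2norm
  refine Real.sqrt_le_sqrt ?_
  have h1 := variance_eq_integral (X := f) hf.1.aemeasurable
  have h2 := variance_eq_sub hf
  have h3 : ∫ ω, (f ^ 2) ω ∂P = ∫ ω, f ω ^ 2 ∂P := rfl
  rw [← h1, h2, h3]
  linarith [sq_nonneg (∫ ω, f ω ∂P)]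

lemma memLp_sub_integral {f : Ω → ℝ} (hf : MemLp f 2 P) :
    MemLp (fun ω => f ω - ∫ ω', f ω' ∂P) 2 P := hf.sub (memLp_const _)

lemma abs_covariance_le_l2norm {f g : Ω → ℝ} (hf : MemLp f 2 P) (hg : MemLp g 2 P) :
    |cov[f, g; P]| ≤ l2norm P f * l2norm P g := by
  unfold covariance
  refine (abs_integral_mul_le_l2norm (memLp_sub_integral hf) (memLp_sub_integral hg)).trans ?_
  exact mul_le_mul (l2norm_sub_integral_le hf) (l2norm_sub_integral_le hg) (l2norm_nonneg _)
    (l2norm_nonneg _)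

lemma abs_phi_term_le (A B : Set Ω) : |P.real (A ∩ B) / P.real A - P.real B| ≤ 1 := by
  have h1 : P.real (A ∩ B) / P.real A ≤ 1 :=
    div_le_one_of_le₀ (measureReal_mono Set.inter_subset_left) measureReal_nonneg
  have h2 : 0 ≤ P.real (A ∩ B) / P.real A := by positivity
  have h3 : P.real B ≤ 1 := measureReal_le_one
  have h4 : 0 ≤ P.real B := measureReal_nonneg
  rw [abs_le]; constructor <;> linarith

lemma phiCoeff_le_one : phiCoeff G H P ≤ 1 := by
  refine Real.sSup_le ?_ zero_le_one
  rintro x ⟨A, B, -, -, -, rfl⟩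
  exact abs_phi_term_le A B

lemma abs_measure_inter_sub_le {A B : Set Ω} (hA : MeasurableSet[G] A) (hB : MeasurableSet[H] B) :
    |P.real (A ∩ B) - P.real A * P.real B| ≤ phiCoeff G H P * P.real A := by
  by_cases h : 0 < P.real A
  · have hle : |P.real (A ∩ B) / P.real A - P.real B| ≤ phiCoeff G H P := by
      refine le_csSup ⟨1, ?_⟩ ⟨A, B, hA, hB, h, rfl⟩
      rintro x ⟨A, B, -, -, -, rfl⟩
      exact abs_phi_term_le A B
    have e : P.real (A ∩ B) - P.real A * P.real B
        = (P.real (A ∩ B) / P.real A - P.real B) * P.real A := by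
      field_simp
    rw [e, abs_mul, abs_of_pos h]
    exact mul_le_mul_of_nonneg_right hle h.le
  · have h0 : P.real A = 0 := le_antisymm (not_lt.1 h) measureReal_nonneg
    have h1 : P.real (A ∩ B) = 0 :=
      le_antisymm (h0 ▸ measureReal_mono Set.inter_subset_left) measureReal_nonneg
    simp [h0, h1]

/-- A function of two finitely valued random variables integrates to a finite double sum. -/
lemma integral_comp_eq_sum {f g : Ω → ℝ} (hf : Measurable f) (hg : Measurable g)
    {s t : Finset ℝ} (hs : ∀ ω, f ω ∈ s) (ht : ∀ ω, g ω ∈ t) (u : ℝ → ℝ → ℝ) :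
    ∫ ω, u (f ω) (g ω) ∂P
      = ∑ x ∈ s, ∑ y ∈ t, u x y * P.real (f ⁻¹' {x} ∩ g ⁻¹' {y}) := by
  have hm : ∀ x y, MeasurableSet (f ⁻¹' {x} ∩ g ⁻¹' {y}) := fun x y =>
    (hf (measurableSet_singleton x)).inter (hg (measurableSet_singleton y))
  have h1 : ∀ ω, u (f ω) (g ω)
      = ∑ x ∈ s, ∑ y ∈ t, (f ⁻¹' {x} ∩ g ⁻¹' {y}).indicator (fun _ => u x y) ω := by
    intro ω
    rw [Finset.sum_eq_single_of_mem (f ω) (hs ω), Finset.sum_eq_single_of_mem (g ω) (ht ω)]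
    · rw [Set.indicator_of_mem (by simp)]
    · intro y _ hy
      rw [Set.indicator_of_notMem]
      simp [Ne.symm hy]
    · intro x _ hx
      refine Finset.sum_eq_zero fun y _ => ?_
      rw [Set.indicator_of_notMem]
      simp [Ne.symm hx]
  simp_rw [h1]
  have hi : ∀ x y, Integrable ((f ⁻¹' {x} ∩ g ⁻¹' {y}).indicator (fun _ => u x y)) P :=
    fun x y => (integrable_const _).indicator (hm x y)
  rw [integral_finsetSum _ fun x _ => integrable_finsetSum _ fun y _ => hi x y]
  refine Finset.sum_congr rfl fun x _ => ?_
  rw [integral_finsetSum _ fun y _ => hi x y]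
  refine Finset.sum_congr rfl fun y _ => ?_
  rw [integral_indicator (hm x y), setIntegral_const, smul_eq_mul, mul_comm]

/-- The total variation form of the `φ`-mixing coefficient: the signed discrepancies are collected
according to their signs. -/
lemma sum_abs_discrepancy_le (hH : H ≤ mΩ) {A : Set Ω} (hA : MeasurableSet[G] A)
    {g : Ω → ℝ} (hg : Measurable[H] g) (t : Finset ℝ) :
    ∑ y ∈ t, |P.real (A ∩ g ⁻¹' {y}) - P.real A * P.real (g ⁻¹' {y})|
      ≤ 2 * phiCoeff G H P * P.real A := by
  classical
  have hg' : Measurable g := hg.mono hH le_rfl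
  have key : ∀ t' : Finset ℝ,
      |∑ y ∈ t', (P.real (A ∩ g ⁻¹' {y}) - P.real A * P.real (g ⁻¹' {y}))|
        ≤ phiCoeff G H P * P.real A := by
    intro t'
    have h1 : P.real (g ⁻¹' (t' : Set ℝ)) = ∑ y ∈ t', P.real (g ⁻¹' {y}) := by
      rw [← measureReal_biUnion_finset]
      · congr 1; ext ω; simp
      · intro x _ y _ hxy
        exact Disjoint.preimage _ (by simpa using hxy)
      · exact fun y _ => hg' (measurableSet_singleton y)
    have h2 : P.real (g ⁻¹' (t' : Set ℝ) ∩ A) = ∑ y ∈ t', P.real (g ⁻¹' {y} ∩ A) := by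
      have := Finset.sum_congr rfl fun y (_ : y ∈ t') =>
        (measureReal_restrict_apply (μ := P) (s := A) (hg' (measurableSet_singleton y)))
      rw [← this, ← measureReal_restrict_apply (hg' t'.measurableSet), ← measureReal_biUnion_finset]
      · congr 1; ext ω; simp
      · intro x _ y _ hxy
        exact Disjoint.preimage _ (by simpa using hxy)
      · exact fun y _ => hg' (measurableSet_singleton y)
    have h3 := abs_measure_inter_sub_le (P := P) hA (hg t'.measurableSet)
    rw [Finset.sum_sub_distrib, ← Finset.mul_sum, ← h1]
    rw [Set.inter_comm, h2] at h3
    simpa [Set.inter_comm] using h3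
  have hsplit := Finset.sum_filter_add_sum_filter_not t
    (fun y => 0 ≤ P.real (A ∩ g ⁻¹' {y}) - P.real A * P.real (g ⁻¹' {y}))
    (fun y => |P.real (A ∩ g ⁻¹' {y}) - P.real A * P.real (g ⁻¹' {y})|)
  rw [← hsplit]
  have e1 := Finset.sum_congr rfl fun y (hy : y ∈ t.filter
      (fun y => 0 ≤ P.real (A ∩ g ⁻¹' {y}) - P.real A * P.real (g ⁻¹' {y}))) =>
    abs_of_nonneg (Finset.mem_filter.1 hy).2
  have e2 := Finset.sum_congr rfl fun y (hy : y ∈ t.filter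
      (fun y => ¬ 0 ≤ P.real (A ∩ g ⁻¹' {y}) - P.real A * P.real (g ⁻¹' {y}))) =>
    abs_of_neg (not_le.1 (Finset.mem_filter.1 hy).2)
  rw [e1, e2, Finset.sum_neg_distrib]
  have k1 := (abs_le.1 (key (t.filter
      (fun y => 0 ≤ P.real (A ∩ g ⁻¹' {y}) - P.real A * P.real (g ⁻¹' {y}))))).2
  have k2 := (abs_le.1 (key (t.filter
      (fun y => ¬ 0 ≤ P.real (A ∩ g ⁻¹' {y}) - P.real A * P.real (g ⁻¹' {y}))))).1
  linarith

lemma abs_covariance_le_of_finite (hG : G ≤ mΩ) (hH : H ≤ mΩ) {f g : Ω → ℝ}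
    (hf : Measurable[G] f) (hg : Measurable[H] g)
    {s t : Finset ℝ} (hs : ∀ ω, f ω ∈ s) (ht : ∀ ω, g ω ∈ t) :
    |cov[f, g; P]| ≤ 2 * √(phiCoeff G H P) * l2norm P f * l2norm P g := by
  have hf' : Measurable f := hf.mono hG le_rfl
  have hg' : Measurable g := hg.mono hH le_rfl
  set κ := phiCoeff G H P with hκ
  have hκ0 : 0 ≤ κ := phiCoeff_nonneg
  set p : ℝ → ℝ → ℝ := fun x y => P.real (f ⁻¹' {x} ∩ g ⁻¹' {y}) with hp
  set q : ℝ → ℝ := fun x => P.real (f ⁻¹' {x}) with hq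
  set r : ℝ → ℝ := fun y => P.real (g ⁻¹' {y}) with hr
  set d : ℝ → ℝ → ℝ := fun x y => |p x y - q x * r y| with hd
  have hpart : ∀ {h : Ω → ℝ} (_ : Measurable h) {w : Finset ℝ} (_ : ∀ ω, h ω ∈ w)
      {A : Set Ω} (_ : MeasurableSet A), ∑ y ∈ w, P.real (h ⁻¹' {y} ∩ A) = P.real A := by
    intro h hh w hw A hA
    have := Finset.sum_congr rfl fun y (_ : y ∈ w) =>
      (measureReal_restrict_apply (μ := P) (s := A) (hh (measurableSet_singleton y)))
    rw [← this, ← measureReal_biUnion_finset]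
    · have : (⋃ y ∈ w, h ⁻¹' {y}) = Set.univ := by ext ω; simp [hw]
      rw [this, measureReal_restrict_apply MeasurableSet.univ, Set.univ_inter]
    · intro x _ y _ hxy
      exact Disjoint.preimage _ (by simpa using hxy)
    · exact fun y _ => hh (measurableSet_singleton y)
  have hpx : ∀ x, ∑ y ∈ t, p x y = q x := by
    intro x
    have := hpart hg' ht (hf' (measurableSet_singleton x))
    simpa [hp, hq, Set.inter_comm] using this
  have hpy : ∀ y, ∑ x ∈ s, p x y = r y := fun y => hpart hf' hs (hg' (measurableSet_singleton y))
  have hqs : ∑ x ∈ s, q x = 1 := by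
    have := hpart hf' hs MeasurableSet.univ
    simpa [hq] using this
  have hrs : ∑ y ∈ t, r y = 1 := by
    have := hpart hg' ht MeasurableSet.univ
    simpa [hr] using this
  have hp0 : ∀ x y, 0 ≤ p x y := fun _ _ => measureReal_nonneg
  have hq0 : ∀ x, 0 ≤ q x := fun _ => measureReal_nonneg
  have hr0 : ∀ y, 0 ≤ r y := fun _ => measureReal_nonneg
  have hd0 : ∀ x y, 0 ≤ d x y := fun _ _ => abs_nonneg _
  -- the integrals as finite sums
  have Efg := integral_comp_eq_sum (P := P) hf' hg' hs ht (fun x y => x * y)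
  have Ef := integral_comp_eq_sum (P := P) hf' hg' hs ht (fun x _ => x)
  have Eg := integral_comp_eq_sum (P := P) hf' hg' hs ht (fun _ y => y)
  have Ef2 := integral_comp_eq_sum (P := P) hf' hg' hs ht (fun x _ => x ^ 2)
  have Eg2 := integral_comp_eq_sum (P := P) hf' hg' hs ht (fun _ y => y ^ 2)
  simp only [← Finset.mul_sum] at Ef Ef2
  rw [Finset.sum_comm] at Eg Eg2
  simp only [← Finset.mul_sum] at Eg Eg2
  change _ = ∑ x ∈ s, ∑ y ∈ t, x * y * p x y at Efg
  change _ = ∑ x ∈ s, x * ∑ y ∈ t, p x y at Ef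
  change _ = ∑ x ∈ s, x ^ 2 * ∑ y ∈ t, p x y at Ef2
  change _ = ∑ y ∈ t, y * ∑ x ∈ s, p x y at Eg
  change _ = ∑ y ∈ t, y ^ 2 * ∑ x ∈ s, p x y at Eg2
  simp only [hpx] at Ef Ef2
  simp only [hpy] at Eg Eg2
  have hcov : cov[f, g; P] = ∑ x ∈ s, ∑ y ∈ t, x * y * (p x y - q x * r y) := by
    rw [covariance_eq_sub (memLp_of_mem_finset hf' hs 2) (memLp_of_mem_finset hg' ht 2)]
    simp only [Pi.mul_apply]
    rw [Efg, Ef, Eg, Finset.sum_mul_sum, ← Finset.sum_sub_distrib]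
    refine Finset.sum_congr rfl fun x _ => ?_
    rw [← Finset.sum_sub_distrib]
    exact Finset.sum_congr rfl fun y _ => by ring
  have habs : |cov[f, g; P]| ≤ ∑ z ∈ s ×ˢ t, (|z.1| * √(d z.1 z.2)) * (|z.2| * √(d z.1 z.2)) := by
    rw [hcov, Finset.sum_product]
    refine (Finset.abs_sum_le_sum_abs _ _).trans (Finset.sum_le_sum fun x _ => ?_)
    refine (Finset.abs_sum_le_sum_abs _ _).trans (Finset.sum_le_sum fun y _ => le_of_eq ?_)
    rw [abs_mul, abs_mul]
    have := Real.mul_self_sqrt (hd0 x y)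
    change |x| * |y| * d x y = _
    rw [← this]
    simp only [Real.sqrt_mul_self (Real.sqrt_nonneg _)]
    ring
  have hCS := Finset.sum_mul_sq_le_sq_mul_sq (s ×ˢ t) (fun z => |z.1| * √(d z.1 z.2))
    (fun z => |z.2| * √(d z.1 z.2))
  have hA : ∑ z ∈ s ×ˢ t, (|z.1| * √(d z.1 z.2)) ^ 2 ≤ 2 * κ * ∫ ω, f ω ^ 2 ∂P := by
    rw [Finset.sum_product, Ef2, Finset.mul_sum]
    refine Finset.sum_le_sum fun x _ => ?_
    have h1 : ∑ y ∈ t, d x y ≤ 2 * κ * q x :=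
      sum_abs_discrepancy_le hH (hf (measurableSet_singleton x)) hg t
    calc ∑ y ∈ t, (|x| * √(d x y)) ^ 2 = x ^ 2 * ∑ y ∈ t, d x y := by
          rw [Finset.mul_sum]
          refine Finset.sum_congr rfl fun y _ => ?_
          rw [mul_pow, Real.sq_sqrt (hd0 x y), sq_abs]
      _ ≤ x ^ 2 * (2 * κ * q x) := mul_le_mul_of_nonneg_left h1 (sq_nonneg x)
      _ = _ := by ring
  have hB : ∑ z ∈ s ×ˢ t, (|z.2| * √(d z.1 z.2)) ^ 2 ≤ 2 * ∫ ω, g ω ^ 2 ∂P := by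
    rw [Finset.sum_product_right, Eg2, Finset.mul_sum]
    refine Finset.sum_le_sum fun y _ => ?_
    have h1 : ∑ x ∈ s, d x y ≤ 2 * r y := by
      calc ∑ x ∈ s, d x y ≤ ∑ x ∈ s, (p x y + q x * r y) := by
            refine Finset.sum_le_sum fun x _ => ?_
            refine (abs_sub _ _).trans (le_of_eq ?_)
            rw [abs_of_nonneg (hp0 x y), abs_of_nonneg (mul_nonneg (hq0 x) (hr0 y))]
        _ = 2 * r y := by
            rw [Finset.sum_add_distrib, hpy, ← Finset.sum_mul, hqs]; ring
    calc ∑ x ∈ s, (|y| * √(d x y)) ^ 2 = y ^ 2 * ∑ x ∈ s, d x y := by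
          rw [Finset.mul_sum]
          refine Finset.sum_congr rfl fun x _ => ?_
          rw [mul_pow, Real.sq_sqrt (hd0 x y), sq_abs]
      _ ≤ y ^ 2 * (2 * r y) := mul_le_mul_of_nonneg_left h1 (sq_nonneg y)
      _ = _ := by ring
  refine abs_le_of_sq_le_sq' ?_ ?_ |> fun h => abs_le.2 h
  · have h0 : 0 ≤ ∑ z ∈ s ×ˢ t, (|z.1| * √(d z.1 z.2)) * (|z.2| * √(d z.1 z.2)) :=
      Finset.sum_nonneg fun z _ => by positivity
    rw [← sq_abs]
    calc |cov[f, g; P]| ^ 2 ≤ (∑ z ∈ s ×ˢ t, (|z.1| * √(d z.1 z.2)) * (|z.2| * √(d z.1 z.2))) ^ 2 :=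
          pow_le_pow_left₀ (abs_nonneg _) habs 2
      _ ≤ _ := hCS
      _ ≤ (2 * κ * ∫ ω, f ω ^ 2 ∂P) * (2 * ∫ ω, g ω ^ 2 ∂P) :=
          mul_le_mul hA hB (Finset.sum_nonneg fun z _ => sq_nonneg _)
            (mul_nonneg (by positivity) (integral_nonneg fun _ => sq_nonneg _))
      _ = _ := by
          rw [mul_pow, mul_pow, mul_pow, Real.sq_sqrt hκ0, l2norm_sq, l2norm_sq]; ring
  · have := l2norm_nonneg (P := P) f
    have := l2norm_nonneg (P := P) g
    positivity

/-- Ibragimov's covariance inequality. -/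
lemma abs_covariance_le_sqrt_phiCoeff (hG : G ≤ mΩ) (hH : H ≤ mΩ) {f g : Ω → ℝ}
    (hf : Measurable[G] f) (hg : Measurable[H] g) (hf2 : MemLp f 2 P) (hg2 : MemLp g 2 P) :
    |cov[f, g; P]| ≤ 2 * √(phiCoeff G H P) * l2norm P f * l2norm P g := by
  set κ := phiCoeff G H P
  set a := l2norm P f
  set b := l2norm P g
  have ha : 0 ≤ a := l2norm_nonneg f
  have hb : 0 ≤ b := l2norm_nonneg g
  set F : ℝ → ℝ := fun ε => 2 * √κ * (a + ε) * (b + ε) + ε * b + (a + ε) * ε with hF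
  have hle : ∀ ε > 0, |cov[f, g; P]| ≤ F ε := by
    intro ε hε
    obtain ⟨f', hf', ⟨s, hs⟩, hfε⟩ := exists_finite_approx hG hf hf2 hε
    obtain ⟨g', hg', ⟨t, ht⟩, hgε⟩ := exists_finite_approx hH hg hg2 hε
    have hf'2 : MemLp f' 2 P := memLp_of_mem_finset (hf'.mono hG le_rfl) hs 2
    have hg'2 : MemLp g' 2 P := memLp_of_mem_finset (hg'.mono hH le_rfl) ht 2
    have hfa : l2norm P f' ≤ a + ε := by
      have := l2norm_sub_le hf2 (hf2.sub hf'2)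
      simp only [Pi.sub_apply, sub_sub_cancel] at this
      exact this.trans (add_le_add le_rfl hfε)
    have hgb : l2norm P g' ≤ b + ε := by
      have := l2norm_sub_le hg2 (hg2.sub hg'2)
      simp only [Pi.sub_apply, sub_sub_cancel] at this
      exact this.trans (add_le_add le_rfl hgε)
    have e : cov[f, g; P] = cov[f', g'; P] + cov[fun ω => f ω - f' ω, g; P]
        + cov[f', fun ω => g ω - g' ω; P] := by
      rw [covariance_fun_sub_left hf2 hf'2 hg2, covariance_fun_sub_right hf'2 hg2 hg'2]
      ring
    have h1 := abs_covariance_le_of_finite (P := P) hG hH hf' hg' hs ht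
    have h2 := abs_covariance_le_l2norm (P := P) (hf2.sub hf'2) hg2
    have h3 := abs_covariance_le_l2norm (P := P) hf'2 (hg2.sub hg'2)
    have h1' : 2 * √κ * l2norm P f' * l2norm P g' ≤ 2 * √κ * (a + ε) * (b + ε) :=
      mul_le_mul (mul_le_mul_of_nonneg_left hfa (by positivity)) hgb (l2norm_nonneg _)
        (by positivity)
    have h2' : l2norm P (f - f') * l2norm P g ≤ ε * b :=
      mul_le_mul_of_nonneg_right hfε hb
    have h3' : l2norm P f' * l2norm P (g - g') ≤ (a + ε) * ε :=
      mul_le_mul hfa hgε (l2norm_nonneg _) (by positivity)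
    rw [e]
    refine (abs_add_three _ _ _).trans ?_
    exact add_le_add (add_le_add (h1.trans h1') (h2.trans h2')) (h3.trans h3')
  have hcont : Continuous F := by fun_prop
  have hlim : Tendsto F (𝓝[>] 0) (𝓝 (F 0)) := hcont.continuousAt.tendsto.mono_left nhdsWithin_le_nhds
  have := ge_of_tendsto hlim (eventually_nhdsWithin_of_forall hle)
  simpa [hF] using this

lemma rhoCoeff_le_sqrt_phiCoeff (hG : G ≤ mΩ) (hH : H ≤ mΩ) :
    rhoCoeff G H P ≤ 2 * √(phiCoeff G H P) := by
  refine Real.sSup_le ?_ (by positivity)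
  rintro x ⟨f, h, hf, hh, rfl⟩
  have h1 := abs_covariance_le_sqrt_phiCoeff (P := P) hG hH hf.1 hh.1 hf.2.1 hh.2.1
  rw [covariance_eq_sub hf.2.1 hh.2.1, hf.2.2.1, l2norm, l2norm, hf.2.2.2, hh.2.2.2] at h1
  simpa using h1

/-- The defining inequality of the maximal correlation coefficient, without normalization. -/
lemma abs_covariance_le_rhoCoeff {f h : Ω → ℝ} (hf : Measurable[G] f) (hh : Measurable[H] h)
    (hf2 : MemLp f 2 P) (hh2 : MemLp h 2 P) :
    |cov[f, h; P]| ≤ rhoCoeff G H P * l2norm P f * l2norm P h := by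
  set f₀ : Ω → ℝ := fun ω => f ω - ∫ ω', f ω' ∂P with hf₀
  set h₀ : Ω → ℝ := fun ω => h ω - ∫ ω', h ω' ∂P with hh₀
  have hf₀2 : MemLp f₀ 2 P := memLp_sub_integral hf2
  have hh₀2 : MemLp h₀ 2 P := memLp_sub_integral hh2
  have hρ : 0 ≤ rhoCoeff G H P := rhoCoeff_nonneg
  have key : |∫ ω, f₀ ω * h₀ ω ∂P| ≤ rhoCoeff G H P * l2norm P f₀ * l2norm P h₀ := by
    rcases (l2norm_nonneg (P := P) f₀).eq_or_lt with h0 | hs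
    · have := abs_integral_mul_le_l2norm hf₀2 hh₀2
      rw [← h0] at this ⊢
      simpa using this
    rcases (l2norm_nonneg (P := P) h₀).eq_or_lt with h0 | ht
    · have := abs_integral_mul_le_l2norm hf₀2 hh₀2
      rw [← h0] at this ⊢
      simpa using this
    have hunit : ∀ {K : MeasurableSpace Ω} {u : Ω → ℝ} (_ : Measurable[K] u) (_ : MemLp u 2 P)
        (_ : 0 < l2norm P fun ω => u ω - ∫ ω', u ω' ∂P),
        IsUnitCentered K P (fun ω => (l2norm P fun ω => u ω - ∫ ω', u ω' ∂P)⁻¹ *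
          (u ω - ∫ ω', u ω' ∂P)) := by
      intro K u hu hu2 hpos
      refine ⟨?_, (memLp_sub_integral hu2).const_mul _, ?_, ?_⟩
      · exact (hu.sub_const _).const_mul _
      · rw [integral_const_mul, integral_sub (hu2.integrable (by norm_num)) (integrable_const _)]
        simp
      · simp_rw [mul_pow]
        rw [integral_const_mul, ← l2norm_sq]
        field_simp
    have hle : |∫ ω, ((l2norm P f₀)⁻¹ * f₀ ω) * ((l2norm P h₀)⁻¹ * h₀ ω) ∂P| ≤ rhoCoeff G H P := by
      refine le_csSup ⟨1, ?_⟩ ⟨_, _, hunit hf hf2 hs, hunit hh hh2 ht, rfl⟩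
      rintro x ⟨f, h, hf, hh, rfl⟩
      exact rho_term_le hf hh
    have e : ∫ ω, ((l2norm P f₀)⁻¹ * f₀ ω) * ((l2norm P h₀)⁻¹ * h₀ ω) ∂P
        = (l2norm P f₀ * l2norm P h₀)⁻¹ * ∫ ω, f₀ ω * h₀ ω ∂P := by
      rw [← integral_const_mul]
      refine integral_congr_ae (Eventually.of_forall fun ω => ?_)
      simp only [mul_inv]
      ring
    rw [e, abs_mul, abs_of_pos (by positivity), inv_mul_le_iff₀ (by positivity)] at hle
    linarith
  have h1 := l2norm_sub_integral_le hf2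
  have h2 := l2norm_sub_integral_le hh2
  calc |cov[f, h; P]| ≤ rhoCoeff G H P * l2norm P f₀ * l2norm P h₀ := key
    _ ≤ _ := mul_le_mul (mul_le_mul_of_nonneg_left h1 hρ) h2 (l2norm_nonneg _)
      (mul_nonneg hρ (l2norm_nonneg _))

end Covariance

/-! ### Moments of the normal distribution -/

lemma iteratedDeriv_id_mul {f : ℝ → ℝ} (hf : ContDiff ℝ ⊤ f) (n : ℕ) :
    iteratedDeriv (n + 1) (fun t => t * f t)
      = fun t => t * iteratedDeriv (n + 1) f t + (n + 1) * iteratedDeriv n f t := by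
  have hd : ∀ n, Differentiable ℝ (iteratedDeriv n f) := fun n =>
    hf.differentiable_iteratedDeriv n (by exact_mod_cast WithTop.coe_lt_top _)
  induction n with
  | zero =>
    funext t
    rw [iteratedDeriv_one, iteratedDeriv_one, iteratedDeriv_zero]
    have h := (hasDerivAt_id t).mul ((hf.differentiable (by simp)) t).hasDerivAt
    have h' : HasDerivAt (fun t => t * f t) (1 * f t + t * deriv f t) t := h
    rw [h'.deriv]
    push_cast
    ring
  | succ n ih =>
    funext t
    rw [iteratedDeriv_succ, ih]
    have h1 := (hasDerivAt_id t).mul (hd (n + 1) t).hasDerivAt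
    have h2 := (hd n t).hasDerivAt.const_mul ((n : ℝ) + 1)
    have h3 : HasDerivAt (fun t => t * iteratedDeriv (n + 1) f t + (n + 1) * iteratedDeriv n f t)
      (1 * iteratedDeriv (n + 1) f t + t * deriv (iteratedDeriv (n + 1) f) t +
        (n + 1) * deriv (iteratedDeriv n f) t) t := h1.add h2
    rw [h3.deriv, ← iteratedDeriv_succ, ← iteratedDeriv_succ]
    push_cast
    ring

lemma gaussMoment_zero : gaussMoment 0 = 1 := by simp [gaussMoment]

lemma gaussMoment_one : gaussMoment 1 = 0 := by simp [gaussMoment]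

lemma gaussMoment_add_two (q : ℕ) : gaussMoment (q + 2) = (q + 1) * gaussMoment q := by
  set f : ℝ → ℝ := fun t => Real.exp (t ^ 2 / 2) with hf
  have hfc : ContDiff ℝ ⊤ f := by fun_prop
  have hm : ∀ n, gaussMoment n = iteratedDeriv n f 0 := by
    intro n
    have h := iteratedDeriv_mgf_zero (X := id) (μ := gaussianReal 0 1) (by simp) n
    have e : mgf id (gaussianReal 0 1) = f := by
      rw [mgf_id_gaussianReal, hf]
      funext t
      simp
    rw [← e, h]
    rfl
  have hder : deriv f = fun t => t * f t := by
    funext t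
    have h1 : HasDerivAt (fun t : ℝ => t ^ 2 / 2) t t := by
      have := (hasDerivAt_pow 2 t).div_const 2
      exact this.congr_deriv (by push_cast; ring)
    have := h1.exp
    rw [hf, this.deriv, mul_comm]
  rw [hm, hm, iteratedDeriv_succ', hder, iteratedDeriv_id_mul hfc]
  simp

lemma gaussMoment_eq_zero_of_odd {q : ℕ} (hq : Odd q) : gaussMoment q = 0 := by
  obtain ⟨k, rfl⟩ := hq
  induction k with
  | zero => exact gaussMoment_one
  | succ k ih =>
    have : 2 * (k + 1) + 1 = (2 * k + 1) + 2 := by ring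
    rw [this, gaussMoment_add_two, ih, mul_zero]

lemma abs_gaussMoment_le (q : ℕ) : |gaussMoment q| ≤ (q ! : ℝ) := by
  induction q using Nat.strong_induction_on with
  | _ q ih =>
  match q with
  | 0 => simp [gaussMoment_zero]
  | 1 => simp [gaussMoment_one]
  | q + 2 =>
    have h := ih q (by omega)
    rw [gaussMoment_add_two, abs_mul, abs_of_nonneg (by positivity), Nat.factorial_succ,
      Nat.factorial_succ]
    push_cast
    have hq : (0 : ℝ) ≤ q := Nat.cast_nonneg q
    have h0 : (0 : ℝ) ≤ (q ! : ℝ) := by positivity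
    calc ((q : ℝ) + 1) * |gaussMoment q| ≤ (q + 1) * (q ! : ℝ) := by gcongr
      _ ≤ (q + 1 + 1) * ((q + 1) * (q ! : ℝ)) := by nlinarith [mul_nonneg hq h0, mul_nonneg (mul_nonneg hq hq) h0]

/-! ### Moments from cumulants -/

/-- The order of the first correction to the `q`-th moment of an approximately normal variable:
skewness enters the odd moments to first, the even ones to second order. -/
def correctionOrder (q : ℕ) : ℕ := if Even q then 2 else 1

set_option maxHeartbeats 400000 in
/-- If the cumulants of order `3` and `≥ 4` of a variable are smaller than those of scale `s` by
factors `δ` and `δ ^ 2`, then its moments are close to those of the normal distribution. -/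
lemma abs_moment_sub_gauss_le {m : ℕ → ℝ} {s δ M : ℝ} {p : ℕ} (h0 : m 0 = 1) (h1 : m 1 = 0)
    (h2 : m 2 = s ^ 2) (hs : 0 ≤ s) (hδ : 0 ≤ δ) (hδ1 : δ ≤ 1) (hM : 1 ≤ M)
    (hm : ∀ q, |m q| ≤ M ^ q * (q ! : ℝ) * s ^ q)
    (hk3 : 3 ≤ p → |cumulantSeq m 3| ≤ M ^ 3 * s ^ 3 * δ)
    (hk : ∀ k, 4 ≤ k → k ≤ p → |cumulantSeq m k| ≤ M ^ k * s ^ k * δ ^ 2) {q : ℕ} (hq : q ≤ p) :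
    |m q - s ^ q * gaussMoment q|
      ≤ (4 * M) ^ q * (q ! : ℝ) * s ^ q * δ ^ correctionOrder q := by
  have hM0 : 0 ≤ M := by linarith
  have c1 : cumulantSeq m 1 = 0 := by
    have := moment_eq_sum_cumulantSeq m h0 0
    rw [Finset.sum_range_one] at this
    simpa [h0, h1] using this.symm
  have c2 : cumulantSeq m 2 = s ^ 2 := by
    have := moment_eq_sum_cumulantSeq m h0 1
    rw [Finset.sum_range_succ, Finset.sum_range_one] at this
    simp only [zero_add, c1, one_add_one_eq_two, h0, h2, Nat.choose_self, Nat.sub_self] at this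
    simpa using this.symm
  induction q using Nat.strong_induction_on with
  | _ q ih =>
  match q with
  | 0 => simp only [h0, pow_zero, gaussMoment_zero]; norm_num; positivity
  | 1 => simp only [h1, gaussMoment_one]; norm_num; positivity
  | n + 2 =>
    have hle : δ ^ 2 ≤ δ ^ correctionOrder (n + 2) := by
      refine pow_le_pow_of_le_one hδ hδ1 ?_
      unfold correctionOrder; split_ifs <;> norm_num
    have hexp := moment_eq_sum_cumulantSeq m h0 (n + 1)
    rw [Finset.sum_range_succ', Finset.sum_range_succ'] at hexp
    simp only [zero_add, Nat.choose_zero_right, Nat.cast_one, one_mul, c1, zero_mul, add_zero,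
      Nat.choose_one_right] at hexp
    -- the terms of order at least four
    set T : ℝ := ∑ j ∈ Finset.range n,
      ((n + 1).choose (j + 1 + 1) : ℝ) * cumulantSeq m (j + 1 + 1 + 1) * m (n + 1 - (j + 1 + 1))
      with hT
    have hmn : m (n + 2) = T + ((n : ℝ) + 1) * s ^ 2 * m n := by
      have e : n + 1 - 1 = n := by omega
      rw [e, show (1 + 1 : ℕ) = 2 from rfl, c2] at hexp
      rw [show n + 2 = n + 1 + 1 by ring, hexp]
      push_cast; ring
    have hfac : ((n + 2)! : ℝ) = (n + 2) * ((n + 1)! : ℝ) := by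
      rw [Nat.factorial_succ (n + 1)]; push_cast; ring
    have hfac' : ((n + 1)! : ℝ) = (n + 1) * (n ! : ℝ) := by
      rw [Nat.factorial_succ n]; push_cast; ring
    -- a bound for one term of order at least four
    have hterm : ∀ j, 1 ≤ j → j < n →
        |((n + 1).choose (j + 1 + 1) : ℝ) * cumulantSeq m (j + 1 + 1 + 1) *
          m (n + 1 - (j + 1 + 1))| ≤ M ^ (n + 2) * ((n + 1)! : ℝ) * s ^ (n + 2) * δ ^ 2 := by
      intro j hj hjn
      have a1 := hk (j + 1 + 1 + 1) (by omega) (by omega)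
      have a2 := hm (n + 1 - (j + 1 + 1))
      have a3 : ((n + 1).choose (j + 1 + 1) : ℝ) * ((n + 1 - (j + 1 + 1))! : ℝ) ≤ ((n + 1)! : ℝ) := by
        have : (n + 1).choose (j + 1 + 1) * (n + 1 - (j + 1 + 1))! ≤ (n + 1)! := by
          rw [← Nat.choose_mul_factorial_mul_factorial (show j + 1 + 1 ≤ n + 1 by omega)]
          calc _ = (n + 1).choose (j + 1 + 1) * 1 * (n + 1 - (j + 1 + 1))! := by ring
            _ ≤ _ := by
              gcongr
              exact Nat.one_le_iff_ne_zero.2 (Nat.factorial_ne_zero _)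
        exact_mod_cast this
      have e1 : M ^ (j + 1 + 1 + 1) * M ^ (n + 1 - (j + 1 + 1)) = M ^ (n + 2) := by
        rw [← pow_add]; congr 1; omega
      have e2 : s ^ (j + 1 + 1 + 1) * s ^ (n + 1 - (j + 1 + 1)) = s ^ (n + 2) := by
        rw [← pow_add]; congr 1; omega
      rw [abs_mul, abs_mul, Nat.abs_cast]
      calc _ ≤ ((n + 1).choose (j + 1 + 1) : ℝ) * (M ^ (j + 1 + 1 + 1) * s ^ (j + 1 + 1 + 1) * δ ^ 2)
            * (M ^ (n + 1 - (j + 1 + 1)) * ((n + 1 - (j + 1 + 1))! : ℝ) *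
              s ^ (n + 1 - (j + 1 + 1))) := by gcongr
        _ = (M ^ (j + 1 + 1 + 1) * M ^ (n + 1 - (j + 1 + 1))) *
            (((n + 1).choose (j + 1 + 1) : ℝ) * ((n + 1 - (j + 1 + 1))! : ℝ)) *
            (s ^ (j + 1 + 1 + 1) * s ^ (n + 1 - (j + 1 + 1))) * δ ^ 2 := by ring
        _ ≤ _ := by rw [e1, e2]; gcongr
    -- the third order term
    have hthird : 1 ≤ n → |((n + 1).choose 2 : ℝ) * cumulantSeq m 3 * m (n - 1)| ≤
        (4 * M) ^ (n + 2) / 16 * ((n + 1)! : ℝ) * s ^ (n + 2) * δ ^ correctionOrder (n + 2) := by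
      intro hn
      obtain ⟨l, rfl⟩ : ∃ l, n = l + 1 := ⟨n - 1, by omega⟩
      simp only [Nat.add_sub_cancel]
      have a1 := hk3 (by omega)
      have a3 : ((l + 1 + 1).choose 2 : ℝ) * (l ! : ℝ) ≤ ((l + 1 + 1)! : ℝ) := by
        have : (l + 1 + 1).choose 2 * l ! ≤ (l + 1 + 1)! := by
          rw [← Nat.choose_mul_factorial_mul_factorial (show 2 ≤ l + 1 + 1 by omega)]
          calc _ = (l + 1 + 1).choose 2 * 1 * l ! := by ring
            _ ≤ _ := by
              gcongr
              · norm_num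
              · omega
        exact_mod_cast this
      have a2 : δ * |m l| ≤ (4 * M) ^ l * (l ! : ℝ) * s ^ l * δ ^ correctionOrder (l + 1 + 2) := by
        by_cases he : Even l
        · have e1 : correctionOrder (l + 1 + 2) = 1 := by
            unfold correctionOrder
            rw [if_neg]
            simp only [Nat.even_add_one, show l + 1 + 2 = l + 1 + 1 + 1 by ring]
            simpa using he
          rw [e1, pow_one, mul_comm]
          refine mul_le_mul_of_nonneg_right ((hm l).trans ?_) hδ
          have : M ^ l ≤ (4 * M) ^ l := pow_le_pow_left₀ hM0 (by linarith) l
          gcongr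
        · have e1 : correctionOrder (l + 1 + 2) = 2 := by
            unfold correctionOrder
            rw [if_pos]
            simp only [Nat.even_add_one, show l + 1 + 2 = l + 1 + 1 + 1 by ring]
            simpa using he
          have e2 : correctionOrder l = 1 := by unfold correctionOrder; rw [if_neg he]
          have := ih l (by omega) (by omega)
          rw [gaussMoment_eq_zero_of_odd (Nat.not_even_iff_odd.1 he), mul_zero, sub_zero, e2,
            pow_one] at this
          rw [e1]
          calc δ * |m l| ≤ δ * ((4 * M) ^ l * (l ! : ℝ) * s ^ l * δ) :=
                mul_le_mul_of_nonneg_left this hδ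
            _ = _ := by ring
      rw [abs_mul, abs_mul, Nat.abs_cast]
      calc _ ≤ ((l + 1 + 1).choose 2 : ℝ) * (M ^ 3 * s ^ 3 * δ) * |m l| := by gcongr
        _ = ((l + 1 + 1).choose 2 : ℝ) * M ^ 3 * s ^ 3 * (δ * |m l|) := by ring
        _ ≤ ((l + 1 + 1).choose 2 : ℝ) * M ^ 3 * s ^ 3 *
            ((4 * M) ^ l * (l ! : ℝ) * s ^ l * δ ^ correctionOrder (l + 1 + 2)) := by gcongr
        _ = (M ^ 3 * (4 * M) ^ l) * (((l + 1 + 1).choose 2 : ℝ) * (l ! : ℝ)) * s ^ (l + 1 + 2) *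
              δ ^ correctionOrder (l + 1 + 2) := by ring
        _ ≤ ((4 * M) ^ (l + 1 + 2) / 16) * ((l + 1 + 1)! : ℝ) * s ^ (l + 1 + 2) *
              δ ^ correctionOrder (l + 1 + 2) := by
            gcongr
            have e : (4 * M) ^ (l + 1 + 2) / 16 = 4 * (M ^ 3 * (4 * M) ^ l) := by ring
            rw [e]
            have : 0 ≤ M ^ 3 * (4 * M) ^ l := by positivity
            linarith
    -- all terms of order at least three
    have hTle : |T| ≤ (4 * M) ^ (n + 2) / 8 * ((n + 2)! : ℝ) * s ^ (n + 2) *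
        δ ^ correctionOrder (n + 2) := by
      rcases Nat.eq_zero_or_pos n with rfl | hn
      · simp only [hT, Finset.range_zero, Finset.sum_empty, abs_zero]; positivity
      obtain ⟨l, rfl⟩ : ∃ l, n = l + 1 := ⟨n - 1, by omega⟩
      rw [hT, Finset.sum_range_succ']
      have t3 := hthird hn
      have e3 : l + 1 + 1 - (0 + 1 + 1) = l + 1 - 1 := by omega
      have hsum : |∑ j ∈ Finset.range l, ((l + 1 + 1).choose (j + 1 + 1 + 1) : ℝ) *
          cumulantSeq m (j + 1 + 1 + 1 + 1) * m (l + 1 + 1 - (j + 1 + 1 + 1))| ≤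
          l * (M ^ (l + 1 + 2) * ((l + 1 + 1)! : ℝ) * s ^ (l + 1 + 2) * δ ^ 2) := by
        refine (Finset.abs_sum_le_sum_abs _ _).trans ?_
        refine (Finset.sum_le_card_nsmul _ _ _ fun j hj => hterm (j + 1) (by omega)
          (by have := Finset.mem_range.1 hj; omega)).trans (le_of_eq ?_)
        simp
      rw [e3]
      refine (abs_add_le _ _).trans ((add_le_add hsum t3).trans ?_)
      have hp : M ^ (l + 1 + 2) ≤ (4 * M) ^ (l + 1 + 2) / 16 := by
        have e : (4 * M) ^ (l + 1 + 2) / 16 = 4 ^ (l + 1) * M ^ (l + 1 + 2) := by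
          rw [mul_pow, pow_add 4 (l + 1) 2]; ring
        rw [e]
        exact le_mul_of_one_le_left (by positivity) (one_le_pow₀ (by norm_num))
      set Z := (4 * M) ^ (l + 1 + 2) / 16 * ((l + 1 + 1)! : ℝ) * s ^ (l + 1 + 2) *
        δ ^ correctionOrder (l + 1 + 2) with hZ
      have hZ0 : 0 ≤ Z := by positivity
      have hbig : M ^ (l + 1 + 2) * ((l + 1 + 1)! : ℝ) * s ^ (l + 1 + 2) * δ ^ 2 ≤ Z := by
        rw [hZ]; gcongr
      have hl0 : (0 : ℝ) ≤ l := Nat.cast_nonneg l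
      calc _ ≤ (l : ℝ) * Z + Z := by gcongr
        _ ≤ 2 * ((l : ℝ) + 1 + 2) * Z := by nlinarith [mul_nonneg hl0 hZ0]
        _ = _ := by rw [hfac, hZ]; push_cast; ring
    have hmain := ih n (by omega) (by omega)
    have e2 : correctionOrder (n + 2) = correctionOrder n := by
      unfold correctionOrder
      simp [Nat.even_add]
    have hsplit : m (n + 2) - s ^ (n + 2) * gaussMoment (n + 2)
        = T + ((n : ℝ) + 1) * s ^ 2 * (m n - s ^ n * gaussMoment n) := by
      rw [hmn, gaussMoment_add_two]; ring
    rw [hsplit]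
    refine (abs_add_le _ _).trans ((add_le_add hTle ?_).trans_eq (b := 
      (4 * M) ^ (n + 2) / 8 * ((n + 2)! : ℝ) * s ^ (n + 2) * δ ^ correctionOrder (n + 2) +
      7 * ((4 * M) ^ (n + 2) / 8 * ((n + 2)! : ℝ) * s ^ (n + 2) * δ ^ correctionOrder (n + 2)))
      (by ring))
    have hn0 : (0 : ℝ) ≤ n := Nat.cast_nonneg n
    rw [abs_mul, abs_of_nonneg (by positivity)]
    calc ((n : ℝ) + 1) * s ^ 2 * |m n - s ^ n * gaussMoment n|
        ≤ ((n : ℝ) + 1) * s ^ 2 * ((4 * M) ^ n * (n ! : ℝ) * s ^ n * δ ^ correctionOrder n) := by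
          gcongr
      _ = (4 * M) ^ n * ((n + 1)! : ℝ) * s ^ (n + 2) * δ ^ correctionOrder (n + 2) := by
          rw [hfac', e2]; ring
      _ ≤ (7 / 8 * (4 * M) ^ (n + 2)) * ((n + 2)! : ℝ) * s ^ (n + 2) *
          δ ^ correctionOrder (n + 2) := by
          gcongr
          · have : (1 : ℝ) ≤ M ^ 2 := one_le_pow₀ hM
            have h4 : 0 ≤ (4 * M) ^ n := by positivity
            have e : (7 / 8 * (4 * M) ^ (n + 2)) = 14 * M ^ 2 * (4 * M) ^ n := by ring
            rw [e]
            nlinarith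
          · omega
      _ = _ := by ring

/-! ### The explicit moment bound -/

lemma exists_pow_le_const_mul_factorial (e : ℕ) :
    ∃ c : ℝ, 1 ≤ c ∧ ∀ k : ℕ, (k : ℝ) ^ e ≤ c * (k ! : ℝ) := by
  have h := (tendsto_pow_const_div_const_pow_of_one_lt e (one_lt_two (α := ℝ))).bddAbove_range
  obtain ⟨b, hb⟩ := h
  have h2 : ∀ k : ℕ, (2 : ℝ) ^ k ≤ 2 * (k ! : ℝ) := by
    intro k
    induction k with
    | zero => norm_num
    | succ k ih =>
      rcases Nat.eq_zero_or_pos k with rfl | hk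
      · norm_num
      rw [Nat.factorial_succ, pow_succ]
      push_cast
      have hk1 : (1 : ℝ) ≤ k := by exact_mod_cast hk
      have : (0 : ℝ) ≤ (k ! : ℝ) := by positivity
      nlinarith
  refine ⟨max 1 (b * 2), le_max_left _ _, fun k => ?_⟩
  have hbk : (k : ℝ) ^ e / 2 ^ k ≤ b := hb ⟨k, rfl⟩
  rw [div_le_iff₀ (by positivity)] at hbk
  have hb0 : 0 ≤ b := by
    have := hb ⟨0, rfl⟩
    exact le_trans (by positivity) this
  calc (k : ℝ) ^ e ≤ b * 2 ^ k := hbk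
    _ ≤ b * (2 * (k ! : ℝ)) := mul_le_mul_of_nonneg_left (h2 k) hb0
    _ = b * 2 * (k ! : ℝ) := by ring
    _ ≤ _ := mul_le_mul_of_nonneg_right (le_max_right _ _) (by positivity)

lemma rosenthalBound_mono {C C' η R s : ℝ} (hC : 0 ≤ C) (hCC' : C ≤ C') (hR : 0 ≤ R) (hs : 0 ≤ s)
    (p : ℕ) : rosenthalBound C η R s p ≤ rosenthalBound C' η R s p := by
  unfold rosenthalBound
  have : 0 ≤ (p ! : ℝ) ^ (2 + 1 / η) := by positivity
  have : 0 ≤ ∑ u ∈ Finset.Icc 1 ((p - 1) / 2),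
      R ^ u * s ^ (2 * u) * (p : ℝ) ^ u / (u ! : ℝ) ^ 2 :=
    Finset.sum_nonneg fun u _ => by positivity
  gcongr

/-- Every single term of the sum bounds `rosenthalBound` from below. -/
lemma le_rosenthalBound {C η R s : ℝ} (hη : 0 < η) (hC : 0 ≤ C) (hR : 0 ≤ R) (hs : 0 ≤ s) {p u : ℕ}
    (hu : u ∈ Finset.Icc 1 ((p - 1) / 2)) :
    R * C ^ p * (p ! : ℝ) ^ 2 * (R ^ u * s ^ (2 * u) * (p : ℝ) ^ u / (u ! : ℝ) ^ 2)
      ≤ rosenthalBound C η R s p := by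
  have hp1 : (1 : ℝ) ≤ (p ! : ℝ) := by
    exact_mod_cast Nat.one_le_iff_ne_zero.2 p.factorial_ne_zero
  have h1 : (p ! : ℝ) ^ 2 ≤ (p ! : ℝ) ^ (2 + 1 / η) := by
    rw [← Real.rpow_natCast]
    refine Real.rpow_le_rpow_of_exponent_le hp1 ?_
    have : 0 < 1 / η := by positivity
    push_cast; linarith
  have h2 : R ^ u * s ^ (2 * u) * (p : ℝ) ^ u / (u ! : ℝ) ^ 2 ≤ ∑ u ∈ Finset.Icc 1 ((p - 1) / 2),
      R ^ u * s ^ (2 * u) * (p : ℝ) ^ u / (u ! : ℝ) ^ 2 :=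
    Finset.single_le_sum (f := fun u => R ^ u * s ^ (2 * u) * (p : ℝ) ^ u / (u ! : ℝ) ^ 2)
      (fun u _ => by positivity) hu
  unfold rosenthalBound
  gcongr

lemma factorial_half_sq_le (p : ℕ) :
    (((p - 1) / 2)! : ℝ) ^ 2 ≤ (p : ℝ) ^ ((p - 1) / 2) * √(p ! : ℝ) := by
  set u := (p - 1) / 2 with hu
  have h1 : (u ! : ℝ) ≤ (p : ℝ) ^ u := by
    have : u ! ≤ u ^ u := Nat.factorial_le_pow u
    have h : (u ! : ℝ) ≤ (u : ℝ) ^ u := by exact_mod_cast this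
    refine h.trans ?_
    have : (u : ℝ) ≤ p := by exact_mod_cast (by omega : u ≤ p)
    gcongr
  have h2 : (u ! : ℝ) ≤ √(p ! : ℝ) := by
    refine Real.le_sqrt_of_sq_le ?_
    have : u ! * u ! ≤ p ! := by
      refine (Nat.le_of_dvd (Nat.factorial_pos _) (Nat.factorial_mul_factorial_dvd_factorial_add u u)).trans ?_
      exact Nat.factorial_le (by omega)
    rw [sq]; exact_mod_cast this
  rw [sq]
  exact mul_le_mul h1 h2 (by positivity) (by positivity)

/-- Only the last term, `u = ⌊(p - 1) / 2⌋`, is needed once `s` is large. -/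
lemma main_term_le_rosenthalBound {C η R s : ℝ} (hη : 0 < η) (hC : 0 ≤ C) (hR : 0 ≤ R) (hs : 0 ≤ s)
    {p : ℕ} (hp : 2 < p) :
    C ^ p * (p ! : ℝ) * √(p ! : ℝ) * (R ^ ((p - 1) / 2 + 1) * s ^ (2 * ((p - 1) / 2)))
      ≤ rosenthalBound C η R s p := by
  have hu : (p - 1) / 2 ∈ Finset.Icc 1 ((p - 1) / 2) := Finset.mem_Icc.2 ⟨by omega, le_rfl⟩
  refine le_trans ?_ (le_rosenthalBound hη hC hR hs hu)
  have h := factorial_half_sq_le p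
  set u := (p - 1) / 2
  have hu0 : (0 : ℝ) < (u ! : ℝ) ^ 2 := by positivity
  have hp0 : (0 : ℝ) ≤ (p ! : ℝ) := by positivity
  have hsq : √(p ! : ℝ) * √(p ! : ℝ) = p ! := Real.mul_self_sqrt hp0
  have e : R * C ^ p * (p ! : ℝ) ^ 2 * (R ^ u * s ^ (2 * u) * (p : ℝ) ^ u / (u ! : ℝ) ^ 2)
      = C ^ p * (p ! : ℝ) * √(p ! : ℝ) * (R ^ (u + 1) * s ^ (2 * u)) *
        ((p : ℝ) ^ u * √(p ! : ℝ) / (u ! : ℝ) ^ 2) := by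
    rw [sq (p ! : ℝ)]
    nth_rewrite 2 [← hsq]
    ring
  rw [e]
  refine le_mul_of_one_le_right (by positivity) ?_
  rwa [one_le_div hu0]

/-- Moments of a variable of variance `s ^ 2` whose `k`-th cumulant is at most
`s ^ 2 * R ^ (k - 2)` up to powers of `k` satisfy the Rosenthal type bound.  For `p ! ≤ s ^ 4` the
cumulants of order at least five are negligible, whatever the power of `k`; for `s ^ 4 < p !` the
moment and its normal counterpart are bounded separately. -/
lemma exists_moment_bound {η C₁ C₂ : ℝ} (hη : 0 < η) (hC₁ : 1 ≤ C₁) (hC₂ : 1 ≤ C₂) (b : ℕ) :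
    ∃ C : ℝ, 0 < C ∧ ∀ (m : ℕ → ℝ) (s R : ℝ), m 0 = 1 → m 1 = 0 → m 2 = s ^ 2 → 1 ≤ R →
      R ^ 3 ≤ s → (∀ q, |m q| ≤ C₁ ^ q * (q ! : ℝ) * s ^ q) →
      (∀ k, 3 ≤ k → |cumulantSeq m k| ≤ s ^ 2 * R ^ (k - 2) * (C₂ * (k : ℝ) ^ b) ^ k) →
      ∀ p : ℕ, 2 < p → |m p - s ^ p * gaussMoment p| ≤ rosenthalBound C η R s p := by
  obtain ⟨c, hc1, hc⟩ := exists_pow_le_const_mul_factorial (5 * b * 6)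
  have h4b : (1 : ℝ) ≤ 4 ^ b := one_le_pow₀ (by norm_num)
  have hC4 : 0 < C₂ * 4 ^ b := by positivity
  have hCc : 0 < C₂ * c := by positivity
  set M : ℝ := C₁ + C₂ * 4 ^ b + C₂ * c with hM
  have hM1 : 1 ≤ M := by rw [hM]; linarith
  refine ⟨4 * M, by linarith, ?_⟩
  intro m s R h0 h1 h2 hR hRs hm hκ p hp
  have hs1 : 1 ≤ s := (one_le_pow₀ hR).trans hRs
  have hs0 : 0 < s := by linarith
  have hR0 : 0 < R := by linarith
  refine le_trans ?_ (main_term_le_rosenthalBound hη (by linarith) hR0.le hs0.le hp)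
  set u := (p - 1) / 2 with hu
  have hp1 : (1 : ℝ) ≤ (p ! : ℝ) := by
    exact_mod_cast Nat.one_le_iff_ne_zero.2 p.factorial_ne_zero
  rcases le_or_gt (p ! : ℝ) (s ^ 4) with hps | hps
  · set δ := R / s with hδ
    have hδ0 : 0 ≤ δ := by positivity
    have hRs' : R ≤ s := (le_self_pow₀ hR (by norm_num)).trans hRs
    have hδ1 : δ ≤ 1 := (div_le_one hs0).2 hRs'
    have hsδ : s * δ = R := by rw [hδ]; field_simp
    have hδs : δ ^ 6 * s ^ 4 ≤ 1 := by
      have h6 : (R ^ 3) ^ 2 ≤ s ^ 2 := pow_le_pow_left₀ (by positivity) hRs 2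
      have e : δ ^ 6 * s ^ 4 = (R ^ 3) ^ 2 / s ^ 2 := by rw [hδ]; field_simp
      rw [e]
      exact (div_le_one (by positivity)).2 h6
    have e2 : ∀ k, 3 ≤ k → s ^ 2 * R ^ (k - 2) = s ^ k * δ ^ (k - 2) := by
      intro k hk
      rw [← hsδ, mul_pow, ← mul_assoc, ← pow_add]
      congr 2; omega
    have hM4 : C₂ * 4 ^ b ≤ M := by rw [hM]; linarith
    have hMc : C₂ * c ≤ M := by rw [hM]; linarith
    have key := abs_moment_sub_gauss_le (p := p) (q := p) (M := M) h0 h1 h2 hs0.le hδ0 hδ1 hM1 ?_ ?_ ?_ le_rfl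
    · refine key.trans ?_
      have hsq : 1 ≤ √(p ! : ℝ) := Real.one_le_sqrt.2 hp1
      have hle : s ^ p * δ ^ correctionOrder p ≤ R ^ (u + 1) * s ^ (2 * u) := by
        unfold correctionOrder
        split_ifs with he
        · obtain ⟨l, hl⟩ := he
          have e : p = 2 * u + 2 := by omega
          calc s ^ p * δ ^ 2 = s ^ (2 * u) * (s * δ) ^ 2 := by rw [e]; ring
            _ = R ^ 2 * s ^ (2 * u) := by rw [hsδ]; ring
            _ ≤ R ^ (u + 1) * s ^ (2 * u) := by
                gcongr
                omega
        · obtain ⟨l, hl⟩ := Nat.not_even_iff_odd.1 he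
          have e : p = 2 * u + 1 := by omega
          calc s ^ p * δ ^ 1 = s ^ (2 * u) * (s * δ) := by rw [e]; ring
            _ = R ^ 1 * s ^ (2 * u) := by rw [hsδ]; ring
            _ ≤ R ^ (u + 1) * s ^ (2 * u) := by
                gcongr
                omega
      calc (4 * M) ^ p * (p ! : ℝ) * s ^ p * δ ^ correctionOrder p
          = (4 * M) ^ p * (p ! : ℝ) * 1 * (s ^ p * δ ^ correctionOrder p) := by ring
        _ ≤ _ := by gcongr
    · intro q
      refine (hm q).trans ?_
      have : C₁ ≤ M := by rw [hM]; linarith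
      gcongr
    · intro _
      have := hκ 3 le_rfl
      rw [e2 3 le_rfl] at this
      refine this.trans ?_
      have h3 : C₂ * (3 : ℝ) ^ b ≤ M := by
        refine le_trans ?_ hM4
        gcongr
        norm_num
      push_cast
      calc s ^ 3 * δ ^ 1 * (C₂ * 3 ^ b) ^ 3 ≤ s ^ 3 * δ ^ 1 * M ^ 3 := by gcongr
        _ = _ := by ring
    · intro k hk hkp
      have := hκ k (by omega)
      rw [e2 k (by omega)] at this
      refine this.trans ?_
      have hmain : δ ^ (k - 4) * (C₂ * (k : ℝ) ^ b) ^ k ≤ M ^ k := by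
        rcases hk.eq_or_lt with rfl | hk5
        · simp only [Nat.sub_self, pow_zero, one_mul]
          push_cast
          gcongr
        · have hk1 : (1 : ℝ) ≤ k := by exact_mod_cast (by omega : 1 ≤ k)
          have h5 : (k : ℝ) ^ (5 * b) * δ ≤ c := by
            refine le_of_pow_le_pow_left₀ (n := 6) (by norm_num) (by linarith) ?_
            calc ((k : ℝ) ^ (5 * b) * δ) ^ 6 = (k : ℝ) ^ (5 * b * 6) * δ ^ 6 := by
                  rw [mul_pow, ← pow_mul]
              _ ≤ (c * (k ! : ℝ)) * δ ^ 6 := by gcongr; exact hc k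
              _ ≤ (c * s ^ 4) * δ ^ 6 := by
                  gcongr
                  refine le_trans ?_ hps
                  exact_mod_cast Nat.factorial_le hkp
              _ = c * (δ ^ 6 * s ^ 4) := by ring
              _ ≤ c * 1 := by gcongr
              _ ≤ c ^ 6 := by rw [mul_one]; exact le_self_pow₀ hc1 (by norm_num)
          have h6 : ((k : ℝ) ^ b) ^ k ≤ ((k : ℝ) ^ (5 * b)) ^ (k - 4) := by
            rw [← pow_mul, ← pow_mul]
            refine pow_le_pow_right₀ hk1 ?_
            calc b * k ≤ b * (5 * (k - 4)) := by gcongr; omega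
              _ = 5 * b * (k - 4) := by ring
          calc δ ^ (k - 4) * (C₂ * (k : ℝ) ^ b) ^ k
              = C₂ ^ k * (δ ^ (k - 4) * ((k : ℝ) ^ b) ^ k) := by rw [mul_pow]; ring
            _ ≤ C₂ ^ k * (δ ^ (k - 4) * ((k : ℝ) ^ (5 * b)) ^ (k - 4)) := by gcongr
            _ = C₂ ^ k * ((k : ℝ) ^ (5 * b) * δ) ^ (k - 4) := by rw [mul_pow]; ring
            _ ≤ C₂ ^ k * c ^ (k - 4) := by gcongr
            _ ≤ C₂ ^ k * c ^ k := by gcongr; omega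
            _ = (C₂ * c) ^ k := by rw [mul_pow]
            _ ≤ M ^ k := by gcongr
      have e3 : δ ^ (k - 2) = δ ^ 2 * δ ^ (k - 4) := by
        rw [← pow_add]; congr 1; omega
      rw [e3]
      calc s ^ k * (δ ^ 2 * δ ^ (k - 4)) * (C₂ * (k : ℝ) ^ b) ^ k
          = s ^ k * δ ^ 2 * (δ ^ (k - 4) * (C₂ * (k : ℝ) ^ b) ^ k) := by ring
        _ ≤ s ^ k * δ ^ 2 * M ^ k := by gcongr
        _ = _ := by ring
  · have hs2 : s ^ 2 ≤ √(p ! : ℝ) := by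
      refine Real.le_sqrt_of_sq_le ?_
      calc (s ^ 2) ^ 2 = s ^ 4 := by ring
        _ ≤ _ := hps.le
    have hsp : s ^ p ≤ s ^ 2 * s ^ (2 * u) := by
      rw [← pow_add]
      exact pow_le_pow_right₀ hs1 (by omega)
    have hR1 : 1 ≤ R ^ (u + 1) := one_le_pow₀ hR
    have hg := abs_gaussMoment_le p
    have hC : C₁ ^ p + 1 ≤ (4 * M) ^ p := by
      have a1 : (1 : ℝ) ≤ C₁ ^ p := one_le_pow₀ hC₁
      have a2 : (2 * C₁) ^ p ≤ (4 * M) ^ p := by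
        have : C₁ ≤ M := by rw [hM]; linarith
        have : 2 * C₁ ≤ 4 * M := by linarith
        gcongr
      have a3 : 2 * C₁ ^ p ≤ (2 * C₁) ^ p := by
        rw [mul_pow]
        have : (2 : ℝ) ≤ 2 ^ p := le_self_pow₀ (by norm_num) (by omega)
        gcongr
      linarith
    calc |m p - s ^ p * gaussMoment p| ≤ |m p| + |s ^ p * gaussMoment p| := abs_sub _ _
      _ ≤ C₁ ^ p * (p ! : ℝ) * s ^ p + s ^ p * (p ! : ℝ) := by
          refine add_le_add (hm p) ?_
          rw [abs_mul, abs_of_nonneg (by positivity)]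
          gcongr
      _ = (C₁ ^ p + 1) * (p ! : ℝ) * s ^ p := by ring
      _ ≤ (4 * M) ^ p * (p ! : ℝ) * (√(p ! : ℝ) * s ^ (2 * u)) := by
          gcongr
          exact hsp.trans (by gcongr)
      _ = (4 * M) ^ p * (p ! : ℝ) * √(p ! : ℝ) * (1 * s ^ (2 * u)) := by ring
      _ ≤ _ := by gcongr

lemma rosenthalBound_div_le {C η R s r : ℝ} (hC : 0 ≤ C) (hR : 0 ≤ R) (hs : 0 ≤ s) (hr : 0 < r)
    (hr1 : r ≤ 1) {p : ℕ} (hp : 2 < p) :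
    rosenthalBound C η (R / r) s p ≤ rosenthalBound (C / r) η R s p := by
  unfold rosenthalBound
  have hf : 0 ≤ (p ! : ℝ) ^ (2 + 1 / η) := by positivity
  rw [Finset.mul_sum, Finset.mul_sum]
  refine Finset.sum_le_sum fun u hu => ?_
  have hu' := Finset.mem_Icc.1 hu
  have h1 : (r ^ (u + 1))⁻¹ ≤ (r ^ p)⁻¹ := by
    refine inv_anti₀ (by positivity) ?_
    exact pow_le_pow_of_le_one hr.le hr1 (by omega)
  calc R / r * C ^ p * (p ! : ℝ) ^ (2 + 1 / η) *
        ((R / r) ^ u * s ^ (2 * u) * (p : ℝ) ^ u / (u ! : ℝ) ^ 2)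
      = (R * C ^ p * (p ! : ℝ) ^ (2 + 1 / η) *
        (R ^ u * s ^ (2 * u) * (p : ℝ) ^ u / (u ! : ℝ) ^ 2)) * (r ^ (u + 1))⁻¹ := by
        rw [div_pow, pow_succ r u, mul_inv]; ring
    _ ≤ (R * C ^ p * (p ! : ℝ) ^ (2 + 1 / η) *
        (R ^ u * s ^ (2 * u) * (p : ℝ) ^ u / (u ! : ℝ) ^ 2)) * (r ^ p)⁻¹ := by gcongr
    _ = _ := by rw [div_pow]; ring

/-! ### Maximal inequalities and moments of sums over intervals -/

/-- The sum of `x j` over `a < j ≤ b`. -/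
def ivlSum {Ω : Type*} (x : ℕ → Ω → ℝ) (a b : ℕ) (ω : Ω) : ℝ := ∑ j ∈ Finset.Ioc a b, x j ω

/-- `σ`-algebras `F a b` for index intervals `[a, b]` that grow with the interval. -/
structure IsIntervalFiltration {Ω : Type*} [mΩ : MeasurableSpace Ω]
    (F : ℕ → ℕ → MeasurableSpace Ω) (n : ℕ) : Prop where
  le : ∀ a b, b ≤ n → F a b ≤ mΩ
  mono : ∀ a a' b b', a' ≤ a → b ≤ b' → F a b ≤ F a' b'

section Sums

variable {Ω : Type*} {x : ℕ → Ω → ℝ}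

@[simp] lemma ivlSum_self (a : ℕ) (ω : Ω) : ivlSum x a a ω = 0 := by simp [ivlSum]

lemma ivlSum_add {a b c : ℕ} (hab : a ≤ b) (hbc : b ≤ c) (ω : Ω) :
    ivlSum x a b ω + ivlSum x b c ω = ivlSum x a c ω :=
  Finset.sum_Ioc_consecutive (fun j => x j ω) hab hbc

lemma abs_ivlSum_le {n : ℕ} {K : ℝ} (hK : ∀ j, 1 ≤ j → j ≤ n → ∀ ω, |x j ω| ≤ K) {a b : ℕ}
    (hab : a ≤ b) (hb : b ≤ n) (ω : Ω) : |ivlSum x a b ω| ≤ ((b : ℝ) - a) * K := by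
  unfold ivlSum
  refine (Finset.abs_sum_le_sum_abs _ _).trans ?_
  refine (Finset.sum_le_card_nsmul _ _ K fun j hj => ?_).trans (le_of_eq ?_)
  · have := Finset.mem_Ioc.1 hj
    exact hK j (by omega) (by omega) ω
  · rw [Nat.card_Ioc, nsmul_eq_mul, Nat.cast_sub hab]

lemma measurable_ivlSum {G : MeasurableSpace Ω} {a b : ℕ}
    (h : ∀ j ∈ Finset.Ioc a b, Measurable[G] (x j)) : Measurable[G] (ivlSum x a b) :=
  Finset.measurable_fun_sum _ h

/-- Some partial sum `x (a + 1) + ⋯ + x m`, `m ≤ b`, exceeds `c` in absolute value. -/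
def maxEvent (x : ℕ → Ω → ℝ) (a b : ℕ) (c : ℝ) : Set Ω :=
  {ω | ∃ m, a < m ∧ m ≤ b ∧ c < |ivlSum x a m ω|}

/-- `m` is the first index for which the partial sum exceeds `c` in absolute value. -/
def firstPassage (x : ℕ → Ω → ℝ) (a m : ℕ) (c : ℝ) : Set Ω :=
  {ω | (∀ l, a < l → l < m → |ivlSum x a l ω| ≤ c) ∧ c < |ivlSum x a m ω|}

lemma measurableSet_lt_abs_ivlSum {G : MeasurableSpace Ω} {a b : ℕ}
    (h : ∀ j ∈ Finset.Ioc a b, Measurable[G] (x j)) (c : ℝ) :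
    MeasurableSet[G] {ω | c < |ivlSum x a b ω|} :=
  measurableSet_lt measurable_const (measurable_ivlSum h).abs

lemma measurableSet_maxEvent {G : MeasurableSpace Ω} {a b : ℕ}
    (h : ∀ j ∈ Finset.Ioc a b, Measurable[G] (x j)) (c : ℝ) :
    MeasurableSet[G] (maxEvent x a b c) := by
  have : maxEvent x a b c = ⋃ m ∈ Finset.Ioc a b, {ω | c < |ivlSum x a m ω|} := by
    ext ω
    simp only [maxEvent, Set.mem_ofPred_eq, Set.mem_iUnion, Finset.mem_Ioc, exists_prop, and_assoc]
  rw [this]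
  refine Finset.measurableSet_biUnion _ fun m hm => measurableSet_lt_abs_ivlSum (fun j hj => h j ?_) c
  simp only [Finset.mem_Ioc] at hm hj ⊢
  omega

lemma measurableSet_firstPassage {G : MeasurableSpace Ω} {a m : ℕ}
    (h : ∀ j ∈ Finset.Ioc a m, Measurable[G] (x j)) (c : ℝ) :
    MeasurableSet[G] (firstPassage x a m c) := by
  have : firstPassage x a m c
      = (⋂ l ∈ Finset.Ioo a m, {ω | c < |ivlSum x a l ω|}ᶜ) ∩ {ω | c < |ivlSum x a m ω|} := by
    ext ω
    simp [firstPassage, and_imp]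
  rw [this]
  refine MeasurableSet.inter (Finset.measurableSet_biInter _ fun l hl => ?_)
    (measurableSet_lt_abs_ivlSum h c)
  refine (measurableSet_lt_abs_ivlSum (fun j hj => h j ?_) c).compl
  simp only [Finset.mem_Ioc, Finset.mem_Ioo] at hl hj ⊢
  omega

lemma maxEvent_eq_biUnion (a b : ℕ) (c : ℝ) :
    maxEvent x a b c = ⋃ m ∈ Finset.Ioc a b, firstPassage x a m c := by
  classical
  ext ω
  simp only [maxEvent, Set.mem_ofPred_eq, Set.mem_iUnion, Finset.mem_Ioc, exists_prop, firstPassage]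
  constructor
  · rintro ⟨m, h1, h2, h3⟩
    have hex : ∃ m, a < m ∧ m ≤ b ∧ c < |ivlSum x a m ω| := ⟨m, h1, h2, h3⟩
    obtain ⟨k1, k2, k3⟩ := Nat.find_spec hex
    refine ⟨Nat.find hex, ⟨k1, k2⟩, fun l hl1 hl2 => ?_, k3⟩
    by_contra hcon
    exact Nat.find_min hex hl2 ⟨hl1, by omega, not_le.1 hcon⟩
  · rintro ⟨m, ⟨h1, h2⟩, -, h3⟩
    exact ⟨m, h1, h2, h3⟩

lemma pairwiseDisjoint_firstPassage (a b : ℕ) (c : ℝ) :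
    ((Finset.Ioc a b : Finset ℕ) : Set ℕ).PairwiseDisjoint (fun m => firstPassage x a m c) := by
  intro l hl m hm hlm
  simp only [Finset.coe_Ioc, Set.mem_Ioc] at hl hm
  refine Set.disjoint_left.2 fun ω h1 h2 => ?_
  rcases lt_or_gt_of_ne hlm with h | h
  · exact absurd (h2.1 l hl.1 h) (not_le.2 h1.2)
  · exact absurd (h1.1 m hm.1 h) (not_le.2 h2.2)

end Sums

section HoffmannJorgensen

variable {Ω : Type*} [mΩ : MeasurableSpace Ω] {P : Measure Ω} [IsProbabilityMeasure P]
  {F : ℕ → ℕ → MeasurableSpace Ω} {n : ℕ} {x : ℕ → Ω → ℝ}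

lemma measurable_of_interval (hF : IsIntervalFiltration F n)
    (hx : ∀ j, 1 ≤ j → j ≤ n → Measurable[F j j] (x j)) {a b c d : ℕ} (hab : a ≤ c + 1)
    (hd : d ≤ b) (hdn : d ≤ n) : ∀ j ∈ Finset.Ioc c d, Measurable[F a b] (x j) := by
  intro j hj
  have := Finset.mem_Ioc.1 hj
  exact (hx j (by omega) (by omega)).mono (hF.mono j a j b (by omega) (by omega)) le_rfl

/-- Decomposition according to the first passage: an event that, after the first passage at time
`m`, forces an event of the future from time `m + J` on, carries at most the fraction
`1 / 3 + β` of the mass of the passage event. -/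
lemma measure_maxEvent_inter_le (hF : IsIntervalFiltration F n)
    (hx : ∀ j, 1 ≤ j → j ≤ n → Measurable[F j j] (x j)) {J : ℕ}
    (hφ : ∀ k, k + J ≤ n → phiCoeff (F 0 k) (F (k + J) n) P ≤ 1 / 3) {a b : ℕ} (hb : b ≤ n)
    {c β : ℝ} (hβ : 0 ≤ β) {D : Set Ω}
    (hD : ∀ m, a < m → m ≤ b → firstPassage x a m c ∩ D = ∅ ∨ (m + J ≤ n ∧ ∃ B : Set Ω,
      MeasurableSet[F (m + J) n] B ∧ P.real B ≤ β ∧ firstPassage x a m c ∩ D ⊆ B)) :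
    P.real (maxEvent x a b c ∩ D) ≤ (1 / 3 + β) * P.real (maxEvent x a b c) := by
  have hE : ∀ m ∈ Finset.Ioc a b, MeasurableSet[F 0 m] (firstPassage x a m c) := fun m hm =>
    measurableSet_firstPassage (measurable_of_interval hF hx (by omega) le_rfl
      (by have := Finset.mem_Ioc.1 hm; omega)) c
  have hE' : ∀ m ∈ Finset.Ioc a b, MeasurableSet (firstPassage x a m c) := fun m hm =>
    hF.le 0 m (by have := Finset.mem_Ioc.1 hm; omega) _ (hE m hm)
  have hstep : ∀ m ∈ Finset.Ioc a b, P.real (firstPassage x a m c ∩ D)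
      ≤ (1 / 3 + β) * P.real (firstPassage x a m c) := by
    intro m hm
    have hm' := Finset.mem_Ioc.1 hm
    have hE0 : 0 ≤ P.real (firstPassage x a m c) := measureReal_nonneg
    rcases hD m hm'.1 hm'.2 with h | ⟨hmJ, B, hB, hPB, hsub⟩
    · rw [h, measureReal_empty]; positivity
    · have h1 := abs_measure_inter_sub_le (P := P) (hE m hm) hB
      have h2 := hφ m hmJ
      have h3 : P.real (firstPassage x a m c ∩ D) ≤ P.real (firstPassage x a m c ∩ B) :=
        measureReal_mono fun ω hω => ⟨hω.1, hsub hω⟩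
      have h4 := (abs_le.1 h1).2
      have h5 := mul_le_mul_of_nonneg_right h2 hE0
      have h6 := mul_le_mul_of_nonneg_left hPB hE0
      nlinarith
  have hdisj := pairwiseDisjoint_firstPassage (x := x) a b c
  calc P.real (maxEvent x a b c ∩ D)
      = P.real (⋃ m ∈ Finset.Ioc a b, firstPassage x a m c ∩ D) := by
        rw [maxEvent_eq_biUnion, Set.iUnion₂_inter]
    _ ≤ ∑ m ∈ Finset.Ioc a b, P.real (firstPassage x a m c ∩ D) := measureReal_biUnion_finset_le _ _
    _ ≤ ∑ m ∈ Finset.Ioc a b, (1 / 3 + β) * P.real (firstPassage x a m c) :=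
        Finset.sum_le_sum hstep
    _ = _ := by
        rw [← Finset.mul_sum, maxEvent_eq_biUnion, measureReal_biUnion_finset hdisj hE']

lemma measureReal_lt_abs_le {f : Ω → ℝ} (hf : MemLp f 2 P) {c v : ℝ} (hc : 0 < c)
    (hv : ∫ ω, f ω ^ 2 ∂P ≤ v) : P.real {ω | c < |f ω|} ≤ v / c ^ 2 := by
  have h1 := mul_meas_ge_le_integral_of_nonneg (μ := P) (f := fun ω => f ω ^ 2)
    (Eventually.of_forall fun ω => sq_nonneg _) hf.integrable_sq (c ^ 2)
  rw [le_div_iff₀ (by positivity), mul_comm]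
  refine le_trans ?_ (h1.trans hv)
  refine mul_le_mul_of_nonneg_left (measureReal_mono fun ω hω => ?_) (sq_nonneg c)
  change c ^ 2 ≤ f ω ^ 2
  rw [← sq_abs (f ω)]
  exact pow_le_pow_left₀ hc.le (le_of_lt hω) 2

variable {K v : ℝ} {J : ℕ}

lemma memLp_ivlSum (hF : IsIntervalFiltration F n)
    (hx : ∀ j, 1 ≤ j → j ≤ n → Measurable[F j j] (x j))
    (hK : ∀ j, 1 ≤ j → j ≤ n → ∀ ω, |x j ω| ≤ K) {a b : ℕ} (hab : a ≤ b) (hb : b ≤ n)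
    (p : ENNReal) : MemLp (ivlSum x a b) p P := by
  refine MemLp.of_bound (C := ((b : ℝ) - a) * K) ?_ (Eventually.of_forall fun ω => ?_)
  · exact ((measurable_ivlSum (measurable_of_interval hF hx (Nat.zero_le _) le_rfl hb)).mono
      (hF.le 0 b hb) le_rfl).aestronglyMeasurable
  · exact abs_ivlSum_le hK hab hb ω

/-- Ottaviani's inequality: partial sums are controlled by the total sum. -/
lemma measure_maxEvent_le (hF : IsIntervalFiltration F n)
    (hx : ∀ j, 1 ≤ j → j ≤ n → Measurable[F j j] (x j)) (hK0 : 0 ≤ K)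
    (hK : ∀ j, 1 ≤ j → j ≤ n → ∀ ω, |x j ω| ≤ K) (hJ : 1 ≤ J)
    (hφ : ∀ k, k + J ≤ n → phiCoeff (F 0 k) (F (k + J) n) P ≤ 1 / 3)
    {a b : ℕ} (hb : b ≤ n) (hv0 : 0 < v)
    (hv : ∀ c d, a ≤ c → c ≤ d → d ≤ b → ∫ ω, ivlSum x c d ω ^ 2 ∂P ≤ v)
    {s : ℝ} (hs : J * K + √(6 * v) < s) :
    P.real (maxEvent x a b s) ≤ 2 * v / (s - J * K - √(6 * v)) ^ 2 := by
  rcases lt_or_ge b a with hba | hab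
  · have : maxEvent x a b s = ∅ := by
      ext ω; simp only [maxEvent, Set.mem_ofPred_eq, Set.mem_empty_iff_false, iff_false]
      rintro ⟨m, h1, h2, -⟩; omega
    rw [this, measureReal_empty]; positivity
  set lam := √(6 * v) with hlam
  have hlam0 : 0 < lam := Real.sqrt_pos.2 (by positivity)
  have hlam2 : lam ^ 2 = 6 * v := Real.sq_sqrt (by positivity)
  set t := s - J * K - lam with ht
  have ht0 : 0 < t := by rw [ht]; linarith
  have hJ1 : (1 : ℝ) ≤ J := by exact_mod_cast hJ
  have key := measure_maxEvent_inter_le (P := P) (c := s) (β := 1 / 6) (a := a)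
    (D := {ω | t < |ivlSum x a b ω|}ᶜ) hF hx hφ hb (by norm_num) ?_
  · have hsplit := measureReal_inter_add_sdiff (μ := P) (s := maxEvent x a b s)
      (t := {ω | t < |ivlSum x a b ω|}) (hF.le 0 b hb _
        (measurableSet_lt_abs_ivlSum (measurable_of_interval hF hx (by omega) le_rfl hb) t))
    have h1 : P.real (maxEvent x a b s ∩ {ω | t < |ivlSum x a b ω|})
        ≤ P.real {ω | t < |ivlSum x a b ω|} := measureReal_mono Set.inter_subset_right
    have h2 := measureReal_lt_abs_le (memLp_ivlSum (P := P) hF hx hK hab hb 2) ht0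
      (hv a b le_rfl hab le_rfl)
    rw [Set.sdiff_eq] at hsplit
    have e : 2 * v / t ^ 2 = 2 * (v / t ^ 2) := by ring
    rw [e]
    linarith
  · intro m ham hmb
    rcases lt_or_ge (m + J) (b + 1) with hmJ | hmJ
    · refine Or.inr ⟨by omega, {ω | lam < |ivlSum x (m + J - 1) b ω|}, ?_, ?_, ?_⟩
      · exact measurableSet_lt_abs_ivlSum (measurable_of_interval hF hx (by omega) hb hb) lam
      · have := measureReal_lt_abs_le (memLp_ivlSum (P := P) hF hx hK
          (show m + J - 1 ≤ b by omega) hb 2) hlam0 (hv (m + J - 1) b (by omega) (by omega) le_rfl)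
        refine this.trans (le_of_eq ?_)
        rw [hlam2]; field_simp
      · rintro ω ⟨hω1, hω2⟩
        simp only [Set.mem_compl_iff, Set.mem_ofPred_eq, not_lt] at hω2 ⊢
        have e1 := ivlSum_add (x := x) (show a ≤ m by omega) (show m ≤ m + J - 1 by omega) ω
        have e2 := ivlSum_add (x := x) (show a ≤ m + J - 1 by omega)
          (show m + J - 1 ≤ b by omega) ω
        have h3 := abs_ivlSum_le hK (show m ≤ m + J - 1 by omega) (by omega) ω
        have e3 : ((m + J - 1 : ℕ) : ℝ) - m = J - 1 := by
          rw [Nat.cast_sub (by omega)]; push_cast; ring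
        rw [e3] at h3
        have h4 := hω1.2
        have e4 : ivlSum x a m ω = ivlSum x a b ω - ivlSum x (m + J - 1) b ω
          - ivlSum x m (m + J - 1) ω := by linarith
        have h5 : |ivlSum x a m ω| ≤ |ivlSum x a b ω| + |ivlSum x (m + J - 1) b ω|
            + |ivlSum x m (m + J - 1) ω| := by
          rw [e4]
          exact (abs_sub _ _).trans (add_le_add (abs_sub _ _) le_rfl)
        nlinarith
    · left
      refine Set.eq_empty_of_forall_notMem ?_
      rintro ω ⟨hω1, hω2⟩
      simp only [Set.mem_compl_iff, Set.mem_ofPred_eq, not_lt] at hω2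
      have e1 := ivlSum_add (x := x) (show a ≤ m by omega) hmb ω
      have h3 := abs_ivlSum_le hK hmb hb ω
      have h4 := hω1.2
      have h6 : (b : ℝ) - m ≤ J := by
        have : (b : ℝ) ≤ m + J := by exact_mod_cast (by omega : b ≤ m + J)
        linarith
      have h7 := mul_le_mul_of_nonneg_right h6 hK0
      have h5 : |ivlSum x a m ω| ≤ |ivlSum x a b ω| + |ivlSum x m b ω| := by
        have : ivlSum x a m ω = ivlSum x a b ω - ivlSum x m b ω := by linarith
        rw [this]; exact abs_sub _ _
      linarith

/-- The scale on which the sums over an interval have exponential tails. -/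
def tailScale (v K : ℝ) (J : ℕ) : ℝ := 2 * √(6 * v) + 2 * (J * K)

/-- The Hoffmann-Jørgensen step: raising the level by one unit of scale costs a constant factor. -/
lemma measure_maxEvent_add_le (hF : IsIntervalFiltration F n)
    (hx : ∀ j, 1 ≤ j → j ≤ n → Measurable[F j j] (x j)) (hK0 : 0 ≤ K)
    (hK : ∀ j, 1 ≤ j → j ≤ n → ∀ ω, |x j ω| ≤ K) (hJ : 1 ≤ J)
    (hφ : ∀ k, k + J ≤ n → phiCoeff (F 0 k) (F (k + J) n) P ≤ 1 / 3)
    {a b : ℕ} (hb : b ≤ n) (hv0 : 0 < v)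
    (hv : ∀ c d, a ≤ c → c ≤ d → d ≤ b → ∫ ω, ivlSum x c d ω ^ 2 ∂P ≤ v)
    {c : ℝ} (hc : 0 ≤ c) :
    P.real (maxEvent x a b (c + tailScale v K J)) ≤ 2 / 3 * P.real (maxEvent x a b c) := by
  set lam := √(6 * v) with hlam
  have hlam0 : 0 < lam := Real.sqrt_pos.2 (by positivity)
  have hlam2 : lam ^ 2 = 6 * v := Real.sq_sqrt (by positivity)
  have hJK : 0 ≤ J * K := by positivity
  have hJ1 : (1 : ℝ) ≤ J := by exact_mod_cast hJ
  have hsc : tailScale v K J = 2 * lam + 2 * (J * K) := rfl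
  have hsub : maxEvent x a b (c + tailScale v K J) ⊆ maxEvent x a b c := by
    rintro ω ⟨m, h1, h2, h3⟩
    exact ⟨m, h1, h2, lt_of_le_of_lt (by rw [hsc]; linarith) h3⟩
  have key := measure_maxEvent_inter_le (P := P) (c := c) (β := 1 / 3) (a := a)
    (D := maxEvent x a b (c + tailScale v K J)) hF hx hφ hb (by norm_num) ?_
  · rw [Set.inter_eq_self_of_subset_right hsub] at key
    norm_num at key ⊢
    exact key
  · intro m ham hmb
    -- fewer than `J` steps after the first passage the level is exceeded by at most `J * K`
    have hover : ∀ ω ∈ firstPassage x a m c, ∀ l, m ≤ l → l ≤ b → l + 1 ≤ m + J →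
        |ivlSum x a l ω| ≤ c + J * K := by
      intro ω hω l hml hlb hlJ
      have h1 : |ivlSum x a (m - 1) ω| ≤ c := by
        rcases Nat.lt_or_ge a (m - 1) with h | h
        · exact hω.1 (m - 1) h (by omega)
        · rw [show m - 1 = a by omega, ivlSum_self, abs_zero]; exact hc
      have e1 := ivlSum_add (x := x) (show a ≤ m - 1 by omega) (show m - 1 ≤ l by omega) ω
      have h2 := abs_ivlSum_le hK (show m - 1 ≤ l by omega) (by omega) ω
      have h3 : (l : ℝ) - (m - 1 : ℕ) ≤ J := by
        have : (l : ℝ) ≤ J + (m - 1 : ℕ) := by exact_mod_cast (by omega : l ≤ J + (m - 1))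
        linarith
      have h4 := mul_le_mul_of_nonneg_right h3 hK0
      have h5 := abs_add_le (ivlSum x a (m - 1) ω) (ivlSum x (m - 1) l ω)
      rw [e1] at h5
      linarith
    rcases lt_or_ge (m + J) (b + 1) with hmJ | hmJ
    · refine Or.inr ⟨by omega, maxEvent x (m + J - 1) b (2 * lam + J * K), ?_, ?_, ?_⟩
      · exact measurableSet_maxEvent (measurable_of_interval hF hx (by omega) hb hb) _
      · have := measure_maxEvent_le (P := P) (a := m + J - 1) (b := b) (v := v)
          (s := 2 * lam + J * K) hF hx hK0 hK hJ hφ hb hv0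
          (fun c' d' h1 h2 h3 => hv c' d' (by omega) h2 h3) (by rw [← hlam]; linarith)
        refine this.trans (le_of_eq ?_)
        rw [← hlam]
        have e : 2 * lam + J * K - J * K - lam = lam := by ring
        rw [e, hlam2]; field_simp; norm_num
      · rintro ω ⟨hω1, l, hl1, hl2, hl3⟩
        have hl : m + J - 1 < l := by
          by_contra hcon
          rcases Nat.lt_or_ge l m with h | h
          · have := hω1.1 l hl1 h
            rw [hsc] at hl3; linarith
          · have := hover ω hω1 l h hl2 (by omega)
            rw [hsc] at hl3; linarith
        refine ⟨l, hl, hl2, ?_⟩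
        have h1 := hover ω hω1 (m + J - 1) (by omega) (by omega) (by omega)
        have e1 := ivlSum_add (x := x) (show a ≤ m + J - 1 by omega) hl.le ω
        have h2 := abs_add_le (ivlSum x a (m + J - 1) ω) (ivlSum x (m + J - 1) l ω)
        rw [e1] at h2
        rw [hsc] at hl3
        linarith
    · left
      refine Set.eq_empty_of_forall_notMem ?_
      rintro ω ⟨hω1, l, hl1, hl2, hl3⟩
      rw [hsc] at hl3
      rcases Nat.lt_or_ge l m with h | h
      · have := hω1.1 l hl1 h
        linarith
      · have := hover ω hω1 l h hl2 (by omega)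
        linarith

lemma measure_maxEvent_geometric (hF : IsIntervalFiltration F n)
    (hx : ∀ j, 1 ≤ j → j ≤ n → Measurable[F j j] (x j)) (hK0 : 0 ≤ K)
    (hK : ∀ j, 1 ≤ j → j ≤ n → ∀ ω, |x j ω| ≤ K) (hJ : 1 ≤ J)
    (hφ : ∀ k, k + J ≤ n → phiCoeff (F 0 k) (F (k + J) n) P ≤ 1 / 3)
    {a b : ℕ} (hb : b ≤ n) (hv0 : 0 < v)
    (hv : ∀ c d, a ≤ c → c ≤ d → d ≤ b → ∫ ω, ivlSum x c d ω ^ 2 ∂P ≤ v) (i : ℕ) :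
    P.real (maxEvent x a b ((i + 1) * tailScale v K J))
      ≤ (2 / 3) ^ i * (8 * v / tailScale v K J ^ 2) := by
  have hlam0 : 0 < √(6 * v) := Real.sqrt_pos.2 (by positivity)
  have hJK : 0 ≤ J * K := by positivity
  have hM0 : 0 < tailScale v K J := by unfold tailScale; positivity
  induction i with
  | zero =>
    have := measure_maxEvent_le (P := P) (a := a) (b := b) (v := v)
      (s := tailScale v K J) hF hx hK0 hK hJ hφ hb hv0 hv (by unfold tailScale; linarith)
    simp only [Nat.cast_zero, zero_add, one_mul, pow_zero]
    refine this.trans (le_of_eq ?_)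
    have e : tailScale v K J - J * K - √(6 * v) = tailScale v K J / 2 := by
      unfold tailScale; ring
    rw [e]; field_simp; norm_num
  | succ i ih =>
    have := measure_maxEvent_add_le (P := P) (a := a) (b := b) (v := v)
      (c := (i + 1) * tailScale v K J) hF hx hK0 hK hJ hφ hb hv0 hv (by positivity)
    have e : ((i + 1 : ℕ) + 1 : ℝ) * tailScale v K J
        = (i + 1) * tailScale v K J + tailScale v K J := by push_cast; ring
    rw [e, pow_succ]
    refine this.trans ?_
    linarith

lemma sum_pow_mul_geometric_le (m L : ℕ) :
    ∑ i ∈ Finset.range L, ((i : ℝ) + 2) ^ m * (2 / 3) ^ i ≤ 10 * 5 ^ m * (m ! : ℝ) := by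
  have hexp : Real.exp (1 / 5) ≤ 5 / 4 := by
    have h := Real.one_sub_le_exp_neg (1 / 5)
    rw [Real.exp_neg] at h
    have h5 := Real.exp_pos (1 / 5)
    have : (4 / 5 : ℝ) ≤ (Real.exp (1 / 5))⁻¹ := by linarith
    rw [le_inv_comm₀ (by norm_num) h5] at this
    norm_num at this ⊢
    exact this
  have hterm : ∀ i : ℕ, ((i : ℝ) + 2) ^ m * (2 / 3) ^ i
      ≤ (5 ^ m * (m ! : ℝ) * (25 / 16)) * (5 / 6) ^ i := by
    intro i
    have h1 := Real.pow_div_factorial_le_exp (((i : ℝ) + 2) / 5) (by positivity) m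
    rw [div_le_iff₀ (by positivity), div_pow, div_le_iff₀ (by positivity)] at h1
    have h2 : Real.exp (((i : ℝ) + 2) / 5) ≤ (5 / 4) ^ (i + 2) := by
      have e : ((i : ℝ) + 2) / 5 = ((i + 2 : ℕ) : ℝ) * (1 / 5) := by push_cast; ring
      rw [e, Real.exp_nat_mul]
      exact pow_le_pow_left₀ (Real.exp_pos _).le hexp _
    calc ((i : ℝ) + 2) ^ m * (2 / 3) ^ i
        ≤ ((5 / 4) ^ (i + 2) * (m ! : ℝ) * 5 ^ m) * (2 / 3) ^ i := by
          gcongr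
          exact h1.trans (by gcongr)
      _ = 5 ^ m * (m ! : ℝ) * (25 / 16) * ((5 / 4) ^ i * (2 / 3) ^ i) := by ring
      _ = _ := by rw [← mul_pow]; norm_num
  have hgeom : ∑ i ∈ Finset.range L, (5 / 6 : ℝ) ^ i ≤ 6 := by
    have h := geom_sum_eq (show (5 / 6 : ℝ) ≠ 1 by norm_num) L
    rw [h]
    have : (0 : ℝ) ≤ (5 / 6) ^ L := by positivity
    rw [div_le_iff_of_neg (by norm_num)]
    linarith
  calc _ ≤ ∑ i ∈ Finset.range L, (5 ^ m * (m ! : ℝ) * (25 / 16)) * (5 / 6) ^ i :=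
        Finset.sum_le_sum fun i _ => hterm i
    _ = (5 ^ m * (m ! : ℝ) * (25 / 16)) * ∑ i ∈ Finset.range L, (5 / 6 : ℝ) ^ i := by
        rw [Finset.mul_sum]
    _ ≤ (5 ^ m * (m ! : ℝ) * (25 / 16)) * 6 := by gcongr
    _ ≤ _ := by
        have : (0 : ℝ) ≤ 5 ^ m * (m ! : ℝ) := by positivity
        linarith

/-- Moments of a sum over an interval in terms of a bound `v` for the variances of the sums over
its subintervals.  The factor `v / scale ^ 2` that is gained is what makes the later bounds for
cumulants proportional to the variance. -/
lemma integral_abs_ivlSum_pow_le (hF : IsIntervalFiltration F n)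
    (hx : ∀ j, 1 ≤ j → j ≤ n → Measurable[F j j] (x j)) (hK0 : 0 ≤ K)
    (hK : ∀ j, 1 ≤ j → j ≤ n → ∀ ω, |x j ω| ≤ K) (hJ : 1 ≤ J)
    (hφ : ∀ k, k + J ≤ n → phiCoeff (F 0 k) (F (k + J) n) P ≤ 1 / 3)
    {a b : ℕ} (hab : a ≤ b) (hb : b ≤ n) (hv0 : 0 < v)
    (hv : ∀ c d, a ≤ c → c ≤ d → d ≤ b → ∫ ω, ivlSum x c d ω ^ 2 ∂P ≤ v) {m : ℕ} (hm : 2 ≤ m) :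
    ∫ ω, |ivlSum x a b ω| ^ m ∂P
      ≤ v / tailScale v K J ^ 2 * ((45 * tailScale v K J) ^ m * (m ! : ℝ)) := by
  set M := tailScale v K J with hMdef
  have hlam0 : 0 < √(6 * v) := Real.sqrt_pos.2 (by positivity)
  have hJK : 0 ≤ J * K := by positivity
  have hM0 : 0 < M := by rw [hMdef]; unfold tailScale; positivity
  set S := ivlSum x a b with hS
  obtain ⟨L, hL⟩ := exists_nat_ge (((b : ℝ) - a) * K / M)
  have hSL : ∀ ω, |S ω| ≤ L * M := fun ω => by
    rw [div_le_iff₀ hM0] at hL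
    exact (abs_ivlSum_le hK hab hb ω).trans hL
  have hSm : ∀ q : ENNReal, MemLp S q P := fun q => memLp_ivlSum hF hx hK hab hb q
  set A : ℕ → Set Ω := fun i => {ω | ((i : ℝ) + 1) * M < |S ω|} with hA
  have hAm : ∀ i, MeasurableSet (A i) := fun i => hF.le 0 b hb _
    (measurableSet_lt_abs_ivlSum (measurable_of_interval hF hx (by omega) le_rfl hb) _)
  have hPA : ∀ i, P.real (A i) ≤ (2 / 3) ^ i * (8 * v / M ^ 2) := by
    intro i
    refine le_trans (measureReal_mono ?_) (measure_maxEvent_geometric (P := P) (a := a) (b := b)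
      (v := v) hF hx hK0 hK hJ hφ hb hv0 hv i)
    intro ω hω
    rcases hab.eq_or_lt with rfl | hlt
    · have h1 : ((i : ℝ) + 1) * M < |S ω| := hω
      rw [hS, ivlSum_self, abs_zero] at h1
      exact absurd h1 (not_lt.2 (by positivity))
    · exact ⟨b, hlt, le_rfl, hω⟩
  -- decomposition according to the levels `(i + 1) * M` that `|S|` exceeds
  have hpt : ∀ ω, |S ω| ^ m ≤ M ^ (m - 2) * S ω ^ 2 +
      ∑ i ∈ Finset.range L, (A i).indicator (fun _ => (((i : ℝ) + 2) * M) ^ m) ω := by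
    intro ω
    have hsum0 : 0 ≤ ∑ i ∈ Finset.range L,
        (A i).indicator (fun _ => (((i : ℝ) + 2) * M) ^ m) ω :=
      Finset.sum_nonneg fun i _ => Set.indicator_nonneg (fun _ _ => by positivity) ω
    rcases le_or_gt (|S ω|) M with h | h
    · have e : |S ω| ^ m = |S ω| ^ (m - 2) * S ω ^ 2 := by
        rw [← sq_abs (S ω), ← pow_add]; congr 1; omega
      rw [e]
      have : |S ω| ^ (m - 2) ≤ M ^ (m - 2) := pow_le_pow_left₀ (abs_nonneg _) h _
      have := mul_le_mul_of_nonneg_right this (sq_nonneg (S ω))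
      linarith
    · have hz : 1 < |S ω| / M := (one_lt_div hM0).2 h
      set i := ⌈|S ω| / M⌉₊ - 2 with hi
      have hc2 : 2 ≤ ⌈|S ω| / M⌉₊ := by
        have : 1 < ⌈|S ω| / M⌉₊ := Nat.lt_ceil.2 (by exact_mod_cast hz)
        omega
      have hci : ⌈|S ω| / M⌉₊ = i + 2 := by omega
      have hup : |S ω| ≤ ((i : ℝ) + 2) * M := by
        have := Nat.le_ceil (|S ω| / M)
        rw [hci, div_le_iff₀ hM0] at this
        exact_mod_cast this
      have hlo : ((i : ℝ) + 1) * M < |S ω| := by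
        have : ((i + 1 : ℕ) : ℝ) < |S ω| / M := Nat.lt_ceil.1 (by omega)
        rw [lt_div_iff₀ hM0] at this
        exact_mod_cast this
      have hiL : i < L := by
        have h1 := hlo.trans_le (hSL ω)
        have h2 : (i : ℝ) + 1 < L := lt_of_mul_lt_mul_right h1 hM0.le
        have : i + 1 < L := by exact_mod_cast h2
        omega
      have h3 : (((i : ℝ) + 2) * M) ^ m ≤ ∑ i ∈ Finset.range L,
          (A i).indicator (fun _ => (((i : ℝ) + 2) * M) ^ m) ω := by
        have := Finset.single_le_sum (s := Finset.range L)
          (f := fun i : ℕ => (A i).indicator (fun _ => (((i : ℝ) + 2) * M) ^ m) ω)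
          (fun i _ => Set.indicator_nonneg (fun _ _ => by positivity) ω) (Finset.mem_range.2 hiL)
        have hmem : ω ∈ A i := hlo
        rwa [Set.indicator_of_mem hmem] at this
      have h4 : |S ω| ^ m ≤ (((i : ℝ) + 2) * M) ^ m := pow_le_pow_left₀ (abs_nonneg _) hup _
      have h5 : 0 ≤ M ^ (m - 2) * S ω ^ 2 := by positivity
      linarith
  have hint1 : Integrable (fun ω => M ^ (m - 2) * S ω ^ 2) P :=
    (hSm 2).integrable_sq.const_mul _
  have hint2 : ∀ i ∈ Finset.range L,
      Integrable ((A i).indicator (fun _ => (((i : ℝ) + 2) * M) ^ m)) P :=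
    fun i _ => (integrable_const _).indicator (hAm i)
  calc ∫ ω, |S ω| ^ m ∂P ≤ ∫ ω, (M ^ (m - 2) * S ω ^ 2 +
      ∑ i ∈ Finset.range L, (A i).indicator (fun _ => (((i : ℝ) + 2) * M) ^ m) ω) ∂P := by
        refine integral_mono_of_nonneg (Eventually.of_forall fun ω => by positivity)
          (hint1.add (integrable_finsetSum _ hint2)) (Eventually.of_forall hpt)
    _ = M ^ (m - 2) * ∫ ω, S ω ^ 2 ∂P +
        ∑ i ∈ Finset.range L, (((i : ℝ) + 2) * M) ^ m * P.real (A i) := by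
        rw [integral_add hint1 (integrable_finsetSum _ hint2), integral_const_mul,
          integral_finsetSum _ hint2]
        congr 1
        refine Finset.sum_congr rfl fun i _ => ?_
        rw [integral_indicator (hAm i), setIntegral_const, smul_eq_mul, mul_comm]
    _ ≤ M ^ (m - 2) * v + ∑ i ∈ Finset.range L,
        (((i : ℝ) + 2) * M) ^ m * ((2 / 3) ^ i * (8 * v / M ^ 2)) := by
        gcongr with i _
        · exact hv a b le_rfl hab le_rfl
        · exact hPA i
    _ = v / M ^ 2 * M ^ m *
        (1 + 8 * ∑ i ∈ Finset.range L, ((i : ℝ) + 2) ^ m * (2 / 3) ^ i) := by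
        have e : M ^ m = M ^ (m - 2) * M ^ 2 := by rw [← pow_add]; congr 1; omega
        rw [mul_add, mul_one, Finset.mul_sum, Finset.mul_sum]
        congr 1
        · rw [e]; field_simp
        · refine Finset.sum_congr rfl fun i _ => ?_
          rw [mul_pow]; ring
    _ ≤ v / M ^ 2 * M ^ m * (45 ^ m * (m ! : ℝ)) := by
        gcongr
        have h1 := sum_pow_mul_geometric_le m L
        have h2 : (81 : ℝ) * 5 ^ m ≤ 45 ^ m := by
          have e : (45 : ℝ) ^ m = 9 ^ m * 5 ^ m := by rw [← mul_pow]; norm_num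
          rw [e]
          have : (9 : ℝ) ^ 2 ≤ 9 ^ m := pow_le_pow_right₀ (by norm_num) hm
          have h5 : (0 : ℝ) < 5 ^ m := by positivity
          nlinarith
        have h3 : (1 : ℝ) ≤ (m ! : ℝ) := by
          exact_mod_cast Nat.one_le_iff_ne_zero.2 m.factorial_ne_zero
        have h4 : (1 : ℝ) ≤ 5 ^ m := one_le_pow₀ (by norm_num)
        have h5 : (1 : ℝ) ≤ 5 ^ m * (m ! : ℝ) := by nlinarith
        calc _ ≤ 5 ^ m * (m ! : ℝ) + 8 * (10 * 5 ^ m * (m ! : ℝ)) := by gcongr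
          _ = 81 * 5 ^ m * (m ! : ℝ) := by ring
          _ ≤ _ := by gcongr
    _ = _ := by rw [mul_pow]; ring

end HoffmannJorgensen

/-! ### Variances and the decomposition into blocks -/

/-- A row `x 1, …, x n` of bounded centered variables adapted to an interval filtration, with
bounds `K` and `κ` for the `L^∞` and `L^2` norms and `ρ j` for the maximal correlation at distance
`j`. -/
structure MixingRow {Ω : Type*} [MeasurableSpace Ω] (P : Measure Ω)
    (F : ℕ → ℕ → MeasurableSpace Ω) (n : ℕ) (x : ℕ → Ω → ℝ) (K κ : ℝ) (ρ : ℕ → ℝ) : Prop where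
  filt : IsIntervalFiltration F n
  meas : ∀ j, 1 ≤ j → j ≤ n → Measurable[F j j] (x j)
  K_nonneg : 0 ≤ K
  bdd : ∀ j, 1 ≤ j → j ≤ n → ∀ ω, |x j ω| ≤ K
  centered : ∀ j, 1 ≤ j → j ≤ n → ∫ ω, x j ω ∂P = 0
  sq_le : ∀ j, 1 ≤ j → j ≤ n → ∫ ω, x j ω ^ 2 ∂P ≤ κ ^ 2
  rho_nonneg : ∀ j, 0 ≤ ρ j
  rho_le : ∀ k j, k + j ≤ n → rhoCoeff (F 0 k) (F (k + j) n) P ≤ ρ j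

section Second

variable {Ω : Type*} [mΩ : MeasurableSpace Ω] {P : Measure Ω}

lemma integral_add_sq_le {f g : Ω → ℝ} (hf : MemLp f 2 P) (hg : MemLp g 2 P) :
    ∫ ω, (f ω + g ω) ^ 2 ∂P ≤ 2 * ∫ ω, f ω ^ 2 ∂P + 2 * ∫ ω, g ω ^ 2 ∂P := by
  rw [← integral_const_mul, ← integral_const_mul,
    ← integral_add (hf.integrable_sq.const_mul 2) (hg.integrable_sq.const_mul 2)]
  refine integral_mono (hf.add hg).integrable_sq
    ((hf.integrable_sq.const_mul 2).add (hg.integrable_sq.const_mul 2)) fun ω => ?_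
  nlinarith [sq_nonneg (f ω - g ω)]

lemma integral_sub_sq_le {f g : Ω → ℝ} (hf : MemLp f 2 P) (hg : MemLp g 2 P) :
    ∫ ω, (f ω - g ω) ^ 2 ∂P ≤ 2 * ∫ ω, f ω ^ 2 ∂P + 2 * ∫ ω, g ω ^ 2 ∂P := by
  have h := integral_add_sq_le hf hg.neg
  simpa [sub_eq_add_neg] using h

lemma integral_add_sq {f g : Ω → ℝ} (hf : MemLp f 2 P) (hg : MemLp g 2 P) :
    ∫ ω, (f ω + g ω) ^ 2 ∂P
      = ∫ ω, f ω ^ 2 ∂P + 2 * ∫ ω, f ω * g ω ∂P + ∫ ω, g ω ^ 2 ∂P := by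
  have hi : Integrable (fun ω => 2 * (f ω * g ω)) P := (hf.integrable_mul hg).const_mul 2
  rw [← integral_const_mul, ← integral_add hf.integrable_sq hi,
    ← integral_add (f := fun ω => f ω ^ 2 + 2 * (f ω * g ω)) (hf.integrable_sq.add hi)
      hg.integrable_sq]
  exact integral_congr_ae (Eventually.of_forall fun ω => by ring)

/-- Sums of weakly correlated variables: if the correlation of `Z i` and `Z j` is at most
`ρ (r * |i - j|)` and these coefficients sum to at most `1 / 4`, then the variance of the sum is
comparable to the sum of the variances. -/
lemma abs_integral_sum_sq_sub_le {ρ : ℕ → ℝ} (hρ0 : ∀ j, 0 ≤ ρ j) {n r : ℕ} (hr : 1 ≤ r)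
    (hρ : ∑ m ∈ Finset.Icc 1 (n / r), ρ (r * m) ≤ 1 / 4) {Z : ℕ → Ω → ℝ} {N : ℕ}
    (hZ : ∀ i, i < N → MemLp (Z i) 2 P)
    (hcov : ∀ i j, i < j → j < N → r * (j - i) ≤ n ∧
      |∫ ω, Z i ω * Z j ω ∂P| ≤ ρ (r * (j - i)) * l2norm P (Z i) * l2norm P (Z j)) :
    |∫ ω, (∑ i ∈ Finset.range N, Z i ω) ^ 2 ∂P - ∑ i ∈ Finset.range N, ∫ ω, Z i ω ^ 2 ∂P|
      ≤ 1 / 2 * ∑ i ∈ Finset.range N, ∫ ω, Z i ω ^ 2 ∂P := by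
  set z : ℕ → ℝ := fun i => ∫ ω, Z i ω ^ 2 ∂P with hz
  have hz0 : ∀ i, 0 ≤ z i := fun i => integral_nonneg fun _ => sq_nonneg _
  have hpair : ∀ i j, i < j → j < N →
      2 * |∫ ω, Z i ω * Z j ω ∂P| ≤ ρ (r * (j - i)) * (z i + z j) := by
    intro i j hij hj
    have h1 := (hcov i j hij hj).2
    have h2 := hρ0 (r * (j - i))
    have e1 : l2norm P (Z i) ^ 2 = z i := l2norm_sq _
    have e2 : l2norm P (Z j) ^ 2 = z j := l2norm_sq _
    rw [← e1, ← e2]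
    nlinarith [mul_nonneg h2 (sq_nonneg (l2norm P (Z i) - l2norm P (Z j)))]
  have hdiff : ∀ M ≤ N, |∫ ω, (∑ i ∈ Finset.range M, Z i ω) ^ 2 ∂P - ∑ i ∈ Finset.range M, z i|
      ≤ ∑ j ∈ Finset.range M, ∑ i ∈ Finset.range j, ρ (r * (j - i)) * (z i + z j) := by
    intro M
    induction M with
    | zero => intro _; simp
    | succ M ih =>
      intro hM
      have hsum : MemLp (fun ω => ∑ i ∈ Finset.range M, Z i ω) 2 P :=
        memLp_finsetSum _ fun i hi => hZ i (by have := Finset.mem_range.1 hi; omega)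
      have e := integral_add_sq hsum (hZ M (by omega))
      have e2 : ∫ ω, (∑ i ∈ Finset.range M, Z i ω) * Z M ω ∂P
          = ∑ i ∈ Finset.range M, ∫ ω, Z i ω * Z M ω ∂P := by
        simp_rw [Finset.sum_mul]
        exact integral_finsetSum _ fun i hi =>
          (hZ i (by have := Finset.mem_range.1 hi; omega)).integrable_mul (hZ M (by omega))
      simp_rw [Finset.sum_range_succ]
      rw [e, e2]
      have h1 := ih (by omega)
      have h2 : |2 * ∑ i ∈ Finset.range M, ∫ ω, Z i ω * Z M ω ∂P|
          ≤ ∑ i ∈ Finset.range M, ρ (r * (M - i)) * (z i + z M) := by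
        rw [Finset.mul_sum]
        refine (Finset.abs_sum_le_sum_abs _ _).trans (Finset.sum_le_sum fun i hi => ?_)
        rw [abs_mul, abs_two]
        exact hpair i M (Finset.mem_range.1 hi) (by omega)
      have e3 : ∫ ω, (∑ i ∈ Finset.range M, Z i ω) ^ 2 ∂P
          + 2 * ∑ i ∈ Finset.range M, ∫ ω, Z i ω * Z M ω ∂P + ∫ ω, Z M ω ^ 2 ∂P
          - (∑ i ∈ Finset.range M, z i + z M)
          = (∫ ω, (∑ i ∈ Finset.range M, Z i ω) ^ 2 ∂P - ∑ i ∈ Finset.range M, z i)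
            + 2 * ∑ i ∈ Finset.range M, ∫ ω, Z i ω * Z M ω ∂P := by
        simp only [hz]; ring
      rw [e3]
      exact (abs_add_le _ _).trans (add_le_add h1 h2)
  -- the correlations of a fixed block with all the others on one side sum to at most `1 / 4`
  have hinj : ∀ (s : Finset ℕ) (f : ℕ → ℕ), Set.InjOn f s →
      (∀ i ∈ s, 1 ≤ f i ∧ r * f i ≤ n) → ∑ i ∈ s, ρ (r * f i) ≤ 1 / 4 := by
    intro s f hf hs
    rw [← Finset.sum_image (f := fun m => ρ (r * m)) hf]
    refine le_trans (Finset.sum_le_sum_of_subset_of_nonneg ?_ fun m _ _ => hρ0 _) hρ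
    intro m hm
    obtain ⟨i, hi, rfl⟩ := Finset.mem_image.1 hm
    refine Finset.mem_Icc.2 ⟨(hs i hi).1, ?_⟩
    rw [Nat.le_div_iff_mul_le (by omega), mul_comm]
    exact (hs i hi).2
  have hA : ∑ j ∈ Finset.range N, ∑ i ∈ Finset.range j, ρ (r * (j - i)) * z j
      ≤ 1 / 4 * ∑ j ∈ Finset.range N, z j := by
    rw [Finset.mul_sum]
    refine Finset.sum_le_sum fun j hj => ?_
    rw [← Finset.sum_mul]
    refine mul_le_mul_of_nonneg_right (hinj _ (fun i => j - i) ?_ ?_) (hz0 j)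
    · intro i hi i' hi' h
      simp only [Finset.coe_range, Set.mem_Iio] at hi hi' h
      omega
    · intro i hi
      have := Finset.mem_range.1 hi
      exact ⟨by omega, (hcov i j this (Finset.mem_range.1 hj)).1⟩
  have hB : ∑ j ∈ Finset.range N, ∑ i ∈ Finset.range j, ρ (r * (j - i)) * z i
      ≤ 1 / 4 * ∑ j ∈ Finset.range N, z j := by
    have hcomm : ∑ j ∈ Finset.range N, ∑ i ∈ Finset.range j, ρ (r * (j - i)) * z i
        = ∑ i ∈ Finset.range N, ∑ j ∈ Finset.Ioo i N, ρ (r * (j - i)) * z i := by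
      refine Finset.sum_comm' fun j i => ?_
      simp only [Finset.mem_range, Finset.mem_Ioo]
      omega
    rw [hcomm, Finset.mul_sum]
    refine Finset.sum_le_sum fun i _ => ?_
    rw [← Finset.sum_mul]
    refine mul_le_mul_of_nonneg_right (hinj _ (fun j => j - i) ?_ ?_) (hz0 i)
    · intro j hj j' hj' h
      simp only [Finset.coe_Ioo, Set.mem_Ioo] at hj hj' h
      omega
    · intro j hj
      have := Finset.mem_Ioo.1 hj
      exact ⟨by omega, (hcov i j this.1 this.2).1⟩
  refine (hdiff N le_rfl).trans ?_
  simp_rw [mul_add, Finset.sum_add_distrib]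
  linarith

end Second

section Blocks

variable {Ω : Type*} [mΩ : MeasurableSpace Ω] {P : Measure Ω}
  {F : ℕ → ℕ → MeasurableSpace Ω} {n : ℕ} {x : ℕ → Ω → ℝ} {K κ : ℝ} {ρ : ℕ → ℝ}

/-- The row restricted to the indices `c < j ≤ d`. -/
lemma MixingRow.restrict (h : MixingRow P F n x K κ ρ) (c d : ℕ) :
    MixingRow P F n (fun j => if c < j ∧ j ≤ d then x j else fun _ => 0) K κ ρ where
  filt := h.filt
  meas := by
    intro j h1 h2
    split_ifs
    · exact h.meas j h1 h2
    · exact measurable_const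
  K_nonneg := h.K_nonneg
  bdd := by
    intro j h1 h2 ω
    split_ifs
    · exact h.bdd j h1 h2 ω
    · simpa using h.K_nonneg
  centered := by
    intro j h1 h2
    split_ifs
    · exact h.centered j h1 h2
    · simp
  sq_le := by
    intro j h1 h2
    split_ifs
    · exact h.sq_le j h1 h2
    · simpa using sq_nonneg κ
  rho_nonneg := h.rho_nonneg
  rho_le := h.rho_le

/-- Blocks `(T i, T (i + 1)]`, `i ≤ N`, of a row with variances of the order `Q`: all of them but
the last, which is left over and may be short, have length at least `2 * r` and variance at least
`16 * Q`, and no interval inside a block has variance above `132 * Q`. -/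
structure IsBlocks (P : Measure Ω) (x : ℕ → Ω → ℝ) (n r : ℕ) (Q : ℝ) (N : ℕ) (T : ℕ → ℕ) :
    Prop where
  zero : T 0 = 0
  last : T (N + 1) = n
  le_last : T N ≤ n
  length : ∀ i < N, T i + 2 * r ≤ T (i + 1)
  lower : ∀ i < N, 16 * Q ≤ ∫ ω, ivlSum x (T i) (T (i + 1)) ω ^ 2 ∂P
  upper : ∀ i ≤ N, ∀ c d, T i ≤ c → c ≤ d → d ≤ T (i + 1) →
    ∫ ω, ivlSum x c d ω ^ 2 ∂P ≤ 132 * Q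
  rest : ∫ ω, ivlSum x (T N) n ω ^ 2 ∂P ≤ 16 * Q

variable {r N : ℕ} {Q : ℝ} {T : ℕ → ℕ}

lemma IsBlocks.add_le (hB : IsBlocks P x n r Q N T) {i j : ℕ} (hij : i ≤ j) (hj : j ≤ N) :
    T i + 2 * r * (j - i) ≤ T j := by
  induction j, hij using Nat.le_induction with
  | base => simp
  | succ j hij ih =>
    have h1 := ih (by omega)
    have h2 := hB.length j (by omega)
    have e : j + 1 - i = (j - i) + 1 := by omega
    rw [e, mul_add]
    omega

lemma IsBlocks.le_n (hB : IsBlocks P x n r Q N T) {i : ℕ} (hi : i ≤ N + 1) : T i ≤ n := by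
  rcases hi.eq_or_lt with rfl | hi
  · exact hB.last.le
  · exact (le_trans (Nat.le_add_right _ _) (hB.add_le (show i ≤ N by omega) le_rfl)).trans
      hB.le_last

lemma IsBlocks.mono (hB : IsBlocks P x n r Q N T) {i j : ℕ} (hij : i ≤ j) (hj : j ≤ N + 1) :
    T i ≤ T j := by
  rcases hj.eq_or_lt with rfl | hj
  · rw [hB.last]; exact hB.le_n hij
  · exact le_trans (Nat.le_add_right _ _) (hB.add_le hij (by omega))

lemma IsBlocks.sum_eq (hB : IsBlocks P x n r Q N T) (y : ℕ → Ω → ℝ) {L : ℕ} (hL : L ≤ N + 1)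
    (ω : Ω) : ∑ i ∈ Finset.range L, ivlSum y (T i) (T (i + 1)) ω = ivlSum y 0 (T L) ω := by
  induction L with
  | zero => simp [hB.zero]
  | succ L ih =>
    rw [Finset.sum_range_succ, ih (by omega)]
    exact ivlSum_add (Nat.zero_le _) (hB.mono (by omega) hL) ω

lemma IsBlocks.sum_eq' (hB : IsBlocks P x n r Q N T) (y : ℕ → Ω → ℝ) {L : ℕ} (hL : L ≤ N + 1)
    (ω : Ω) : ivlSum y 0 (T L) ω
      = (∑ i ∈ Finset.range L, ivlSum y (T i) (min (T i + r) (T (i + 1))) ω)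
        + ∑ i ∈ Finset.range L, ivlSum y (min (T i + r) (T (i + 1))) (T (i + 1)) ω := by
  rw [← hB.sum_eq y hL, ← Finset.sum_add_distrib]
  refine Finset.sum_congr rfl fun i hi => (ivlSum_add ?_ (min_le_right _ _) ω).symm
  exact le_min (by omega) (hB.mono (by omega) (by have := Finset.mem_range.1 hi; omega))

variable [IsProbabilityMeasure P]

namespace MixingRow

lemma memLp (h : MixingRow P F n x K κ ρ) {a b : ℕ} (hb : b ≤ n) (p : ENNReal) :
    MemLp (ivlSum x a b) p P := by
  rcases le_or_gt a b with hab | hab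
  · exact memLp_ivlSum h.filt h.meas h.bdd hab hb p
  · have : ivlSum x a b = fun _ => 0 := by
      funext ω; unfold ivlSum; rw [Finset.Ioc_eq_empty (by omega), Finset.sum_empty]
    rw [this]; exact memLp_const 0

lemma memLp_single (h : MixingRow P F n x K κ ρ) {j : ℕ} (hj : 1 ≤ j) (hjn : j ≤ n)
    (p : ENNReal) : MemLp (x j) p P :=
  MemLp.of_bound ((h.meas j hj hjn).mono (h.filt.le j j hjn) le_rfl).aestronglyMeasurable K
    (Eventually.of_forall fun ω => h.bdd j hj hjn ω)

lemma integral_ivlSum (h : MixingRow P F n x K κ ρ) {a b : ℕ} (hb : b ≤ n) :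
    ∫ ω, ivlSum x a b ω ∂P = 0 := by
  unfold ivlSum
  rw [integral_finsetSum]
  · refine Finset.sum_eq_zero fun j hj => ?_
    have := Finset.mem_Ioc.1 hj
    exact h.centered j (by omega) (by omega)
  · intro j hj
    have := Finset.mem_Ioc.1 hj
    exact (h.memLp_single (by omega) (by omega) 1).integrable le_rfl

lemma abs_covariance_le (h : MixingRow P F n x K κ ρ) {k d : ℕ} (hkd : k + d ≤ n) {f g : Ω → ℝ}
    (hf : Measurable[F 0 k] f) (hg : Measurable[F (k + d) n] g) (hf2 : MemLp f 2 P)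
    (hg2 : MemLp g 2 P) : |cov[f, g; P]| ≤ ρ d * l2norm P f * l2norm P g := by
  refine (abs_covariance_le_rhoCoeff hf hg hf2 hg2).trans ?_
  have := h.rho_le k d hkd
  have := l2norm_nonneg (P := P) f
  have := l2norm_nonneg (P := P) g
  gcongr

lemma abs_integral_mul_le (h : MixingRow P F n x K κ ρ) {a b c e d : ℕ} (hbd : b + d ≤ c + 1)
    (he : e ≤ n) (hdn : b + d ≤ n) :
    |∫ ω, ivlSum x a b ω * ivlSum x c e ω ∂P|
      ≤ ρ d * l2norm P (ivlSum x a b) * l2norm P (ivlSum x c e) := by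
  have h1 := h.abs_covariance_le (f := ivlSum x a b) (g := ivlSum x c e) hdn
    (measurable_ivlSum (measurable_of_interval h.filt h.meas (by omega) le_rfl (by omega)))
    (measurable_ivlSum (measurable_of_interval h.filt h.meas hbd he he))
    (h.memLp (by omega) 2) (h.memLp he 2)
  rw [covariance_eq_sub (h.memLp (by omega) 2) (h.memLp he 2), h.integral_ivlSum (by omega),
    zero_mul, sub_zero] at h1
  exact h1

lemma integral_sq_le (h : MixingRow P F n x K κ ρ) (hκ : 0 ≤ κ) {a b : ℕ} (hab : a ≤ b)
    (hb : b ≤ n) :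
    ∫ ω, ivlSum x a b ω ^ 2 ∂P
      ≤ ((b : ℝ) - a) * (κ ^ 2 * (1 + 2 * ∑ j ∈ Finset.Icc 1 n, ρ j)) := by
  induction b, hab using Nat.le_induction with
  | base => simp
  | succ b hab ih =>
    have hl2 : ∀ j, 1 ≤ j → j ≤ n → l2norm P (x j) ≤ κ := fun j h1 h2 =>
      Real.sqrt_le_iff.2 ⟨hκ, h.sq_le j h1 h2⟩
    have e1 : ∀ ω, ivlSum x a (b + 1) ω = ivlSum x a b ω + x (b + 1) ω := by
      intro ω
      unfold ivlSum
      rw [Finset.sum_Ioc_succ_top hab]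
    have e2 : ∫ ω, ivlSum x a b ω * x (b + 1) ω ∂P
        = ∑ j ∈ Finset.Ioc a b, ∫ ω, x j ω * x (b + 1) ω ∂P := by
      unfold ivlSum
      simp_rw [Finset.sum_mul]
      refine integral_finsetSum _ fun j hj => ?_
      have := Finset.mem_Ioc.1 hj
      exact (h.memLp_single (by omega) (by omega) 2).integrable_mul
        (h.memLp_single (by omega) hb 2)
    have h3 : ∫ ω, ivlSum x a b ω * x (b + 1) ω ∂P ≤ κ ^ 2 * ∑ j ∈ Finset.Icc 1 n, ρ j := by
      rw [e2]
      calc _ ≤ ∑ j ∈ Finset.Ioc a b, κ ^ 2 * ρ (b + 1 - j) := by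
            refine Finset.sum_le_sum fun j hj => ?_
            have hj' := Finset.mem_Ioc.1 hj
            have m1 := h.memLp_single (show 1 ≤ j by omega) (by omega) 2
            have m2 := h.memLp_single (show 1 ≤ b + 1 by omega) hb 2
            have hc := h.abs_covariance_le (k := j) (d := b + 1 - j) (by omega)
              ((h.meas j (by omega) (by omega)).mono (h.filt.mono j 0 j j (by omega) le_rfl) le_rfl)
              ((h.meas (b + 1) (by omega) hb).mono
                (h.filt.mono (b + 1) (j + (b + 1 - j)) (b + 1) n (by omega) hb) le_rfl) m1 m2
            rw [covariance_eq_sub m1 m2, h.centered j (by omega) (by omega), zero_mul,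
              sub_zero] at hc
            refine ((le_abs_self _).trans hc).trans ?_
            have h4 := hl2 j (by omega) (by omega)
            have h5 := hl2 (b + 1) (by omega) hb
            have h6 := h.rho_nonneg (b + 1 - j)
            calc ρ (b + 1 - j) * l2norm P (x j) * l2norm P (x (b + 1))
                ≤ ρ (b + 1 - j) * κ * κ := by
                  have := l2norm_nonneg (P := P) (x j)
                  have := l2norm_nonneg (P := P) (x (b + 1))
                  gcongr
              _ = _ := by ring
        _ = κ ^ 2 * ∑ j ∈ Finset.Ioc a b, ρ (b + 1 - j) := by rw [Finset.mul_sum]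
        _ ≤ _ := by
            refine mul_le_mul_of_nonneg_left ?_ (sq_nonneg κ)
            have hinj : Set.InjOn (fun j => b + 1 - j) (Finset.Ioc a b : Finset ℕ) := by
              intro i hi j hj hij
              simp only [Finset.coe_Ioc, Set.mem_Ioc] at hi hj hij
              omega
            rw [← Finset.sum_image (f := ρ) hinj]
            refine Finset.sum_le_sum_of_subset_of_nonneg ?_ fun m _ _ => h.rho_nonneg m
            intro m hm
            obtain ⟨j, hj, rfl⟩ := Finset.mem_image.1 hm
            have := Finset.mem_Ioc.1 hj
            exact Finset.mem_Icc.2 ⟨by omega, by omega⟩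
    simp_rw [e1]
    rw [integral_add_sq (h.memLp (by omega) 2) (h.memLp_single (by omega) hb 2)]
    have h7 := ih (by omega)
    have h8 := h.sq_le (b + 1) (by omega) hb
    push_cast
    linarith

end MixingRow

lemma ivlSum_restrict {Ω : Type*} {x : ℕ → Ω → ℝ} (c d a b : ℕ) (ω : Ω) :
    ivlSum (fun j => if c < j ∧ j ≤ d then x j else fun _ => 0) a b ω
      = ivlSum x (max a c) (min b d) ω := by
  unfold ivlSum
  have e : Finset.Ioc (max a c) (min b d) = (Finset.Ioc a b).filter fun j => c < j ∧ j ≤ d := by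
    ext j; simp only [Finset.mem_Ioc, Finset.mem_filter, max_lt_iff, le_min_iff]; tauto
  rw [e, Finset.sum_filter]
  refine Finset.sum_congr rfl fun j _ => ?_
  by_cases hj : c < j ∧ j ≤ d
  · simp only [if_pos hj]
  · simp only [if_neg hj]

/-- Greedy decomposition of `(a, n]` into intervals on which a set function first reaches a
threshold; the last interval is what is left over. -/
lemma exists_greedy_blocks (w : ℕ → ℕ → ℝ) (thr : ℝ) (n a : ℕ) (ha : a ≤ n)
    (hw : ∀ a, w a a < thr) :
    ∃ (N : ℕ) (T : ℕ → ℕ), T 0 = a ∧ T (N + 1) = n ∧ (∀ i < N, T i < T (i + 1)) ∧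
      T N ≤ n ∧ (∀ i < N, thr ≤ w (T i) (T (i + 1))) ∧
      (∀ i ≤ N, ∀ c, T i ≤ c → c < T (i + 1) → w (T i) c < thr) ∧ w (T N) n < thr := by
  classical
  induction hk : n - a using Nat.strong_induction_on generalizing a with
  | _ k ih =>
  by_cases hex : ∃ c, a ≤ c ∧ c ≤ n ∧ thr ≤ w a c
  · obtain ⟨h1, h2, h3⟩ := Nat.find_spec hex
    set c := Nat.find hex with hc
    have hac : a < c := by
      refine lt_of_le_of_ne h1 fun he => ?_
      rw [← he] at h3
      exact absurd h3 (not_le.2 (hw a))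
    obtain ⟨N, T, t0, tN, t1, t2, t3, t4, t5⟩ := ih (n - c) (by omega) c h2 rfl
    refine ⟨N + 1, fun i => Nat.casesOn i a T, rfl, tN, ?_, t2, ?_, ?_, t5⟩
    · rintro (_ | i) hi
      · change a < T 0
        rw [t0]; exact hac
      · exact t1 i (by omega)
    · rintro (_ | i) hi
      · change thr ≤ w a (T 0)
        rw [t0]; exact h3
      · exact t3 i (by omega)
    · rintro (_ | i) hi e he1 he2
      · change e < T 0 at he2
        rw [t0] at he2
        by_contra hcon
        exact Nat.find_min hex he2 ⟨he1, by omega, not_lt.1 hcon⟩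
      · exact t4 i (by omega) e he1 he2
  · have hno : ∀ c, a ≤ c → c ≤ n → w a c < thr := fun c h1 h2 =>
      not_le.1 fun h3 => hex ⟨c, h1, h2, h3⟩
    refine ⟨0, fun i => if i = 0 then a else n, rfl, rfl, fun i hi => absurd hi (Nat.not_lt_zero i),
      ha, fun i hi => absurd hi (Nat.not_lt_zero i), ?_, hno n ha le_rfl⟩
    intro i hi c h1 h2
    obtain rfl : i = 0 := by omega
    exact hno c h1 (le_of_lt h2)

lemma MixingRow.exists_blocks (h : MixingRow P F n x K κ ρ) (hκ : 0 ≤ κ) {r : ℕ} (hr : 1 ≤ r)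
    {Q : ℝ} (hQ0 : 0 < Q) (hQ : 2 * κ ^ 2 * (1 + 2 * ∑ j ∈ Finset.Icc 1 n, ρ j) * r ≤ Q) :
    ∃ N T, IsBlocks P x n r Q N T := by
  obtain ⟨N, T, t0, tN, t1, t2, t3, t4, t5⟩ := exists_greedy_blocks
    (fun a b => ∫ ω, ivlSum x a b ω ^ 2 ∂P) (16 * Q) n 0 (Nat.zero_le _)
    (by intro a; simp only [ivlSum_self]; norm_num; exact hQ0)
  have hD : 1 ≤ 1 + 2 * ∑ j ∈ Finset.Icc 1 n, ρ j := by
    have := Finset.sum_nonneg fun j (_ : j ∈ Finset.Icc 1 n) => h.rho_nonneg j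
    linarith
  set D := 1 + 2 * ∑ j ∈ Finset.Icc 1 n, ρ j with hDdef
  have hr1 : (1 : ℝ) ≤ r := by exact_mod_cast hr
  have hκD : 0 ≤ κ ^ 2 * D := by positivity
  have hκQ : 2 * κ ^ 2 ≤ Q := by
    refine le_trans ?_ hQ
    have h1 : κ ^ 2 ≤ κ ^ 2 * D := le_mul_of_one_le_right (sq_nonneg κ) hD
    have h2 : κ ^ 2 * D ≤ κ ^ 2 * D * r := le_mul_of_one_le_right hκD hr1
    nlinarith
  -- all block end points are at most `n`
  have hTn : ∀ i ≤ N, T (i + 1) ≤ n := by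
    intro i hi
    rcases hi.eq_or_lt with rfl | hi
    · exact tN.le
    · have hmono : ∀ d, i + 1 + d ≤ N → T (i + 1) ≤ T (i + 1 + d) := by
        intro d
        induction d with
        | zero => intro _; exact le_rfl
        | succ d ih => intro hd; exact (ih (by omega)).trans (t1 (i + 1 + d) (by omega)).le
      have := hmono (N - (i + 1)) (by omega)
      rw [show i + 1 + (N - (i + 1)) = N by omega] at this
      omega
  have hlen : ∀ i < N, T i + 2 * r ≤ T (i + 1) := by
    intro i hi
    have h1 := t3 i hi
    have h2 := h.integral_sq_le hκ (t1 i hi).le (hTn i hi.le)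
    by_contra hcon
    have h3 : ((T (i + 1) : ℝ) - T i) ≤ 2 * r := by
      have : (T (i + 1) : ℝ) ≤ T i + 2 * r := by exact_mod_cast (by omega : T (i + 1) ≤ T i + 2 * r)
      linarith
    have h4 := mul_le_mul_of_nonneg_right h3 hκD
    nlinarith
  have hpre : ∀ i ≤ N, ∀ c, T i ≤ c → c ≤ T (i + 1) → ∫ ω, ivlSum x (T i) c ω ^ 2 ∂P ≤ 33 * Q := by
    intro i hi c h1 h2
    rcases h2.eq_or_lt with rfl | h2
    · rcases hi.eq_or_lt with rfl | hi
      · rw [tN]; linarith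
      · have h3 := t4 i hi.le (T (i + 1) - 1) (by have := t1 i hi; omega) (by have := t1 i hi; omega)
        have hn := hTn i hi.le
        have hlt := t1 i hi
        have e : ∀ ω, ivlSum x (T i) (T (i + 1)) ω
            = ivlSum x (T i) (T (i + 1) - 1) ω + x (T (i + 1)) ω := by
          intro ω
          obtain ⟨l, hl⟩ : ∃ l, T (i + 1) = l + 1 := ⟨T (i + 1) - 1, by omega⟩
          rw [hl]
          unfold ivlSum
          rw [Finset.sum_Ioc_succ_top (by omega)]
          rfl
        simp_rw [e]
        have h4 := integral_add_sq_le (P := P) (f := ivlSum x (T i) (T (i + 1) - 1))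
          (h.memLp (by omega) 2) (h.memLp_single (show 1 ≤ T (i + 1) by omega) hn 2)
        have h5 := h.sq_le (T (i + 1)) (by omega) hn
        linarith
    · have := t4 i hi c h1 h2
      linarith
  refine ⟨N, T, t0, tN, t2, hlen, t3, ?_, t5.le⟩
  intro i hi c d h1 h2 h3
  have hn := hTn i hi
  have e : ∀ ω, ivlSum x c d ω = ivlSum x (T i) d ω - ivlSum x (T i) c ω := fun ω => by
    rw [← ivlSum_add h1 h2]; ring
  simp_rw [e]
  have h4 := integral_sub_sq_le (P := P) (h.memLp (a := T i) (show d ≤ n by omega) 2)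
    (h.memLp (a := T i) (show c ≤ n by omega) 2)
  have h5 := hpre i hi d (by omega) h3
  have h6 := hpre i hi c h1 (by omega)
  linarith

/-- Sum over the first `r` indices of each block, for a row `y` that need not be the one from which
the blocks were built: here `y` is also a restriction of `x`. -/
lemma IsBlocks.abs_heads_le (hB : IsBlocks P x n r Q N T) {y : ℕ → Ω → ℝ}
    (h : MixingRow P F n y K κ ρ) (hr : 1 ≤ r)
    (hρ : ∑ m ∈ Finset.Icc 1 (n / r), ρ (r * m) ≤ 1 / 4) {L : ℕ} (hL : L ≤ N + 1) :
    |∫ ω, (∑ i ∈ Finset.range L, ivlSum y (T i) (min (T i + r) (T (i + 1))) ω) ^ 2 ∂P -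
        ∑ i ∈ Finset.range L, ∫ ω, ivlSum y (T i) (min (T i + r) (T (i + 1))) ω ^ 2 ∂P|
      ≤ 1 / 2 * ∑ i ∈ Finset.range L,
        ∫ ω, ivlSum y (T i) (min (T i + r) (T (i + 1))) ω ^ 2 ∂P := by
  refine abs_integral_sum_sq_sub_le (P := P) h.rho_nonneg hr hρ
    (Z := fun i => ivlSum y (T i) (min (T i + r) (T (i + 1)))) ?_ ?_
  · intro i hi
    exact h.memLp ((min_le_right _ _).trans (hB.le_n (by omega))) 2
  · intro i j hij hj
    have h1 := hB.add_le (show i ≤ j by omega) (by omega)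
    have h2 := hB.le_n (show j ≤ N + 1 by omega)
    have h3 : 2 * r * (j - i) = r * (j - i) + r * (j - i) := by ring
    have h4 : r ≤ r * (j - i) := Nat.le_mul_of_pos_right _ (by omega)
    refine ⟨by omega, ?_⟩
    have h6 : min (T i + r) (T (i + 1)) ≤ T i + r := min_le_left _ _
    exact h.abs_integral_mul_le (by omega) ((min_le_right _ _).trans (hB.le_n (by omega)))
      (by omega)

/-- The same for what remains of the blocks without their first `r` indices. -/
lemma IsBlocks.abs_tails_le (hB : IsBlocks P x n r Q N T) {y : ℕ → Ω → ℝ}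
    (h : MixingRow P F n y K κ ρ) (hr : 1 ≤ r)
    (hρ : ∑ m ∈ Finset.Icc 1 (n / r), ρ (r * m) ≤ 1 / 4) {L : ℕ} (hL : L ≤ N + 1) :
    |∫ ω, (∑ i ∈ Finset.range L, ivlSum y (min (T i + r) (T (i + 1))) (T (i + 1)) ω) ^ 2 ∂P -
        ∑ i ∈ Finset.range L, ∫ ω, ivlSum y (min (T i + r) (T (i + 1))) (T (i + 1)) ω ^ 2 ∂P|
      ≤ 1 / 2 * ∑ i ∈ Finset.range L,
        ∫ ω, ivlSum y (min (T i + r) (T (i + 1))) (T (i + 1)) ω ^ 2 ∂P := by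
  refine abs_integral_sum_sq_sub_le (P := P) h.rho_nonneg hr hρ
    (Z := fun i => ivlSum y (min (T i + r) (T (i + 1))) (T (i + 1))) ?_ ?_
  · intro i hi
    exact h.memLp (hB.le_n (by omega)) 2
  · intro i j hij hj
    have h1 := hB.add_le (show i + 1 ≤ j by omega) (by omega)
    have h2 := hB.le_n (show j + 1 ≤ N + 1 by omega)
    have h3 : 2 * r * (j - (i + 1)) = r * (j - (i + 1)) + r * (j - (i + 1)) := by ring
    have h4 : r * (j - i) = r * (j - (i + 1)) + r := by
      rw [show j - i = (j - (i + 1)) + 1 by omega]; ring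
    have h5 := hB.length i (by omega)
    have h7 := hB.le_n (show j ≤ N + 1 by omega)
    refine ⟨by omega, ?_⟩
    rcases le_or_gt (T (j + 1)) (T j + r) with hcase | hcase
    · have e : ∀ ω, ivlSum y (min (T j + r) (T (j + 1))) (T (j + 1)) ω = 0 := by
        intro ω; rw [min_eq_right hcase, ivlSum_self]
      simp_rw [e, mul_zero, integral_zero, abs_zero]
      have := h.rho_nonneg (r * (j - i))
      have := l2norm_nonneg (P := P) (ivlSum y (min (T i + r) (T (i + 1))) (T (i + 1)))
      have := l2norm_nonneg (P := P) (ivlSum y (min (T j + r) (T (j + 1))) (T (j + 1)))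
      positivity
    · rw [min_eq_left hcase.le]
      exact h.abs_integral_mul_le (by omega) h2 (by omega)

/-- The number of blocks is at most of the order of the variance divided by `Q`. -/
lemma IsBlocks.card_mul_le (hB : IsBlocks P x n r Q N T) (h : MixingRow P F n x K κ ρ)
    (hκ : 0 ≤ κ) (hr : 1 ≤ r) (hρ : ∑ m ∈ Finset.Icc 1 (n / r), ρ (r * m) ≤ 1 / 4)
    (hQ : 2 * κ ^ 2 * (1 + 2 * ∑ j ∈ Finset.Icc 1 n, ρ j) * r ≤ Q) :
    N * Q ≤ 2 * ∫ ω, ivlSum x 0 n ω ^ 2 ∂P + 32 * Q := by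
  set H : ℕ → Ω → ℝ := fun i => ivlSum x (T i) (min (T i + r) (T (i + 1))) with hH
  set G : ℕ → Ω → ℝ := fun i => ivlSum x (min (T i + r) (T (i + 1))) (T (i + 1)) with hG
  have hA := hB.abs_heads_le h hr hρ (show N ≤ N + 1 by omega)
  have hC := hB.abs_tails_le h hr hρ (show N ≤ N + 1 by omega)
  have hHm : ∀ i < N, MemLp (H i) 2 P := fun i hi =>
    h.memLp ((min_le_right _ _).trans (hB.le_n (by omega))) 2
  have hGm : ∀ i < N, MemLp (G i) 2 P := fun i hi => h.memLp (hB.le_n (by omega)) 2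
  have hD : 1 ≤ 1 + 2 * ∑ j ∈ Finset.Icc 1 n, ρ j := by
    have := Finset.sum_nonneg fun j (_ : j ∈ Finset.Icc 1 n) => h.rho_nonneg j
    linarith
  have hhead : ∀ i ∈ Finset.range N, ∫ ω, H i ω ^ 2 ∂P ≤ Q / 2 := by
    intro i hi
    have hi' := Finset.mem_range.1 hi
    have h1 := hB.length i hi'
    have h2 := hB.le_n (show i + 1 ≤ N + 1 by omega)
    have e : min (T i + r) (T (i + 1)) = T i + r := min_eq_left (by omega)
    have h3 := h.integral_sq_le hκ (show T i ≤ T i + r by omega) (by omega)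
    simp only [hH, e]
    push_cast at h3
    linarith
  have htail : ∀ i ∈ Finset.range N, 15 / 2 * Q ≤ ∫ ω, G i ω ^ 2 ∂P := by
    intro i hi
    have hi' := Finset.mem_range.1 hi
    have h1 := hhead i hi
    have h2 := integral_add_sq_le (hHm i hi') (hGm i hi')
    have e : ∀ ω, H i ω + G i ω = ivlSum x (T i) (T (i + 1)) ω := fun ω =>
      ivlSum_add (le_min (by omega) (hB.mono (by omega) (by omega))) (min_le_right _ _) ω
    simp_rw [e] at h2
    have h3 := hB.lower i hi'
    linarith
  have hHs := Finset.sum_le_card_nsmul _ _ _ hhead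
  have hGs := Finset.card_nsmul_le_sum _ _ _ htail
  rw [Finset.card_range, nsmul_eq_mul] at hHs hGs
  have hHS : MemLp (fun ω => ∑ i ∈ Finset.range N, H i ω) 2 P :=
    memLp_finsetSum _ fun i hi => hHm i (Finset.mem_range.1 hi)
  have hW := integral_sub_sq_le (h.memLp (a := 0) hB.le_last 2) hHS
  have e1 : ∀ ω, ivlSum x 0 (T N) ω - ∑ i ∈ Finset.range N, H i ω
      = ∑ i ∈ Finset.range N, G i ω := fun ω => by
    rw [hB.sum_eq' x (show N ≤ N + 1 by omega)]; ring
  simp_rw [e1] at hW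
  have hS := integral_sub_sq_le (h.memLp (a := 0) (le_refl n) 2) (h.memLp (a := T N) (le_refl n) 2)
  have e2 : ∀ ω, ivlSum x 0 n ω - ivlSum x (T N) n ω = ivlSum x 0 (T N) ω := fun ω => by
    rw [← ivlSum_add (Nat.zero_le (T N)) hB.le_last]; ring
  simp_rw [e2] at hS
  have hrest := hB.rest
  have hA' := (abs_le.1 hA).2
  have hC' := (abs_le.1 hC).1
  have hQ0 : 0 ≤ Q := le_trans (by positivity) hQ
  have hNQ : 0 ≤ N * Q := by positivity
  simp only [hH, hG] at hHs hGs hW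
  linarith

/-- The variance of the sum over any interval is at most of the order of the number of blocks. -/
lemma IsBlocks.integral_sq_le (hB : IsBlocks P x n r Q N T) (h : MixingRow P F n x K κ ρ)
    (hr : 1 ≤ r) (hρ : ∑ m ∈ Finset.Icc 1 (n / r), ρ (r * m) ≤ 1 / 4) (hQ0 : 0 < Q) {c d : ℕ}
    (hd : d ≤ n) :
    ∫ ω, ivlSum x c d ω ^ 2 ∂P ≤ 792 * (((N : ℝ) + 1) * Q) := by
  set y : ℕ → Ω → ℝ := fun j => if c < j ∧ j ≤ d then x j else fun _ => 0 with hy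
  have hy' : MixingRow P F n y K κ ρ := h.restrict c d
  have hA := (abs_le.1 (hB.abs_heads_le hy' hr hρ le_rfl)).2
  have hC := (abs_le.1 (hB.abs_tails_le hy' hr hρ le_rfl)).2
  -- a restricted sub-interval of a block is again a sub-interval of the block
  have hsub : ∀ i ≤ N, ∀ u w, T i ≤ u → u ≤ w → w ≤ T (i + 1) →
      ∫ ω, ivlSum y u w ω ^ 2 ∂P ≤ 132 * Q := by
    intro i hi u w h1 h2 h3
    simp_rw [hy, ivlSum_restrict]
    rcases le_or_gt (max u c) (min w d) with hle | hlt
    · exact hB.upper i hi _ _ (h1.trans (le_max_left _ _)) hle ((min_le_left _ _).trans h3)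
    · have e : ∀ ω, ivlSum x (max u c) (min w d) ω = 0 := fun ω => by
        unfold ivlSum; rw [Finset.Ioc_eq_empty (by omega), Finset.sum_empty]
      simp_rw [e]
      simp only [ne_eq, OfNat.ofNat_ne_zero, not_false_eq_true, zero_pow, integral_zero]
      positivity
  have hmin : ∀ i ≤ N, T i ≤ min (T i + r) (T (i + 1)) := fun i hi =>
    le_min (by omega) (hB.mono (by omega) (by omega))
  have hHs := Finset.sum_le_card_nsmul (Finset.range (N + 1))
    (fun i => ∫ ω, ivlSum y (T i) (min (T i + r) (T (i + 1))) ω ^ 2 ∂P) (132 * Q)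
    (fun i hi => by
      have hi' : i ≤ N := by have := Finset.mem_range.1 hi; omega
      exact hsub i hi' _ _ le_rfl (hmin i hi') (min_le_right _ _))
  have hGs := Finset.sum_le_card_nsmul (Finset.range (N + 1))
    (fun i => ∫ ω, ivlSum y (min (T i + r) (T (i + 1))) (T (i + 1)) ω ^ 2 ∂P) (132 * Q)
    (fun i hi => by
      have hi' : i ≤ N := by have := Finset.mem_range.1 hi; omega
      exact hsub i hi' _ _ (hmin i hi') (min_le_right _ _) le_rfl)
  rw [Finset.card_range, nsmul_eq_mul] at hHs hGs
  push_cast at hHs hGs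
  have hHS : MemLp (fun ω => ∑ i ∈ Finset.range (N + 1),
      ivlSum y (T i) (min (T i + r) (T (i + 1))) ω) 2 P :=
    memLp_finsetSum _ fun i hi => hy'.memLp ((min_le_right _ _).trans
      (hB.le_n (by have := Finset.mem_range.1 hi; omega))) 2
  have hGS : MemLp (fun ω => ∑ i ∈ Finset.range (N + 1),
      ivlSum y (min (T i + r) (T (i + 1))) (T (i + 1)) ω) 2 P :=
    memLp_finsetSum _ fun i hi => hy'.memLp (hB.le_n (by have := Finset.mem_range.1 hi; omega)) 2
  have hW := integral_add_sq_le hHS hGS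
  have e : ∀ ω, (∑ i ∈ Finset.range (N + 1), ivlSum y (T i) (min (T i + r) (T (i + 1))) ω) +
      ∑ i ∈ Finset.range (N + 1), ivlSum y (min (T i + r) (T (i + 1))) (T (i + 1)) ω
      = ivlSum x c d ω := fun ω => by
    rw [← hB.sum_eq' y le_rfl, hB.last, hy, ivlSum_restrict, Nat.max_eq_right (Nat.zero_le c),
      Nat.min_eq_right hd]
  simp_rw [e] at hW
  linarith

end Blocks

/-! ### Summation of the mixing rate over tuples of blocks -/

lemma sum_range_inv_sq_le (L : ℕ) : ∑ g ∈ Finset.range L, (1 : ℝ) / ((g : ℝ) + 1) ^ 2 ≤ 2 := by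
  have h : ∀ L : ℕ, ∑ g ∈ Finset.range (L + 1), (1 : ℝ) / ((g : ℝ) + 1) ^ 2 ≤
      2 - 1 / ((L : ℝ) + 1) := by
    intro L
    induction L with
    | zero => norm_num
    | succ L ih =>
      rw [Finset.sum_range_succ]
      have hL : (0 : ℝ) ≤ L := Nat.cast_nonneg L
      have : (1 : ℝ) / (((L + 1 : ℕ) : ℝ) + 1) ^ 2 ≤
          1 / ((L : ℝ) + 1) - 1 / (((L + 1 : ℕ) : ℝ) + 1) := by
        push_cast
        rw [div_sub_div _ _ (by positivity) (by positivity), div_le_div_iff₀ (by positivity)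
          (by positivity)]
        nlinarith
      linarith
  rcases L with _ | L
  · norm_num
  · refine (h L).trans ?_
    have : (0 : ℝ) ≤ 1 / ((L : ℝ) + 1) := by positivity
    linarith

lemma sum_range_comp_div (u : ℕ → ℝ) {k : ℕ} (hk : 1 ≤ k) (L : ℕ) :
    ∑ d ∈ Finset.range (k * L), u (d / k) = k * ∑ g ∈ Finset.range L, u g := by
  induction L with
  | zero => simp
  | succ L ih =>
    rw [mul_add, mul_one, Finset.sum_range_add, ih, Finset.sum_range_succ, mul_add]
    congr 1
    rw [Finset.sum_congr rfl (g := fun _ => u L)]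
    · simp
    · intro e he
      have := Finset.mem_range.1 he
      rw [Nat.mul_add_div (by omega), Nat.div_eq_of_lt this, add_zero]

lemma sum_fin_dist_le (u : ℕ → ℝ) (hu : ∀ d, 0 ≤ u d) {L : ℕ} (i : Fin L) :
    ∑ j : Fin L, u (((i : ℕ) - j) + ((j : ℕ) - i)) ≤ 2 * ∑ d ∈ Finset.range L, u d := by
  rw [← Finset.sum_range (fun j => u (((i : ℕ) - j) + (j - i)))]
  have hi := i.2
  rw [← Finset.sum_filter_add_sum_filter_not (Finset.range L) (fun j => j ≤ (i : ℕ)), two_mul]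
  have aux : ∀ (s : Finset ℕ), s ⊆ Finset.range L →
      Set.InjOn (fun j => ((i : ℕ) - j) + (j - i)) s →
      ∑ j ∈ s, u (((i : ℕ) - j) + (j - i)) ≤ ∑ d ∈ Finset.range L, u d := by
    intro s hs hinj
    rw [← Finset.sum_image (f := u) hinj]
    refine Finset.sum_le_sum_of_subset_of_nonneg ?_ fun d _ _ => hu d
    intro d hd
    obtain ⟨j, hj, rfl⟩ := Finset.mem_image.1 hd
    have := Finset.mem_range.1 (hs hj)
    exact Finset.mem_range.2 (by omega)
  refine add_le_add (aux _ (Finset.filter_subset _ _) ?_) (aux _ (Finset.filter_subset _ _) ?_)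
  · intro j hj j' hj' h
    simp only [Finset.coe_filter, Set.mem_ofPred_eq] at hj hj' h
    omega
  · intro j hj j' hj' h
    simp only [Finset.coe_filter, Set.mem_ofPred_eq] at hj hj' h
    omega

lemma exp_neg_le_factorial_div {y : ℝ} (hy : 0 < y) (e : ℕ) :
    Real.exp (-y) ≤ (e ! : ℝ) / y ^ e := by
  have h := Real.pow_div_factorial_le_exp y hy.le e
  rw [Real.exp_neg, inv_le_comm₀ (Real.exp_pos y) (by positivity), inv_div]
  exact h

lemma exp_neg_rpow_le {α η : ℝ} (hα : 0 < α) {e : ℕ} (he : 2 ≤ e * η) (g : ℕ) :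
    Real.exp (-(α * ((g + 1 : ℕ) : ℝ) ^ η)) ≤ (e ! : ℝ) / α ^ e * (1 / ((g : ℝ) + 1) ^ 2) := by
  have hg0 : (0 : ℝ) < ((g + 1 : ℕ) : ℝ) := by positivity
  have hg1 : (1 : ℝ) ≤ (g : ℝ) + 1 := by have : (0 : ℝ) ≤ g := Nat.cast_nonneg g; linarith
  refine (exp_neg_le_factorial_div (by positivity) e).trans ?_
  have h2 : ((g : ℝ) + 1) ^ 2 ≤ (((g + 1 : ℕ) : ℝ) ^ η) ^ e := by
    rw [← Real.rpow_natCast (((g + 1 : ℕ) : ℝ) ^ η), ← Real.rpow_mul hg0.le,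
      ← Real.rpow_natCast]
    push_cast
    refine Real.rpow_le_rpow_of_exponent_le hg1 ?_
    linarith
  rw [mul_pow, div_mul_div_comm, mul_one]
  gcongr

/-- The sum of the mixing rate, slowed down by the order `k` of the cumulant, grows at most like a
power of `k`. -/
lemma exists_sum_exp_le {α η : ℝ} (hα : 0 < α) (hη : 0 < η) :
    ∃ (C : ℝ) (b : ℕ), 1 ≤ C ∧ ∀ k : ℕ, 1 ≤ k → ∀ (L : ℕ) (i : Fin L),
      ∑ j : Fin L, Real.exp (-(α / k * (((((i : ℕ) - j) + ((j : ℕ) - i)) / k : ℕ) : ℝ) ^ η))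
        ≤ C * (k : ℝ) ^ b := by
  obtain ⟨e, he⟩ := exists_nat_ge (2 / η)
  rw [div_le_iff₀ hη] at he
  set c : ℝ := (e ! : ℝ) / α ^ e with hc
  have hc0 : 0 ≤ c := by positivity
  refine ⟨2 * (1 + c * 2), e + 1, by linarith, fun k hk L i => ?_⟩
  have hk1 : (1 : ℝ) ≤ k := by exact_mod_cast hk
  have hk0 : (0 : ℝ) < k := by linarith
  set u : ℕ → ℝ := fun g => Real.exp (-(α / k * (g : ℝ) ^ η)) with hu
  have hu0 : ∀ g, 0 ≤ u g := fun g => (Real.exp_pos _).le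
  have hke : (1 : ℝ) ≤ (k : ℝ) ^ e := one_le_pow₀ hk1
  have hug : ∀ g : ℕ, u (g + 1) ≤ c * (k : ℝ) ^ e * (1 / ((g : ℝ) + 1) ^ 2) := by
    intro g
    have := exp_neg_rpow_le (show 0 < α / k by positivity) he g
    refine this.trans (le_of_eq ?_)
    rw [hc, div_pow]
    field_simp
  have hG : ∑ g ∈ Finset.range L, u g ≤ (1 + c * 2) * (k : ℝ) ^ e := by
    rcases L with _ | L
    · exact i.elim0
    rw [Finset.sum_range_succ']
    have h0 : u 0 ≤ 1 := by
      simp only [hu]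
      rw [Real.exp_le_one_iff]
      simp only [Nat.cast_zero, Left.neg_nonpos_iff]
      positivity
    have h1 : ∑ g ∈ Finset.range L, u (g + 1) ≤ c * (k : ℝ) ^ e * 2 := by
      refine (Finset.sum_le_sum fun g _ => hug g).trans ?_
      rw [← Finset.mul_sum]
      exact mul_le_mul_of_nonneg_left (sum_range_inv_sq_le L) (by positivity)
    linarith
  calc ∑ j : Fin L, u ((((i : ℕ) - j) + ((j : ℕ) - i)) / k)
      ≤ 2 * ∑ d ∈ Finset.range L, u (d / k) := sum_fin_dist_le (fun d => u (d / k))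
        (fun d => hu0 _) i
    _ ≤ 2 * ∑ d ∈ Finset.range (k * L), u (d / k) := by
        refine mul_le_mul_of_nonneg_left ?_ (by norm_num)
        refine Finset.sum_le_sum_of_subset_of_nonneg ?_ fun d _ _ => hu0 _
        exact Finset.range_subset_range.2 (Nat.le_mul_of_pos_left _ (by omega))
    _ = 2 * (k * ∑ g ∈ Finset.range L, u g) := by rw [sum_range_comp_div u hk]
    _ ≤ 2 * (k * ((1 + c * 2) * (k : ℝ) ^ e)) := by gcongr
    _ = _ := by ring

/-- Summation over all tuples of a rate in the largest distance to the entry at `x₀`: the rate in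
the largest distance is at most the product over the entries of its `k`-th roots in their
distances. -/
lemma sum_tuples_le {α η : ℝ} (hα : 0 < α) (hη : 0 < η) {C : ℝ} {b k L : ℕ} (hC : 1 ≤ C)
    (hk : 1 ≤ k)
    (hsum : ∀ i : Fin L, ∑ j : Fin L,
      Real.exp (-(α / k * (((((i : ℕ) - j) + ((j : ℕ) - i)) / k : ℕ) : ℝ) ^ η)) ≤ C * (k : ℝ) ^ b)
    (x₀ : Fin k) (d : (Fin k → Fin L) → ℕ)
    (hd : ∀ f x, ((f x₀ : ℕ) - f x) + ((f x : ℕ) - f x₀) ≤ d f) :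
    ∑ f : Fin k → Fin L, Real.exp (-(α * ((d f / k : ℕ) : ℝ) ^ η))
      ≤ L * (C * (k : ℝ) ^ b) ^ k := by
  classical
  have hk1 : (1 : ℝ) ≤ k := by exact_mod_cast hk
  have hk0 : (0 : ℝ) < k := by linarith
  set τ : Fin L → Fin L → ℝ := fun i j =>
    Real.exp (-(α / k * (((((i : ℕ) - j) + ((j : ℕ) - i)) / k : ℕ) : ℝ) ^ η)) with hτ
  set t : Fin L → Fin k → Fin L → ℝ := fun i x j =>
    if x = x₀ then (if j = i then 1 else 0) else τ i j with ht
  have ht0 : ∀ i x j, 0 ≤ t i x j := by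
    intro i x j
    simp only [ht]
    split_ifs
    · norm_num
    · exact le_rfl
    · exact (Real.exp_pos _).le
  have hCk : 1 ≤ C * (k : ℝ) ^ b := by
    have : (1 : ℝ) ≤ (k : ℝ) ^ b := one_le_pow₀ hk1
    nlinarith
  have hrow : ∀ i x, ∑ j, t i x j ≤ C * (k : ℝ) ^ b := by
    intro i x
    by_cases hx : x = x₀
    · simp only [ht, if_pos hx, Finset.sum_ite_eq', Finset.mem_univ, if_true]
      exact hCk
    · simp only [ht, if_neg hx]
      exact hsum i
  have hf : ∀ f : Fin k → Fin L, Real.exp (-(α * ((d f / k : ℕ) : ℝ) ^ η))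
      ≤ ∑ i, ∏ x, t i x (f x) := by
    intro f
    have h1 : Real.exp (-(α * ((d f / k : ℕ) : ℝ) ^ η)) ≤ ∏ x, t (f x₀) x (f x) := by
      have h2 : ∏ x, τ (f x₀) (f x) ≤ ∏ x, t (f x₀) x (f x) := by
        refine Finset.prod_le_prod (fun x _ => (Real.exp_pos _).le) fun x _ => ?_
        by_cases hx : x = x₀
        · simp only [ht, hx, if_true, hτ]
          rw [Real.exp_le_one_iff, Left.neg_nonpos_iff]
          positivity
        · simp only [ht, if_neg hx]
          exact le_rfl
      refine le_trans ?_ h2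
      rw [← Real.exp_sum, Real.exp_le_exp, Finset.sum_neg_distrib, neg_le_neg_iff, ← Finset.mul_sum]
      have h3 : ∑ x, (((((f x₀ : ℕ) - f x) + ((f x : ℕ) - f x₀)) / k : ℕ) : ℝ) ^ η
          ≤ k * ((d f / k : ℕ) : ℝ) ^ η := by
        have h4 : ∀ x ∈ (Finset.univ : Finset (Fin k)),
            (((((f x₀ : ℕ) - f x) + ((f x : ℕ) - f x₀)) / k : ℕ) : ℝ) ^ η
              ≤ ((d f / k : ℕ) : ℝ) ^ η := by
          intro x _
          refine Real.rpow_le_rpow (by positivity) ?_ hη.le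
          exact_mod_cast Nat.div_le_div_right (hd f x)
        have := Finset.sum_le_card_nsmul _ _ _ h4
        simpa using this
      calc _ ≤ α / k * (k * ((d f / k : ℕ) : ℝ) ^ η) := by gcongr
        _ = _ := by field_simp
    exact h1.trans (Finset.single_le_sum (f := fun i => ∏ x, t i x (f x))
      (fun i _ => Finset.prod_nonneg fun x _ => ht0 _ _ _) (Finset.mem_univ (f x₀)))
  calc _ ≤ ∑ f : Fin k → Fin L, ∑ i, ∏ x, t i x (f x) := Finset.sum_le_sum fun f _ => hf f
    _ = ∑ i, ∑ f : Fin k → Fin L, ∏ x, t i x (f x) := Finset.sum_comm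
    _ = ∑ i, ∏ x, ∑ j, t i x j := by
        refine Finset.sum_congr rfl fun i _ => ?_
        rw [Finset.prod_univ_sum, Fintype.piFinset_univ]
    _ ≤ ∑ _i : Fin L, ∏ _x : Fin k, (C * (k : ℝ) ^ b) := by
        refine Finset.sum_le_sum fun i _ => Finset.prod_le_prod
          (fun x _ => Finset.sum_nonneg fun j _ => ht0 _ _ _) fun x _ => hrow i x
    _ = _ := by simp

/-- Among `k` integers that spread over a distance of at least `k * g` there is a gap of length
more than `g`. -/
lemma exists_gap {k g : ℕ} (hg : 1 ≤ g) (f : Fin k → ℕ) (y₀ y₁ : Fin k) (h : f y₀ + k * g ≤ f y₁) :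
    ∃ c, (∀ x, f x ≤ c ∨ c + g + 1 ≤ f x) ∧ f y₀ ≤ c ∧ c + g + 1 ≤ f y₁ := by
  classical
  set s : Finset ℕ := (Finset.univ.erase y₀).image fun x => (f x - f y₀ - 1) / g with hs
  have hcard : s.card < (Finset.range k).card := by
    have h1 : s.card ≤ (Finset.univ.erase y₀).card := Finset.card_image_le
    rw [Finset.card_erase_of_mem (Finset.mem_univ _), Finset.card_univ, Fintype.card_fin] at h1
    rw [Finset.card_range]
    have := y₀.2
    omega
  obtain ⟨l, hl, hls⟩ := Finset.exists_mem_notMem_of_card_lt_card hcard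
  have hlk := Finset.mem_range.1 hl
  have hall : ∀ x, f x ≤ f y₀ + l * g ∨ f y₀ + l * g + g + 1 ≤ f x := by
    intro x
    by_contra hcon
    push Not at hcon
    obtain ⟨h1, h2⟩ := hcon
    have hx : x ≠ y₀ := by
      rintro rfl
      omega
    refine hls (Finset.mem_image.2 ⟨x, Finset.mem_erase.2 ⟨hx, Finset.mem_univ _⟩, ?_⟩)
    refine Nat.div_eq_of_lt_le (by omega) ?_
    rw [add_mul, one_mul]
    omega
  refine ⟨f y₀ + l * g, hall, by omega, ?_⟩
  have h3 : (l + 1) * g ≤ k * g := Nat.mul_le_mul_right g (by omega)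
  rw [add_mul, one_mul] at h3
  rcases hall y₁ with h4 | h4
  · omega
  · exact h4

/-! ### Cumulants of sums over blocks -/

section BoundedAlgebra

variable {Ω : Type*} [mΩ : MeasurableSpace Ω]

/-- The algebra of essentially bounded random variables. -/
def boundedAlgebra (P : Measure Ω) [IsProbabilityMeasure P] : Subalgebra ℝ (Ω → ℝ) where
  carrier := {f | MemLp f ⊤ P}
  mul_mem' hf hg := MemLp.mul (p := ⊤) (q := ⊤) hg hf
  add_mem' hf hg := MemLp.add hf hg
  algebraMap_mem' c := memLp_const c

variable {P : Measure Ω} [IsProbabilityMeasure P]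

lemma integrable_of_mem_boundedAlgebra {f : Ω → ℝ} (hf : f ∈ boundedAlgebra P) :
    Integrable f P := MemLp.integrable le_top (q := ⊤) hf

/-- The expectation on the algebra of essentially bounded random variables. -/
def expectation (P : Measure Ω) [IsProbabilityMeasure P] : boundedAlgebra P →ₗ[ℝ] ℝ where
  toFun f := ∫ ω, (f : Ω → ℝ) ω ∂P
  map_add' f g := integral_add (integrable_of_mem_boundedAlgebra f.2)
    (integrable_of_mem_boundedAlgebra g.2)
  map_smul' c _ := integral_const_mul c _

lemma jointMoment_expectation {ι : Type*} (Y : ι → boundedAlgebra P) (B : Finset ι) :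
    jointMoment (expectation P) Y B = ∫ ω, ∏ i ∈ B, (Y i : Ω → ℝ) ω ∂P := by
  unfold jointMoment expectation
  simp only [LinearMap.coe_mk, AddHom.coe_mk]
  refine integral_congr_ae (Eventually.of_forall fun ω => ?_)
  simp only [SubmonoidClass.coe_finsetProd, Finset.prod_apply]

lemma prod_le_sum_pow {ι : Type*} {B : Finset ι} (hB : B.Nonempty) {c : ι → ℝ}
    (hc : ∀ i ∈ B, 0 ≤ c i) : ∏ i ∈ B, c i ≤ ∑ i ∈ B, c i ^ B.card := by
  obtain ⟨y, hy, hmax⟩ := Finset.exists_max_image B c hB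
  calc ∏ i ∈ B, c i ≤ ∏ _i ∈ B, c y := Finset.prod_le_prod hc hmax
    _ = c y ^ B.card := by rw [Finset.prod_const]
    _ ≤ _ := Finset.single_le_sum (f := fun i => c i ^ B.card)
        (fun i hi => pow_nonneg (hc i hi) _) hy

variable {ι : Type*} {Y : ι → boundedAlgebra P} {θ W : ℝ}

lemma prod_mem_boundedAlgebra (Y : ι → boundedAlgebra P) (B : Finset ι) :
    MemLp (fun ω => ∏ i ∈ B, (Y i : Ω → ℝ) ω) ⊤ P := by
  have h : ∏ i ∈ B, (Y i : Ω → ℝ) ∈ boundedAlgebra P := prod_mem fun i _ => (Y i).2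
  have e : (fun ω => ∏ i ∈ B, (Y i : Ω → ℝ) ω) = ∏ i ∈ B, (Y i : Ω → ℝ) := by
    funext ω; rw [Finset.prod_apply]
  rw [e]; exact h

lemma integral_prod_abs_le (e : ℕ)
    (hY : ∀ i, ∀ m : ℕ, 2 ≤ m → ∫ ω, |(Y i : Ω → ℝ) ω| ^ m ∂P ≤ θ * (W ^ m * (m ! : ℝ)))
    {B : Finset ι} (hB : 2 ≤ e * B.card) :
    ∫ ω, ∏ i ∈ B, |(Y i : Ω → ℝ) ω| ^ e ∂P
      ≤ B.card * (θ * (W ^ (e * B.card) * ((e * B.card)! : ℝ))) := by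
  have hBne : B.Nonempty := by
    rw [← Finset.card_pos]
    by_contra hcon
    have : B.card = 0 := by omega
    rw [this] at hB
    omega
  have hint : ∀ i ∈ B, Integrable (fun ω => (|(Y i : Ω → ℝ) ω| ^ e) ^ B.card) P := by
    intro i _
    have h := prod_mem_boundedAlgebra (fun _ : ℕ => Y i) (Finset.range (e * B.card))
    have h2 := (h.integrable le_top).abs
    refine h2.congr (Eventually.of_forall fun ω => ?_)
    simp only [Finset.prod_const, Finset.card_range, abs_pow, ← pow_mul]
  calc ∫ ω, ∏ i ∈ B, |(Y i : Ω → ℝ) ω| ^ e ∂P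
      ≤ ∫ ω, ∑ i ∈ B, (|(Y i : Ω → ℝ) ω| ^ e) ^ B.card ∂P := by
        refine integral_mono_of_nonneg (Eventually.of_forall fun ω =>
          Finset.prod_nonneg fun i _ => by positivity) (integrable_finsetSum _ hint)
          (Eventually.of_forall fun ω => ?_)
        exact prod_le_sum_pow hBne fun i _ => by positivity
    _ = ∑ i ∈ B, ∫ ω, (|(Y i : Ω → ℝ) ω| ^ e) ^ B.card ∂P := integral_finsetSum _ hint
    _ ≤ ∑ _i ∈ B, θ * (W ^ (e * B.card) * ((e * B.card)! : ℝ)) := by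
        refine Finset.sum_le_sum fun i _ => ?_
        simp_rw [← pow_mul]
        exact hY i _ hB
    _ = _ := by rw [Finset.sum_const, nsmul_eq_mul]

lemma abs_jointMoment_le (hθ : 0 ≤ θ) (hW : 0 ≤ W) (hY0 : ∀ i, ∫ ω, (Y i : Ω → ℝ) ω ∂P = 0)
    (hY : ∀ i, ∀ m : ℕ, 2 ≤ m → ∫ ω, |(Y i : Ω → ℝ) ω| ^ m ∂P ≤ θ * (W ^ m * (m ! : ℝ)))
    {B : Finset ι} (hB : B.Nonempty) :
    |jointMoment (expectation P) Y B| ≤ θ * ((4 * W) ^ B.card * (B.card ! : ℝ)) := by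
  rw [jointMoment_expectation]
  have h1B : 1 ≤ B.card := Finset.card_pos.2 hB
  rcases h1B.eq_or_lt with h1 | h2
  · obtain ⟨i, rfl⟩ := Finset.card_eq_one.1 h1.symm
    simp only [Finset.prod_singleton, hY0, abs_zero]
    positivity
  · have h := integral_prod_abs_le (P := P) 1 hY (B := B) (by omega)
    simp only [pow_one, one_mul] at h
    have hcard : (B.card : ℝ) ≤ 4 ^ B.card := by
      exact_mod_cast (Nat.lt_pow_self (by norm_num : 1 < 4)).le
    calc _ ≤ ∫ ω, |∏ i ∈ B, (Y i : Ω → ℝ) ω| ∂P := abs_integral_le_integral_abs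
      _ = ∫ ω, ∏ i ∈ B, |(Y i : Ω → ℝ) ω| ∂P := by simp_rw [Finset.abs_prod]
      _ ≤ _ := h
      _ ≤ 4 ^ B.card * (θ * (W ^ B.card * (B.card ! : ℝ))) := by gcongr
      _ = _ := by rw [mul_pow]; ring

lemma l2norm_prod_le (hθ : 0 ≤ θ) (hW : 0 ≤ W)
    (hY : ∀ i, ∀ m : ℕ, 2 ≤ m → ∫ ω, |(Y i : Ω → ℝ) ω| ^ m ∂P ≤ θ * (W ^ m * (m ! : ℝ)))
    {B : Finset ι} (hB : B.Nonempty) :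
    l2norm P (fun ω => ∏ i ∈ B, (Y i : Ω → ℝ) ω) ≤ √θ * ((4 * W) ^ B.card * (B.card ! : ℝ)) := by
  have hpos : 1 ≤ B.card := Finset.card_pos.2 hB
  have h := integral_prod_abs_le (P := P) 2 hY (B := B) (by omega)
  refine Real.sqrt_le_iff.2 ⟨by positivity, ?_⟩
  have e1 : ∀ ω, (∏ i ∈ B, (Y i : Ω → ℝ) ω) ^ 2 = ∏ i ∈ B, |(Y i : Ω → ℝ) ω| ^ 2 := fun ω => by
    simp_rw [sq_abs, Finset.prod_pow]
  simp_rw [e1]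
  refine h.trans ?_
  have hcard : (B.card : ℝ) ≤ 4 ^ B.card := by
    exact_mod_cast (Nat.lt_pow_self (by norm_num : 1 < 4)).le
  have hfac : ((2 * B.card)! : ℝ) ≤ 4 ^ B.card * (B.card ! : ℝ) ^ 2 := by
    have h1 : (2 * B.card)! = Nat.centralBinom B.card * (B.card ! * B.card !) := by
      have := Nat.choose_mul_factorial_mul_factorial (show B.card ≤ 2 * B.card by omega)
      rw [show 2 * B.card - B.card = B.card by omega] at this
      rw [← this, Nat.centralBinom_eq_two_mul_choose, mul_assoc]
    have h2 : Nat.centralBinom B.card ≤ 4 ^ B.card := by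
      rw [Nat.centralBinom_eq_two_mul_choose, show 4 = 2 ^ 2 from rfl, ← pow_mul]
      exact Nat.choose_le_two_pow _ _
    rw [h1]
    push_cast
    rw [← sq]
    gcongr
    exact_mod_cast h2
  calc _ ≤ 4 ^ B.card * (θ * (W ^ (2 * B.card) * (4 ^ B.card * (B.card ! : ℝ) ^ 2))) := by gcongr
    _ = θ * ((4 * W) ^ B.card * (B.card ! : ℝ)) ^ 2 := by rw [mul_pow, pow_mul]; ring
    _ = _ := by rw [mul_pow (√θ), Real.sq_sqrt hθ]

end BoundedAlgebra

section BlockCumulants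

variable {Ω : Type*} [mΩ : MeasurableSpace Ω] {P : Measure Ω} [IsProbabilityMeasure P]
  {F : ℕ → ℕ → MeasurableSpace Ω} {n : ℕ} {x : ℕ → Ω → ℝ} {K κ : ℝ} {ρ : ℕ → ℝ}
  {r N : ℕ} {Q : ℝ} {T : ℕ → ℕ}

/-- The sum over the `i`-th block as an element of the algebra of bounded variables. -/
def blockVar (h : MixingRow P F n x K κ ρ) (hB : IsBlocks P x n r Q N T) (i : Fin (N + 1)) :
    boundedAlgebra P :=
  ⟨ivlSum x (T i) (T (i + 1)), h.memLp (hB.le_n (by have := i.2; omega)) ⊤⟩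

/-- Joint cumulants of blocks decay with the largest distance of one of them to a fixed one. -/
lemma abs_jointCumulant_blocks_le (h : MixingRow P F n x K κ ρ) (hB : IsBlocks P x n r Q N T)
    (hr : 1 ≤ r) {θ W : ℝ} (hθ : 0 ≤ θ) (hθ1 : θ ≤ 1) (hW : 0 ≤ W)
    (hY : ∀ i : Fin (N + 1), ∀ m : ℕ, 2 ≤ m →
      ∫ ω, |ivlSum x (T i) (T (i + 1)) ω| ^ m ∂P ≤ θ * (W ^ m * (m ! : ℝ)))
    {ε : ℕ → ℝ} (hε0 : ∀ g, 0 ≤ ε g) (hε1 : 1 ≤ ε 0) (hε : ∀ g, 1 ≤ g → g ≤ n → ρ g ≤ ε g)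
    {k : ℕ} (f : Fin k → Fin (N + 1)) (x₀ y : Fin k) :
    |jointCumulant (jointMoment (expectation P) fun z => blockVar h hB (f z)) Finset.univ|
      ≤ ε ((((f x₀ : ℕ) - f y) + ((f y : ℕ) - f x₀)) / k) * θ *
        ((4 * W) ^ k * (k ! : ℝ) ^ 2) := by
  classical
  set V : Fin k → boundedAlgebra P := fun z => blockVar h hB (f z) with hV
  set g := (((f x₀ : ℕ) - f y) + ((f y : ℕ) - f x₀)) / k with hg
  have hk : 0 < k := Fin.pos x₀
  have hV0 : ∀ z, ∫ ω, (V z : Ω → ℝ) ω ∂P = 0 := fun z =>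
    h.integral_ivlSum (hB.le_n (by have := (f z).2; omega))
  have hVm : ∀ z, ∀ m : ℕ, 2 ≤ m → ∫ ω, |(V z : Ω → ℝ) ω| ^ m ∂P ≤ θ * (W ^ m * (m ! : ℝ)) :=
    fun z => hY (f z)
  have hμ : ∀ B ⊆ (Finset.univ : Finset (Fin k)), B.Nonempty →
      |jointMoment (expectation P) V B| ≤ θ * ((4 * W) ^ B.card * (B.card ! : ℝ)) :=
    fun B _ hBne => abs_jointMoment_le hθ hW hV0 hVm hBne
  have hcardk : (Finset.univ : Finset (Fin k)).card = k := by simp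
  rcases Nat.eq_zero_or_pos g with hg0 | hgpos
  · have h1 := abs_jointCumulant_le (by positivity) hθ hθ1 hμ
    rw [hcardk] at h1
    rw [hg0, mul_assoc]
    exact h1.trans (le_mul_of_one_le_left (by positivity) hε1)
  -- a gap in the tuple
  have hgap : ∃ c, (∀ z, (f z : ℕ) ≤ c ∨ c + g + 1 ≤ f z) ∧ (∃ z, (f z : ℕ) ≤ c) ∧
      ∃ z, c + g + 1 ≤ (f z : ℕ) := by
    have hdist : k * g ≤ ((f x₀ : ℕ) - f y) + ((f y : ℕ) - f x₀) := Nat.mul_div_le _ _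
    have hkg : 0 < k * g := Nat.mul_pos hk hgpos
    rcases le_total (f x₀ : ℕ) (f y) with hle | hle
    · obtain ⟨c, h1, h2, h3⟩ := exists_gap hgpos (fun z => (f z : ℕ)) x₀ y (by omega)
      exact ⟨c, h1, ⟨x₀, h2⟩, ⟨y, h3⟩⟩
    · obtain ⟨c, h1, h2, h3⟩ := exists_gap hgpos (fun z => (f z : ℕ)) y x₀ (by omega)
      exact ⟨c, h1, ⟨y, h2⟩, ⟨x₀, h3⟩⟩
  obtain ⟨c, hc, ⟨z₁, hz₁⟩, ⟨z₂, hz₂⟩⟩ := hgap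
  have hcN : c + g + 1 ≤ N := by have := (f z₂).2; omega
  have hT := hB.add_le (show c + 1 ≤ c + g + 1 by omega) hcN
  have hTn := hB.le_n (show c + g + 1 ≤ N + 1 by omega)
  have hTg : T (c + 1) + g ≤ T (c + g + 1) := by
    have e : c + g + 1 - (c + 1) = g := by omega
    rw [e] at hT
    have : g ≤ 2 * r * g := Nat.le_mul_of_pos_left _ (by omega)
    omega
  have key := abs_jointCumulant_le_of_split (μ := jointMoment (expectation P) V) (W := 4 * W)
    (ε := ε g) (by positivity) hθ hθ1 (hε0 g) (by
      rw [jointMoment_expectation]; simp) hμ (fun z => (f z : ℕ) ≤ c) ?_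
    ⟨z₁, Finset.mem_univ _, hz₁⟩ ⟨z₂, Finset.mem_univ _, by omega⟩
  · rwa [hcardk] at key
  · intro B _ hB1 hB2
    set B₁ := B.filter fun z => (f z : ℕ) ≤ c with hB₁
    set B₂ := B.filter fun z => ¬ (f z : ℕ) ≤ c with hB₂
    have hne₁ : B₁.Nonempty := by
      obtain ⟨z, h1, h2⟩ := hB1; exact ⟨z, Finset.mem_filter.2 ⟨h1, h2⟩⟩
    have hne₂ : B₂.Nonempty := by
      obtain ⟨z, h1, h2⟩ := hB2; exact ⟨z, Finset.mem_filter.2 ⟨h1, h2⟩⟩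
    have hcard : B₁.card + B₂.card = B.card := Finset.card_filter_add_card_filter_not _
    rw [jointMoment_expectation, jointMoment_expectation, jointMoment_expectation]
    set u : Ω → ℝ := fun ω => ∏ z ∈ B₁, (V z : Ω → ℝ) ω with hu
    set w : Ω → ℝ := fun ω => ∏ z ∈ B₂, (V z : Ω → ℝ) ω with hw
    have hu2 : MemLp u 2 P := (prod_mem_boundedAlgebra V B₁).mono_exponent le_top
    have hw2 : MemLp w 2 P := (prod_mem_boundedAlgebra V B₂).mono_exponent le_top
    have e1 : ∀ ω, ∏ z ∈ B, (V z : Ω → ℝ) ω = (u * w) ω := fun ω =>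
      (Finset.prod_filter_mul_prod_filter_not B (fun z => (f z : ℕ) ≤ c) _).symm
    simp_rw [e1]
    rw [← covariance_eq_sub hu2 hw2]
    have hum : Measurable[F 0 (T (c + 1))] u := by
      refine Finset.measurable_fun_prod _ fun z hz => ?_
      have hz' := (Finset.mem_filter.1 hz).2
      have h1 := hB.mono (show (f z : ℕ) + 1 ≤ c + 1 by omega) (by omega)
      have h2 := hB.le_n (show c + 1 ≤ N + 1 by omega)
      exact measurable_ivlSum (measurable_of_interval h.filt h.meas (by omega) h1 (by omega))
    have hwm : Measurable[F (T (c + 1) + g) n] w := by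
      refine Finset.measurable_fun_prod _ fun z hz => ?_
      have hz' := (Finset.mem_filter.1 hz).2
      have hz'' : c + g + 1 ≤ (f z : ℕ) := (hc z).resolve_left hz'
      have hzN := (f z).2
      have h1 := hB.mono hz'' (by omega)
      have h2 := hB.le_n (show (f z : ℕ) + 1 ≤ N + 1 by omega)
      exact measurable_ivlSum (measurable_of_interval h.filt h.meas (by omega) h2 h2)
    have hcov := h.abs_covariance_le (show T (c + 1) + g ≤ n by omega) hum hwm hu2 hw2
    have hρε := hε g hgpos (by omega)
    have l1 := l2norm_prod_le (P := P) hθ hW hVm hne₁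
    have l2 := l2norm_prod_le (P := P) hθ hW hVm hne₂
    have hfac : (B₁.card ! : ℝ) * (B₂.card ! : ℝ) ≤ (B.card ! : ℝ) := by
      rw [← hcard]
      exact_mod_cast Nat.le_of_dvd (Nat.factorial_pos _)
        (Nat.factorial_mul_factorial_dvd_factorial_add _ _)
    have hε0g := hε0 g
    refine hcov.trans ?_
    calc ρ g * l2norm P u * l2norm P w
        ≤ ε g * (√θ * ((4 * W) ^ B₁.card * (B₁.card ! : ℝ))) *
          (√θ * ((4 * W) ^ B₂.card * (B₂.card ! : ℝ))) := by
          have := l2norm_nonneg (P := P) u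
          have := l2norm_nonneg (P := P) w
          gcongr
      _ = ε g * (√θ * √θ) * ((4 * W) ^ (B₁.card + B₂.card) *
          ((B₁.card ! : ℝ) * (B₂.card ! : ℝ))) := by rw [pow_add]; ring
      _ ≤ _ := by rw [Real.mul_self_sqrt hθ, hcard]; gcongr

/-- The cumulants of the sum over a row grow linearly in the number of blocks. -/
lemma abs_cumulantSeq_le (h : MixingRow P F n x K κ ρ) (hB : IsBlocks P x n r Q N T)
    (hr : 1 ≤ r) {θ W : ℝ} (hθ : 0 ≤ θ) (hθ1 : θ ≤ 1) (hW : 0 ≤ W)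
    (hY : ∀ i : Fin (N + 1), ∀ m : ℕ, 2 ≤ m →
      ∫ ω, |ivlSum x (T i) (T (i + 1)) ω| ^ m ∂P ≤ θ * (W ^ m * (m ! : ℝ)))
    {α η E : ℝ} (hα : 0 < α) (hη : 0 < η) (hE : 1 ≤ E)
    (hε : ∀ g : ℕ, 1 ≤ g → g ≤ n → ρ g ≤ E * Real.exp (-(α * (g : ℝ) ^ η)))
    {C : ℝ} {b : ℕ} (hC : 1 ≤ C) {k : ℕ} (hk : 1 ≤ k)
    (hsum : ∀ i : Fin (N + 1), ∑ j : Fin (N + 1),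
      Real.exp (-(α / k * (((((i : ℕ) - j) + ((j : ℕ) - i)) / k : ℕ) : ℝ) ^ η)) ≤ C * (k : ℝ) ^ b) :
    |cumulantSeq (fun q => ∫ ω, ivlSum x 0 n ω ^ q ∂P) k|
      ≤ E * θ * ((N : ℝ) + 1) * (4 * W * C * (k : ℝ) ^ (b + 2)) ^ k := by
  classical
  set x₀ : Fin k := ⟨0, by omega⟩ with hx₀
  have hmom : (fun q => ∫ ω, ivlSum x 0 n ω ^ q ∂P)
      = fun q => expectation P ((∑ i, blockVar h hB i) ^ q) := by
    funext q
    unfold expectation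
    simp only [LinearMap.coe_mk, AddHom.coe_mk]
    refine integral_congr_ae (Eventually.of_forall fun ω => ?_)
    simp only [SubmonoidClass.coe_pow, AddSubmonoidClass.coe_finsetSum, Pi.pow_apply,
      Finset.sum_apply]
    congr 1
    have e := hB.sum_eq x le_rfl ω
    rw [hB.last, Finset.sum_range] at e
    rw [← e]
    rfl
  rw [hmom, cumulantSeq_sum]
  set dist : (Fin k → Fin (N + 1)) → Fin k → ℕ :=
    fun f z => ((f x₀ : ℕ) - f z) + ((f z : ℕ) - f x₀) with hdist
  have hmax : ∀ f : Fin k → Fin (N + 1), ∃ y, ∀ z, dist f z ≤ dist f y := by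
    intro f
    obtain ⟨y, -, hy⟩ := Finset.exists_max_image Finset.univ (dist f) ⟨x₀, Finset.mem_univ _⟩
    exact ⟨y, fun z => hy z (Finset.mem_univ z)⟩
  choose y hy using hmax
  have hone : ∀ f : Fin k → Fin (N + 1),
      |jointCumulant (jointMoment (expectation P) fun z => blockVar h hB (f z)) Finset.univ|
        ≤ (E * θ * ((4 * W) ^ k * (k ! : ℝ) ^ 2)) *
          Real.exp (-(α * ((dist f (y f) / k : ℕ) : ℝ) ^ η)) := by
    intro f
    have := abs_jointCumulant_blocks_le h hB hr hθ hθ1 hW hY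
      (ε := fun g => E * Real.exp (-(α * (g : ℝ) ^ η))) (fun g => by positivity)
      (by simp [Real.zero_rpow hη.ne', hE]) hε f x₀ (y f)
    refine this.trans (le_of_eq ?_)
    simp only [hdist]
    ring
  have htup := sum_tuples_le hα hη hC hk hsum x₀ (fun f => dist f (y f)) (fun f z => hy f z)
  have hkk : (k ! : ℝ) ≤ (k : ℝ) ^ k := by exact_mod_cast Nat.factorial_le_pow k
  push_cast at htup
  calc _ ≤ ∑ f : Fin k → Fin (N + 1), _ := Finset.abs_sum_le_sum_abs _ _
    _ ≤ ∑ f : Fin k → Fin (N + 1), (E * θ * ((4 * W) ^ k * (k ! : ℝ) ^ 2)) *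
          Real.exp (-(α * ((dist f (y f) / k : ℕ) : ℝ) ^ η)) := Finset.sum_le_sum fun f _ => hone f
    _ = (E * θ * ((4 * W) ^ k * (k ! : ℝ) ^ 2)) * ∑ f : Fin k → Fin (N + 1),
          Real.exp (-(α * ((dist f (y f) / k : ℕ) : ℝ) ^ η)) := by rw [Finset.mul_sum]
    _ ≤ (E * θ * ((4 * W) ^ k * ((k : ℝ) ^ k) ^ 2)) * (((N : ℝ) + 1) * (C * (k : ℝ) ^ b) ^ k) := by
        gcongr
    _ = E * θ * ((N : ℝ) + 1) * ((4 * W) * (C * (k : ℝ) ^ b) * (k : ℝ) ^ 2) ^ k := by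
        rw [mul_pow ((4 * W) * (C * (k : ℝ) ^ b)), mul_pow (4 * W), ← pow_mul, ← pow_mul,
          mul_comm k 2]
        ring
    _ = _ := by congr 2; rw [pow_add]; ring

end BlockCumulants

/-! ### The moment expansion of one row -/

section RowExpansion

/-- The distance over which the mixing coefficients become small grows more slowly than `√A`. -/
lemma exists_log_rpow_le {a η : ℝ} (ha : 0 < a) (hη : 0 < η) :
    ∃ c : ℝ, 1 ≤ c ∧ ∀ A : ℝ, 1 ≤ A → 1 + (Real.log (3 * A) / a) ^ (1 / η) ≤ c * √A := by
  set d : ℝ := (2 / (η * a)) ^ (1 / η) with hd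
  have hd0 : 0 ≤ d := by positivity
  refine ⟨1 + √3 * d, by nlinarith [Real.sqrt_nonneg 3], fun A hA => ?_⟩
  have hA0 : (0 : ℝ) ≤ 3 * A := by linarith
  have hlog : 0 ≤ Real.log (3 * A) := Real.log_nonneg (by linarith)
  have h1 : Real.log (3 * A) / a ≤ (3 * A) ^ (η / 2) * (2 / (η * a)) := by
    have := Real.log_le_rpow_div hA0 (show 0 < η / 2 by positivity)
    rw [div_le_iff₀ ha]
    refine this.trans (le_of_eq ?_)
    field_simp
  have h2 : (Real.log (3 * A) / a) ^ (1 / η) ≤ √3 * √A * d := by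
    refine (Real.rpow_le_rpow (by positivity) h1 (by positivity)).trans (le_of_eq ?_)
    rw [Real.mul_rpow (by positivity) (by positivity), ← Real.rpow_mul hA0,
      show η / 2 * (1 / η) = 1 / 2 by field_simp, ← Real.sqrt_eq_rpow,
      Real.sqrt_mul (by norm_num)]
  have h3 : 1 ≤ √A := Real.one_le_sqrt.2 hA
  nlinarith

/-- At the distance `⌈(log (3A) / a)^{1/η}⌉` the rate `A e^{-a j^η}` has dropped below `1/3`. -/
lemma mul_exp_ceil_le {a η A : ℝ} (ha : 0 < a) (hη : 0 < η) (hA : 1 ≤ A) :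
    A * Real.exp (-(a * ((⌈(Real.log (3 * A) / a) ^ (1 / η)⌉₊ : ℕ) : ℝ) ^ η)) ≤ 1 / 3 := by
  have hlog : 0 ≤ Real.log (3 * A) := Real.log_nonneg (by linarith)
  set y : ℝ := (Real.log (3 * A) / a) ^ (1 / η) with hy
  have hy0 : 0 ≤ y := by positivity
  have h1 : Real.log (3 * A) ≤ a * ((⌈y⌉₊ : ℕ) : ℝ) ^ η := by
    have h2 : y ^ η = Real.log (3 * A) / a := by
      rw [hy, ← Real.rpow_mul (by positivity), one_div_mul_cancel hη.ne', Real.rpow_one]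
    have h3 : y ^ η ≤ ((⌈y⌉₊ : ℕ) : ℝ) ^ η := Real.rpow_le_rpow hy0 (Nat.le_ceil y) hη.le
    rw [h2, div_le_iff₀ ha] at h3
    linarith
  calc _ ≤ A * Real.exp (-Real.log (3 * A)) := by gcongr
    _ = 1 / 3 := by
      rw [Real.exp_neg, Real.exp_log (by linarith)]
      field_simp

lemma tailScale_pos {v K : ℝ} (hv : 0 < v) (hK : 0 ≤ K) (J : ℕ) : 0 < tailScale v K J := by
  have : 0 < √(6 * v) := Real.sqrt_pos.2 (by positivity)
  unfold tailScale
  positivity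

lemma div_tailScale_sq_le {v K : ℝ} (hv : 0 < v) (hK : 0 ≤ K) (J : ℕ) :
    v / tailScale v K J ^ 2 ≤ 1 := by
  have h0 := tailScale_pos hv hK J
  rw [div_le_one (by positivity)]
  have h1 : √(6 * v) ≤ tailScale v K J := by
    have : 0 ≤ √(6 * v) := Real.sqrt_nonneg _
    have : 0 ≤ (J : ℝ) * K := by positivity
    unfold tailScale
    linarith
  have h2 := pow_le_pow_left₀ (Real.sqrt_nonneg _) h1 2
  rw [Real.sq_sqrt (by positivity)] at h2
  linarith

variable {Ω : Type*} [mΩ : MeasurableSpace Ω]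

set_option maxHeartbeats 1000000 in
/-- The moment expansion for a single row, once the standard deviation dominates the cube of
a multiple of the scale `R`; the constants depend on the mixing rate only. -/
lemma MixingRow.exists_moment_bound {a η ε₀ : ℝ} (ha : 0 < a) (hη : 0 < η) (hε₀ : 0 < ε₀) :
    ∃ C c : ℝ, 0 < C ∧ 0 < c ∧
      ∀ (P : Measure Ω) [IsProbabilityMeasure P] (F : ℕ → ℕ → MeasurableSpace Ω) (n : ℕ)
        (x : ℕ → Ω → ℝ) (K κ : ℝ) (ρ : ℕ → ℝ) (A Q s R : ℝ) (r : ℕ),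
        MixingRow P F n x K κ ρ → 0 ≤ κ → 1 ≤ A → 1 ≤ r → ε₀ ≤ Q →
        2 * κ ^ 2 * (1 + 2 * ∑ j ∈ Finset.Icc 1 n, ρ j) * r ≤ Q →
        ∑ m ∈ Finset.Icc 1 (n / r), ρ (r * m) ≤ 1 / 4 →
        (∀ k j, 1 ≤ j → k + j ≤ n →
          phiCoeff (F 0 k) (F (k + j) n) P ≤ A * Real.exp (-(a * (j : ℝ) ^ η))) →
        (∀ j, 1 ≤ j → j ≤ n → ρ j ≤ 2 * √A * Real.exp (-(a / 2 * (j : ℝ) ^ η))) →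
        0 ≤ s → ∫ ω, ivlSum x 0 n ω ^ 2 ∂P = s ^ 2 → Q ≤ s ^ 2 →
        √Q * (K + (1 + (Real.log (3 * A) / a) ^ (1 / η)) + 1) * A = R → (c * R) ^ 3 ≤ s →
        ∀ p : ℕ, 2 < p →
          |∫ ω, ivlSum x 0 n ω ^ p ∂P - s ^ p * gaussMoment p| ≤ rosenthalBound C η R s p := by
  obtain ⟨cJ, hcJ1, hcJ⟩ := exists_log_rpow_le ha hη
  obtain ⟨Cs, b, hCs, hsum⟩ := exists_sum_exp_le (show 0 < a / 2 by positivity) hη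
  obtain ⟨C₀, hC₀, hmain⟩ := MixArray.exists_moment_bound hη (C₁ := 36900)
    (C₂ := 9240 * (180 * Cs)) (by norm_num) (by linarith) (b + 2)
  have hsε : 0 < √ε₀ := Real.sqrt_pos.2 hε₀
  -- `c * R` is to be at least `1` and at least the tail scale of the blocks times `√A`
  set c : ℝ := 58 + 2 * cJ / √ε₀ + 1 / √ε₀ with hc
  have hcc : 0 < 2 * cJ / √ε₀ := by positivity
  have hc1ε : 0 < 1 / √ε₀ := by positivity
  have hc1 : 1 ≤ c := by linarith
  have hc0 : 0 < c := by linarith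
  refine ⟨C₀ / (1 / c), c, by positivity, hc0, ?_⟩
  intro P _ F n x K κ ρ A Q s R r h hκ hA hr hεQ hQ hρ hφ hρε hs hsq hQs hR hRs p hp
  have hQ0 : 0 < Q := hε₀.trans_le hεQ
  have hK0 := h.K_nonneg
  have hsA : 1 ≤ √A := Real.one_le_sqrt.2 hA
  have hAA : √A * √A = A := Real.mul_self_sqrt (by linarith)
  have hsA' : √A ≤ A := by nlinarith
  have hsQ : √ε₀ ≤ √Q := Real.sqrt_le_sqrt hεQ
  set j₀ : ℝ := (Real.log (3 * A) / a) ^ (1 / η) with hj₀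
  have hlog : 0 < Real.log (3 * A) := Real.log_pos (by linarith)
  have hj₀0 : 0 < j₀ := by positivity
  set J : ℕ := ⌈j₀⌉₊ with hJdef
  have hJ : 1 ≤ J := Nat.one_le_iff_ne_zero.2 (Nat.ceil_pos.2 hj₀0).ne'
  have hJle : (J : ℝ) ≤ cJ * √A := by
    have h1 := (Nat.ceil_lt_add_one hj₀0.le).le
    have h2 := hcJ A hA
    linarith
  have hφJ : ∀ k, k + J ≤ n → phiCoeff (F 0 k) (F (k + J) n) P ≤ 1 / 3 := fun k hk =>
    (hφ k J hJ hk).trans (mul_exp_ceil_le ha hη hA)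
  -- lower bounds of the scale `R`
  have hR0 : 2 * √ε₀ ≤ R := by
    rw [← hR]
    calc 2 * √ε₀ = √ε₀ * 2 * 1 := by ring
      _ ≤ √Q * (K + (1 + j₀) + 1) * A := by gcongr; linarith
  have hRpos : 0 < R := by linarith
  have hRQ : √Q * √A ≤ R := by
    rw [← hR]
    calc √Q * √A = √Q * 1 * √A := by ring
      _ ≤ √Q * (K + (1 + j₀) + 1) * A := by gcongr; linarith
  have hRK : K * A ≤ R / √ε₀ := by
    rw [le_div_iff₀ hsε, ← hR]
    calc K * A * √ε₀ = √ε₀ * K * A := by ring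
      _ ≤ √Q * (K + (1 + j₀) + 1) * A := by gcongr; linarith
  have hJK : J * K * √A ≤ cJ / √ε₀ * R := by
    calc J * K * √A ≤ (cJ * √A) * K * √A := by gcongr
      _ = cJ * (K * (√A * √A)) := by ring
      _ = cJ * (K * A) := by rw [hAA]
      _ ≤ cJ * (R / √ε₀) := by gcongr
      _ = _ := by ring
  set R₁ : ℝ := c * R with hR₁
  have hR₁1 : 1 ≤ R₁ := by
    calc (1 : ℝ) ≤ (1 / √ε₀) * (2 * √ε₀) := by field_simp; norm_num
      _ ≤ c * R := by gcongr; linarith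
  have hR₁s : R₁ ≤ s := (le_self_pow₀ hR₁1 (by norm_num)).trans hRs
  have hs1 : 1 ≤ s := hR₁1.trans hR₁s
  -- the blocks
  obtain ⟨N, T, hB⟩ := h.exists_blocks hκ hr hQ0 hQ
  have hNQ : ((N : ℝ) + 1) * Q ≤ 35 * s ^ 2 := by
    have := hB.card_mul_le h hκ hr hρ hQ
    rw [hsq] at this
    linarith
  -- moments of the blocks
  set v : ℝ := 132 * Q with hv
  set M : ℝ := tailScale v K J with hM
  have hv0 : 0 < v := by positivity
  have hMpos : 0 < M := tailScale_pos hv0 hK0 J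
  have hθ1 : v / M ^ 2 ≤ 1 := div_tailScale_sq_le hv0 hK0 J
  have hY : ∀ i : Fin (N + 1), ∀ m : ℕ, 2 ≤ m →
      ∫ ω, |ivlSum x (T i) (T (i + 1)) ω| ^ m ∂P ≤ v / M ^ 2 * ((45 * M) ^ m * (m ! : ℝ)) := by
    intro i m hm
    have hi := i.2
    exact integral_abs_ivlSum_pow_le h.filt h.meas hK0 h.bdd hJ hφJ (hB.mono (by omega) (by omega))
      (hB.le_n (by omega)) hv0 (hB.upper i (by omega)) hm
  have hMA : M * √A ≤ R₁ := by
    have h1 : √(6 * v) ≤ 29 * √Q := by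
      rw [Real.sqrt_le_left (by positivity), mul_pow, Real.sq_sqrt hQ0.le]
      linarith
    calc M * √A = 2 * √(6 * v) * √A + 2 * (J * K * √A) := by rw [hM, tailScale]; ring
      _ ≤ 2 * (29 * √Q) * √A + 2 * (cJ / √ε₀ * R) := by gcongr
      _ = 58 * (√Q * √A) + 2 * cJ / √ε₀ * R := by ring
      _ ≤ 58 * R + 2 * cJ / √ε₀ * R := by gcongr
      _ = (58 + 2 * cJ / √ε₀) * R := by ring
      _ ≤ c * R := by gcongr; linarith
  -- cumulants of the row
  have hcum : ∀ k : ℕ, 3 ≤ k → |cumulantSeq (fun q => ∫ ω, ivlSum x 0 n ω ^ q ∂P) k|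
      ≤ s ^ 2 * R₁ ^ (k - 2) * (9240 * (180 * Cs) * (k : ℝ) ^ (b + 2)) ^ k := by
    intro k hk
    have h1 := abs_cumulantSeq_le h hB hr (by positivity) hθ1 (by positivity) hY
      (show 0 < a / 2 by positivity) hη (show 1 ≤ 2 * √A by linarith) hρε hCs
      (show 1 ≤ k by omega) (hsum k (by omega) (N + 1))
    have h2 : M ^ k = M ^ 2 * M ^ (k - 2) := by rw [← pow_add]; congr 1; omega
    have h3 : √A * M ^ (k - 2) ≤ R₁ ^ (k - 2) := by
      calc √A * M ^ (k - 2) ≤ √A ^ (k - 2) * M ^ (k - 2) := by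
            gcongr; exact le_self_pow₀ hsA (by omega)
        _ = (M * √A) ^ (k - 2) := by rw [mul_pow]; ring
        _ ≤ _ := by gcongr
    have h4 : (9240 : ℝ) ≤ 9240 ^ k := le_self_pow₀ (by norm_num) (by omega)
    set G : ℝ := (180 * Cs * (k : ℝ) ^ (b + 2)) ^ k with hG
    have hG0 : 0 ≤ G := by positivity
    calc _ ≤ 2 * √A * (v / M ^ 2) * ((N : ℝ) + 1) * (4 * (45 * M) * Cs * (k : ℝ) ^ (b + 2)) ^ k := h1
      _ = 2 * √A * (v / M ^ 2) * ((N : ℝ) + 1) * (M ^ k * G) := by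
          rw [hG, ← mul_pow]; congr 2; ring
      _ = 264 * (((N : ℝ) + 1) * Q) * (√A * M ^ (k - 2)) * G := by
          rw [h2, hv]; field_simp; ring
      _ ≤ 264 * (35 * s ^ 2) * R₁ ^ (k - 2) * G := by gcongr
      _ = s ^ 2 * R₁ ^ (k - 2) * (9240 * G) := by ring
      _ ≤ s ^ 2 * R₁ ^ (k - 2) * (9240 ^ k * G) := by gcongr
      _ = _ := by rw [hG, ← mul_pow]; congr 2; ring
  -- crude moments of the row
  have hmom : ∀ q : ℕ, |∫ ω, ivlSum x 0 n ω ^ q ∂P| ≤ 36900 ^ q * (q ! : ℝ) * s ^ q := by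
    intro q
    rcases Nat.lt_or_ge q 2 with hq | hq
    · interval_cases q
      · simp
      · simp only [pow_one, h.integral_ivlSum le_rfl, abs_zero]
        positivity
    set v' : ℝ := 27720 * s ^ 2 with hv'
    set M' : ℝ := tailScale v' K J with hM'
    have hvar : ∀ c d, 0 ≤ c → c ≤ d → d ≤ n → ∫ ω, ivlSum x c d ω ^ 2 ∂P ≤ v' := by
      intro c d _ _ hd
      have := hB.integral_sq_le h hr hρ hQ0 (c := c) hd
      linarith
    have h1 := integral_abs_ivlSum_pow_le h.filt h.meas hK0 h.bdd hJ hφJ (Nat.zero_le n) le_rfl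
      (show 0 < v' by positivity) hvar hq
    have hsv' : √(6 * v') ≤ 408 * s := by
      rw [Real.sqrt_le_left (by positivity), mul_pow]
      have := sq_nonneg s
      linarith
    have hJK0 : 0 ≤ (J : ℝ) * K := by positivity
    have hM'le : M' ≤ 820 * s := by
      have h2 : 2 * (J * K) ≤ s := by
        calc 2 * ((J : ℝ) * K) ≤ 2 * (J * K * √A) :=
              mul_le_mul_of_nonneg_left (le_mul_of_one_le_right hJK0 hsA) (by norm_num)
          _ ≤ 2 * (cJ / √ε₀ * R) := by gcongr
          _ = 2 * cJ / √ε₀ * R := by ring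
          _ ≤ c * R := by gcongr; linarith
          _ ≤ s := hR₁s
      rw [hM', tailScale]
      linarith
    have hv'0 : 0 < v' := by positivity
    have hM'pos : 0 < M' := tailScale_pos hv'0 hK0 J
    have hθ' : v' / M' ^ 2 ≤ 1 := div_tailScale_sq_le hv'0 hK0 J
    calc _ ≤ ∫ ω, |ivlSum x 0 n ω ^ q| ∂P := abs_integral_le_integral_abs
      _ = ∫ ω, |ivlSum x 0 n ω| ^ q ∂P := by simp_rw [abs_pow]
      _ ≤ v' / M' ^ 2 * ((45 * M') ^ q * (q ! : ℝ)) := h1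
      _ ≤ 1 * ((45 * (820 * s)) ^ q * (q ! : ℝ)) := by gcongr
      _ = _ := by rw [show 45 * (820 * s) = 36900 * s by ring, mul_pow]; ring
  have key := hmain (fun q => ∫ ω, ivlSum x 0 n ω ^ q ∂P) s R₁ (by simp)
    (by simpa using h.integral_ivlSum le_rfl) hsq hR₁1 hRs hmom hcum p hp
  refine key.trans ?_
  have e : R₁ = R / (1 / c) := by rw [hR₁]; field_simp
  rw [e]
  exact rosenthalBound_div_le hC₀.le hRpos.le hs (by positivity)
    (by rw [div_le_one hc0]; exact hc1) hp

end RowExpansion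

/-! ### The rows of a bounded triangular array -/

section Rows

variable {Ω : Type*} {X : ℕ → ℕ → Type*} [mΩ : MeasurableSpace Ω] {P : Measure Ω}
  {ζ : ∀ n j, Ω → X n j} {g : ∀ n j, X n j → ℝ}

lemma Kinf_nonneg (n : ℕ) : 0 ≤ Kinf P ζ g n := ENNReal.toReal_nonneg

lemma sigma_nonneg (n : ℕ) : 0 ≤ sigma P ζ g n := Real.sqrt_nonneg _

lemma normMoment_eq (p n : ℕ) :
    normMoment P ζ g p n = rowMoment P ζ g p n / sigma P ζ g n ^ p := by
  unfold normMoment rowMoment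
  simp_rw [div_pow]
  exact integral_div _ _

variable [mX : ∀ n j, MeasurableSpace (X n j)]

lemma IsBoundedArray.isIntervalFiltration (hS : IsBoundedArray P ζ g) (n : ℕ) :
    IsIntervalFiltration (rowSigma ζ n) n where
  le _ _ hb := iSup₂_le fun j hj => (hS.measurable_zeta n j (hj.2.trans hb)).comap_le
  mono _ _ _ _ ha hb := biSup_mono (Set.Icc_subset_Icc ha hb)

lemma phiCoeff_le_phiRow [IsProbabilityMeasure P] {n k j : ℕ} (h : k + j ≤ n) :
    phiCoeff (rowSigma ζ n 0 k) (rowSigma ζ n (k + j) n) P ≤ phiRow P ζ n j := by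
  refine le_csSup ⟨1, ?_⟩ ⟨k, h, rfl⟩
  rintro _ ⟨k, -, rfl⟩
  exact phiCoeff_le_one

lemma rhoCoeff_le_rhoRow {n k j : ℕ} (h : k + j ≤ n) :
    rhoCoeff (rowSigma ζ n 0 k) (rowSigma ζ n (k + j) n) P ≤ rhoRow P ζ n j := by
  refine le_csSup ⟨1, ?_⟩ ⟨k, h, rfl⟩
  rintro _ ⟨k, -, rfl⟩
  exact rhoCoeff_le_one

lemma rhoRow_nonneg (n j : ℕ) : 0 ≤ rhoRow P ζ n j := by
  refine Real.sSup_nonneg ?_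
  rintro _ ⟨k, -, rfl⟩
  exact rhoCoeff_nonneg

lemma phiRow_le_phiUnif [IsProbabilityMeasure P] {n j : ℕ} (h : j ≤ n) : phiRow P ζ n j ≤ phiUnif P ζ j := by
  refine le_csSup ⟨1, ?_⟩ ⟨n, h, rfl⟩
  rintro _ ⟨n, -, rfl⟩
  refine Real.sSup_le ?_ zero_le_one
  rintro _ ⟨k, -, rfl⟩
  exact phiCoeff_le_one

/-- The correlation coefficients inherit half of the exponential rate of the `φ`-coefficients. -/
lemma IsBoundedArray.rhoRow_le [IsProbabilityMeasure P] (hS : IsBoundedArray P ζ g) {a η A : ℝ} {n j : ℕ} (hA : 0 ≤ A)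
    (h : phiRow P ζ n j ≤ A * Real.exp (-(a * (j : ℝ) ^ η))) :
    rhoRow P ζ n j ≤ 2 * √A * Real.exp (-(a / 2 * (j : ℝ) ^ η)) := by
  refine Real.sSup_le ?_ (by positivity)
  rintro _ ⟨k, hk, rfl⟩
  have hF := hS.isIntervalFiltration n
  refine (rhoCoeff_le_sqrt_phiCoeff (hF.le 0 k (by omega)) (hF.le _ n le_rfl)).trans ?_
  rw [mul_assoc]
  refine mul_le_mul_of_nonneg_left ?_ (by norm_num)
  refine (Real.sqrt_le_sqrt ((phiCoeff_le_phiRow hk).trans h)).trans (le_of_eq ?_)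
  rw [Real.sqrt_mul hA, ← Real.exp_half]
  congr 2
  ring

lemma IsBoundedArray.ae_abs_xi_le (hS : IsBoundedArray P ζ g) {n j : ℕ} (hj : 1 ≤ j)
    (hjn : j ≤ n) : ∀ᵐ ω ∂P, |xi ζ g n j ω| ≤ Kinf P ζ g n := by
  have hsup : ((Finset.Icc 1 n).sup fun j => eLpNorm (xi ζ g n j) ⊤ P) < ⊤ := by
    refine (Finset.sup_lt_iff (by simp)).2 fun i hi => ?_
    rw [Finset.mem_Icc] at hi
    exact (hS.bounded n i hi.1 hi.2).2
  have hle : eLpNorm (xi ζ g n j) ⊤ P ≤ (Finset.Icc 1 n).sup fun j => eLpNorm (xi ζ g n j) ⊤ P :=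
    Finset.le_sup (f := fun j => eLpNorm (xi ζ g n j) ⊤ P) (Finset.mem_Icc.2 ⟨hj, hjn⟩)
  rw [eLpNorm_exponent_top] at hle
  filter_upwards [ae_le_eLpNormEssSup (f := xi ζ g n j) (μ := P)] with ω hω
  have h1 := ENNReal.toReal_mono hsup.ne (hω.trans hle)
  simpa [Kinf] using h1

/-- The variables of a row, cut off at their essential bound, so that the bound holds
everywhere. -/
def clippedRow (P : Measure Ω) (ζ : ∀ n j, Ω → X n j) (g : ∀ n j, X n j → ℝ) (n j : ℕ) : Ω → ℝ :=
  fun ω => max (-Kinf P ζ g n) (min (Kinf P ζ g n) (xi ζ g n j ω))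

lemma IsBoundedArray.clippedRow_ae_eq (hS : IsBoundedArray P ζ g) {n j : ℕ} (hj : 1 ≤ j)
    (hjn : j ≤ n) : clippedRow P ζ g n j =ᵐ[P] xi ζ g n j := by
  filter_upwards [hS.ae_abs_xi_le hj hjn] with ω hω
  rw [abs_le] at hω
  rw [clippedRow, min_eq_right hω.2, max_eq_right hω.1]

lemma IsBoundedArray.ivlSum_clippedRow_ae_eq (hS : IsBoundedArray P ζ g) (n : ℕ) :
    ivlSum (clippedRow P ζ g n) 0 n =ᵐ[P] rowSum ζ g n := by
  have h : ∀ᵐ ω ∂P, ∀ j ∈ Finset.Icc 1 n, clippedRow P ζ g n j ω = xi ζ g n j ω := by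
    refine (Filter.eventually_all_finset _).2 fun j hj => ?_
    rw [Finset.mem_Icc] at hj
    exact hS.clippedRow_ae_eq hj.1 hj.2
  filter_upwards [h] with ω hω
  exact Finset.sum_congr rfl hω

lemma IsBoundedArray.mixingRow [IsProbabilityMeasure P] (hS : IsBoundedArray P ζ g) {n : ℕ} {κ : ℝ}
    (hle : ∀ j, 1 ≤ j → j ≤ n → (eLpNorm (xi ζ g n j) 2 P).toReal ≤ κ) :
    MixingRow P (rowSigma ζ n) n (clippedRow P ζ g n) (Kinf P ζ g n) κ (rhoRow P ζ n) where
  filt := hS.isIntervalFiltration n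
  meas j _ hjn := by
    have h1 : Measurable[rowSigma ζ n j j] (xi ζ g n j) :=
      ((hS.measurable_g n j hjn).comp (comap_measurable (ζ n j))).mono
        (le_iSup₂_of_le (f := fun i _ => MeasurableSpace.comap (ζ n i) (mX n i)) j
          (Set.mem_Icc.2 ⟨le_rfl, le_rfl⟩) le_rfl) le_rfl
    exact measurable_const.max (measurable_const.min h1)
  K_nonneg := Kinf_nonneg n
  bdd j _ _ ω := by
    have h0 : 0 ≤ Kinf P ζ g n := Kinf_nonneg n
    exact abs_le.2 ⟨le_max_left _ _, max_le (by linarith) (min_le_left _ _)⟩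
  centered j hj hjn := by
    rw [integral_congr_ae (hS.clippedRow_ae_eq hj hjn)]
    exact hS.centered n j hj hjn
  sq_le j hj hjn := by
    have h1 : ∫ ω, clippedRow P ζ g n j ω ^ 2 ∂P = l2norm P (xi ζ g n j) ^ 2 := by
      rw [l2norm_sq]
      refine integral_congr_ae ?_
      filter_upwards [hS.clippedRow_ae_eq hj hjn] with ω hω
      rw [hω]
    rw [h1, l2norm_eq_toReal_eLpNorm ((hS.bounded n j hj hjn).mono_exponent le_top)]
    exact pow_le_pow_left₀ ENNReal.toReal_nonneg (hle j hj hjn) 2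
  rho_nonneg := rhoRow_nonneg n
  rho_le _ _ := rhoCoeff_le_rhoRow

lemma IsBoundedArray.memLp_rowSum [IsProbabilityMeasure P] (hS : IsBoundedArray P ζ g) (n : ℕ) (p : ENNReal) :
    MemLp (rowSum ζ g n) p P := by
  refine MemLp.mono_exponent (q := ⊤) ?_ le_top
  refine memLp_finsetSum _ fun j hj => ?_
  rw [Finset.mem_Icc] at hj
  exact hS.bounded n j hj.1 hj.2

lemma IsBoundedArray.integral_rowSum [IsProbabilityMeasure P] (hS : IsBoundedArray P ζ g) (n : ℕ) :
    ∫ ω, rowSum ζ g n ω ∂P = 0 := by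
  unfold rowSum
  rw [integral_finsetSum]
  · refine Finset.sum_eq_zero fun j hj => ?_
    rw [Finset.mem_Icc] at hj
    exact hS.centered n j hj.1 hj.2
  · intro j hj
    rw [Finset.mem_Icc] at hj
    exact (hS.bounded n j hj.1 hj.2).integrable le_top

lemma IsBoundedArray.rowMoment_two [IsProbabilityMeasure P] (hS : IsBoundedArray P ζ g) (n : ℕ) :
    rowMoment P ζ g 2 n = sigma P ζ g n ^ 2 := by
  rw [sigma, Real.sq_sqrt (variance_nonneg _ _),
    variance_of_integral_eq_zero (hS.memLp_rowSum n 2).aestronglyMeasurable.aemeasurable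
      (hS.integral_rowSum n)]
  rfl

lemma IsBoundedArray.integral_ivlSum_pow (hS : IsBoundedArray P ζ g) (p n : ℕ) :
    ∫ ω, ivlSum (clippedRow P ζ g n) 0 n ω ^ p ∂P = rowMoment P ζ g p n := by
  refine integral_congr_ae ?_
  filter_upwards [hS.ivlSum_clippedRow_ae_eq n] with ω hω
  rw [hω]

/-- For a single row the error is bounded trivially. -/
lemma IsBoundedArray.exists_bound_single [IsProbabilityMeasure P] (hS : IsBoundedArray P ζ g) {η R : ℝ} (hη : 0 < η)
    (hR : 0 < R) (n : ℕ) :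
    ∃ C : ℝ, 0 ≤ C ∧ ∀ p : ℕ, 2 < p →
      |rowMoment P ζ g p n - sigma P ζ g n ^ p * gaussMoment p|
        ≤ rosenthalBound C η R (sigma P ζ g n) p := by
  set s := sigma P ζ g n with hs
  have hs0 : 0 ≤ s := sigma_nonneg n
  have hK0 : 0 ≤ Kinf P ζ g n := Kinf_nonneg n
  set B : ℝ := n * Kinf P ζ g n with hB
  have hB0 : 0 ≤ B := by positivity
  set D : ℝ := B + s + 1 with hD
  have hD1 : 1 ≤ D := by linarith
  refine ⟨2 * D * (1 + 1 / R), by positivity, fun p hp => ?_⟩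
  have hbd : ∀ᵐ ω ∂P, |rowSum ζ g n ω| ≤ B := by
    have h : ∀ᵐ ω ∂P, ∀ j ∈ Finset.Icc 1 n, |xi ζ g n j ω| ≤ Kinf P ζ g n := by
      refine (Filter.eventually_all_finset _).2 fun j hj => ?_
      rw [Finset.mem_Icc] at hj
      exact hS.ae_abs_xi_le hj.1 hj.2
    filter_upwards [h] with ω hω
    refine (Finset.abs_sum_le_sum_abs _ _).trans ((Finset.sum_le_card_nsmul _ _ _ hω).trans ?_)
    simp [hB]
  have hsplit : p = (p - 2) + 2 := by omega
  have hpow : ∀ y : ℝ, y ^ p = y ^ (p - 2) * y ^ 2 := fun y => by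
    rw [← pow_add]; congr 1
  have h1 : |rowMoment P ζ g p n| ≤ D ^ p * s ^ 2 := by
    calc |rowMoment P ζ g p n| ≤ ∫ ω, |rowSum ζ g n ω ^ p| ∂P := abs_integral_le_integral_abs
      _ ≤ ∫ ω, D ^ (p - 2) * rowSum ζ g n ω ^ 2 ∂P := by
        refine integral_mono_of_nonneg (Eventually.of_forall fun ω => abs_nonneg _)
          ((hS.memLp_rowSum n 2).integrable_sq.const_mul _) ?_
        filter_upwards [hbd] with ω hω
        rw [hpow, abs_mul, abs_pow, abs_of_nonneg (sq_nonneg (rowSum ζ g n ω))]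
        gcongr
        linarith
      _ = D ^ (p - 2) * s ^ 2 := by
        rw [integral_const_mul, hs, ← hS.rowMoment_two n]; rfl
      _ ≤ D ^ p * s ^ 2 := by gcongr; omega
  have h2 : |s ^ p * gaussMoment p| ≤ D ^ p * s ^ 2 * (p ! : ℝ) := by
    rw [abs_mul, abs_of_nonneg (by positivity : 0 ≤ s ^ p), hpow]
    calc s ^ (p - 2) * s ^ 2 * |gaussMoment p| ≤ D ^ (p - 2) * s ^ 2 * (p ! : ℝ) := by
          gcongr
          · linarith
          · exact abs_gaussMoment_le p
      _ ≤ _ := by gcongr; omega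
  have hfac : (1 : ℝ) ≤ (p ! : ℝ) := by exact_mod_cast Nat.factorial_pos p
  have hpR : (1 : ℝ) ≤ p := by exact_mod_cast (show 1 ≤ p by omega)
  have hu : 1 ∈ Finset.Icc 1 ((p - 1) / 2) := Finset.mem_Icc.2 ⟨le_rfl, by omega⟩
  have h3 := le_rosenthalBound hη (show 0 ≤ 2 * D * (1 + 1 / R) by positivity) hR.le hs0 hu
  refine le_trans ?_ h3
  have h4 : 1 ≤ R ^ 2 * (1 + 1 / R) ^ p := by
    have h5 : (1 : ℝ) ≤ 1 + 1 / R := by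
      have : 0 < 1 / R := by positivity
      linarith
    calc 1 ≤ (R + 1) ^ 2 := by nlinarith
      _ = R ^ 2 * (1 + 1 / R) ^ 2 := by field_simp
      _ ≤ R ^ 2 * (1 + 1 / R) ^ p := by gcongr
  have h6 : (2 : ℝ) ≤ 2 ^ p := le_self_pow₀ (by norm_num) (by omega)
  calc |rowMoment P ζ g p n - s ^ p * gaussMoment p|
      ≤ |rowMoment P ζ g p n| + |s ^ p * gaussMoment p| := abs_sub _ _
    _ ≤ D ^ p * s ^ 2 * (p ! : ℝ) + D ^ p * s ^ 2 * (p ! : ℝ) := by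
        refine add_le_add (h1.trans (le_mul_of_one_le_right (by positivity) hfac)) h2
    _ = 2 * (D ^ p * s ^ 2 * (p ! : ℝ)) * 1 * 1 * 1 := by ring
    _ ≤ 2 ^ p * (D ^ p * s ^ 2 * (p ! : ℝ)) * (p ! : ℝ) * p * (R ^ 2 * (1 + 1 / R) ^ p) := by
        gcongr
    _ = _ := by
        rw [mul_pow, mul_pow]
        simp only [pow_one, Nat.factorial_one, Nat.cast_one, mul_one, one_pow, div_one]
        ring

/-! ### Admissible sequences -/

section Admissible

variable {K : ℕ → ℝ} {r : ℕ → ℕ} {A : ℕ → ℝ} {a η : ℝ}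

lemma IsAdmissible.K_nonneg (h : IsAdmissible P ζ g K r A a η) {n : ℕ} (hn : 1 ≤ n) : 0 ≤ K n :=
  ENNReal.toReal_nonneg.trans (h.norm_le n 1 le_rfl hn)

lemma one_le_jseq (ha : 0 < a) {n : ℕ} (hA : 1 ≤ A n) : 1 ≤ jseq A a η n := by
  have : 0 ≤ Real.log (3 * A n) := Real.log_nonneg (by linarith)
  unfold jseq
  have : 0 ≤ (Real.log (3 * A n) / a) ^ (1 / η) := by positivity
  linarith

lemma sqrt_Qseq_le_Rseq (ha : 0 < a) {n : ℕ} (hA : 1 ≤ A n) :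
    √(Qseq P ζ K r n) ≤ Rseq P ζ g K r A a η n := by
  have h1 := one_le_jseq (η := η) ha hA
  have h2 : 0 ≤ Kinf P ζ g n := Kinf_nonneg n
  calc √(Qseq P ζ K r n) = √(Qseq P ζ K r n) * 1 * 1 := by ring
    _ ≤ √(Qseq P ζ K r n) * (Kinf P ζ g n + jseq A a η n + 1) * A n := by gcongr; linarith

lemma IsAdmissible.exists_le_Rseq (h : IsAdmissible P ζ g K r A a η) (ha : 0 < a) :
    ∃ c : ℝ, 0 < c ∧ ∀ n, 1 ≤ n → c ≤ Rseq P ζ g K r A a η n := by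
  obtain ⟨ε₀, hε₀, hQ⟩ := h.Q_lower
  exact ⟨√ε₀, Real.sqrt_pos.2 hε₀, fun n hn =>
    (Real.sqrt_le_sqrt (hQ n hn)).trans (sqrt_Qseq_le_Rseq ha (h.one_le_A n hn))⟩

/-- The growth condition on the speeds says that the cube of `R_n` is negligible. -/
lemma IsAdmissible.eventually_cube_le (h : IsAdmissible P ζ g K r A a η)
    (hS : IsBoundedArray P ζ g) (ha : 0 < a) (hη : 0 < η) {c : ℝ} (hc : 0 < c) :
    ∀ᶠ n in atTop, (c * Rseq P ζ g K r A a η n) ^ 3 ≤ sigma P ζ g n := by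
  obtain ⟨b, hb, hlim⟩ := h.exists_speed
  obtain ⟨c₀, hc₀, hR⟩ := h.exists_le_Rseq ha
  set β : ℝ := 1 / (1 + 2 * (1 + 1 / η)) with hβ
  have hβ0 : 0 < β := by positivity
  have hδ : 0 < (c ^ 3) ^ (-β) := by positivity
  filter_upwards [hb.eventually_ge_atTop 1, hlim.eventually (gt_mem_nhds hδ),
    eventually_ge_atTop 1, hS.sigma_tendsto.eventually_gt_atTop 0] with n h1 h2 h3 h4
  have hR0 : 0 < Rseq P ζ g K r A a η n := hc₀.trans_le (hR n h3)
  by_contra hcon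
  push Not at hcon
  have h5 : sigma P ζ g n / Rseq P ζ g K r A a η n ^ 3 ≤ c ^ 3 := by
    rw [div_le_iff₀ (by positivity), ← mul_pow]
    exact hcon.le
  have h6 : (c ^ 3) ^ (-β) ≤ (sigma P ζ g n / Rseq P ζ g K r A a η n ^ 3) ^ (-β) :=
    Real.rpow_le_rpow_of_nonpos (by positivity) h5 (by linarith)
  have h7 : 0 ≤ (sigma P ζ g n / Rseq P ζ g K r A a η n ^ 3) ^ (-β) := hδ.le.trans h6
  nlinarith

lemma IsAdmissible.exists_rosenthalBound [IsProbabilityMeasure P] (h : IsAdmissible P ζ g K r A a η)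
    (hS : IsBoundedArray P ζ g) (ha : 0 < a) (hη : 0 < η) :
    ∃ C : ℝ, 0 < C ∧ ∀ p : ℕ, 2 < p → ∀ n : ℕ, 1 ≤ n →
      |rowMoment P ζ g p n - sigma P ζ g n ^ p * gaussMoment p| ≤
        rosenthalBound C η (Rseq P ζ g K r A a η n) (sigma P ζ g n) p := by
  obtain ⟨ε₀, hε₀, hQ⟩ := h.Q_lower
  obtain ⟨c₀, hc₀, hR⟩ := h.exists_le_Rseq ha
  obtain ⟨C₁, c, hC₁, hc, hrow⟩ := MixingRow.exists_moment_bound (Ω := Ω) ha hη hε₀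
  have hev : ∀ᶠ n in atTop, ∀ p : ℕ, 2 < p →
      |rowMoment P ζ g p n - sigma P ζ g n ^ p * gaussMoment p| ≤
        rosenthalBound C₁ η (Rseq P ζ g K r A a η n) (sigma P ζ g n) p := by
    filter_upwards [h.eventually_cube_le hS ha hη hc, h.sum_rho_le, h.Q_isLittleO.bound one_pos,
      eventually_ge_atTop 1] with n hn1 hn2 hn3 hn p hp
    have hK := h.K_nonneg hn
    have hsum : 0 ≤ ∑ j ∈ Finset.Icc 1 n, rhoRow P ζ n j :=
      Finset.sum_nonneg fun j _ => rhoRow_nonneg n j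
    have hAn := h.one_le_A n hn
    have hQn : Qseq P ζ K r n ≤ sigma P ζ g n ^ 2 := by
      have := (le_abs_self _).trans hn3
      rwa [one_mul, Real.norm_of_nonneg (sq_nonneg _)] at this
    have key := hrow P (rowSigma ζ n) n (clippedRow P ζ g n) (Kinf P ζ g n) (K n) (rhoRow P ζ n)
      (A n) (Qseq P ζ K r n) (sigma P ζ g n) (Rseq P ζ g K r A a η n) (r n)
      (hS.mixingRow (h.norm_le n)) hK hAn (h.r_pos n hn) (hQ n hn)
      (le_add_of_nonneg_right (by unfold Cseq; positivity)) hn2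
      (fun k j hj hkj => (phiCoeff_le_phiRow hkj).trans (h.phi_le n j hj (by omega)))
      (fun j hj hjn => hS.rhoRow_le (by linarith) (h.phi_le n j hj hjn))
      (sigma_nonneg n) (by rw [hS.integral_ivlSum_pow, hS.rowMoment_two]) hQn rfl hn1 p hp
    rwa [hS.integral_ivlSum_pow] at key
  obtain ⟨n₀, hn₀⟩ := eventually_atTop.1 hev
  -- the finitely many remaining rows
  have hsingle : ∀ n : ℕ, ∃ C : ℝ, 0 ≤ C ∧ (1 ≤ n → ∀ p : ℕ, 2 < p →
      |rowMoment P ζ g p n - sigma P ζ g n ^ p * gaussMoment p|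
        ≤ rosenthalBound C η (Rseq P ζ g K r A a η n) (sigma P ζ g n) p) := by
    intro n
    by_cases hn : 1 ≤ n
    · obtain ⟨C, hC, hCp⟩ := hS.exists_bound_single hη (hc₀.trans_le (hR n hn)) n
      exact ⟨C, hC, fun _ => hCp⟩
    · exact ⟨0, le_rfl, fun h => absurd h hn⟩
  choose C' hC' hCp using hsingle
  have hsumC : 0 ≤ ∑ i ∈ Finset.range n₀, C' i := Finset.sum_nonneg fun i _ => hC' i
  refine ⟨C₁ + ∑ i ∈ Finset.range n₀, C' i, by linarith, fun p hp n hn => ?_⟩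
  have hRn : 0 ≤ Rseq P ζ g K r A a η n := hc₀.le.trans (hR n hn)
  rcases Nat.lt_or_ge n n₀ with hlt | hge
  · refine (hCp n hn p hp).trans (rosenthalBound_mono (hC' n) ?_ hRn (sigma_nonneg n) p)
    have := Finset.single_le_sum (fun i _ => hC' i) (Finset.mem_range.2 hlt)
    linarith
  · exact (hn₀ n hge p hp).trans
      (rosenthalBound_mono hC₁.le (by linarith) hRn (sigma_nonneg n) p)

lemma isBigO_pow_of_le {f : ℕ → ℝ} {c : ℝ} (hc : 0 < c) (hf : ∀ᶠ n in atTop, c ≤ f n) {i j : ℕ}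
    (hij : i ≤ j) : (fun n => f n ^ i) =O[atTop] fun n => f n ^ j := by
  refine IsBigO.of_bound ((1 / c) ^ (j - i)) ?_
  filter_upwards [hf] with n hn
  have hfn : 0 < f n := hc.trans_le hn
  rw [Real.norm_of_nonneg (by positivity), Real.norm_of_nonneg (by positivity)]
  have e : f n ^ j = f n ^ (j - i) * f n ^ i := by rw [← pow_add]; congr 1; omega
  rw [e, ← mul_assoc, ← mul_pow]
  refine le_mul_of_one_le_left (by positivity) (one_le_pow₀ ?_)
  rw [one_div_mul_eq_div, one_le_div hc]
  exact hn

lemma isBigO_rosenthalBound {C η c : ℝ} {R s : ℕ → ℝ} (hc : 0 < c) (hR : ∀ᶠ n in atTop, c ≤ R n)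
    (hs : Tendsto s atTop atTop) (p : ℕ) :
    (fun n => rosenthalBound C η (R n) (s n) p) =O[atTop] fun n => R n ^ p * s n ^ (p - 1) := by
  have e : (fun n => rosenthalBound C η (R n) (s n) p)
      = fun n => C ^ p * (p ! : ℝ) ^ (2 + 1 / η) * ∑ u ∈ Finset.Icc 1 ((p - 1) / 2),
        (p : ℝ) ^ u / (u ! : ℝ) ^ 2 * (R n ^ (u + 1) * s n ^ (2 * u)) := by
    funext n
    rw [rosenthalBound, Finset.mul_sum, Finset.mul_sum]
    refine Finset.sum_congr rfl fun u _ => ?_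
    ring
  rw [e]
  refine IsBigO.const_mul_left (IsBigO.fun_sum fun u hu => IsBigO.const_mul_left ?_ _) _
  rw [Finset.mem_Icc] at hu
  exact (isBigO_pow_of_le hc hR (by omega)).mul
    (isBigO_pow_of_le one_pos (hs.eventually_ge_atTop 1) (by omega))

lemma IsAdmissible.tendsto_normMoment [IsProbabilityMeasure P] (h : IsAdmissible P ζ g K r A a η)
    (hS : IsBoundedArray P ζ g) (ha : 0 < a) (hη : 0 < η) {p : ℕ} (hp : 2 < p)
    (hRs : (fun n => Rseq P ζ g K r A a η n ^ p) =o[atTop] fun n => sigma P ζ g n) :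
    Tendsto (normMoment P ζ g p) atTop (𝓝 (gaussMoment p)) := by
  obtain ⟨C, hC, hbound⟩ := h.exists_rosenthalBound hS ha hη
  obtain ⟨c₀, hc₀, hR⟩ := h.exists_le_Rseq ha
  have hRev : ∀ᶠ n in atTop, c₀ ≤ Rseq P ζ g K r A a η n :=
    (eventually_ge_atTop 1).mono fun n hn => hR n hn
  have h1 : (fun n => rowMoment P ζ g p n - sigma P ζ g n ^ p * gaussMoment p) =O[atTop]
      fun n => Rseq P ζ g K r A a η n ^ p * sigma P ζ g n ^ (p - 1) := by
    refine IsBigO.trans (IsBigO.of_bound 1 ?_)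
      (isBigO_rosenthalBound (C := C) (η := η) hc₀ hRev hS.sigma_tendsto p)
    filter_upwards [eventually_ge_atTop 1] with n hn
    rw [one_mul, Real.norm_eq_abs]
    exact (hbound p hp n hn).trans (le_abs_self _)
  have h2 : (fun n => Rseq P ζ g K r A a η n ^ p * sigma P ζ g n ^ (p - 1)) =o[atTop]
      fun n => sigma P ζ g n ^ p := by
    have h3 := hRs.mul_isBigO (isBigO_refl (fun n => sigma P ζ g n ^ (p - 1)) atTop)
    refine h3.congr_right fun n => ?_
    rw [← pow_succ']; congr 1; omega
  have h4 := (h1.trans_isLittleO h2).tendsto_div_nhds_zero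
  have h5 : Tendsto (fun n => (rowMoment P ζ g p n - sigma P ζ g n ^ p * gaussMoment p) /
      sigma P ζ g n ^ p + gaussMoment p) atTop (𝓝 (gaussMoment p)) := by
    simpa using h4.add_const (gaussMoment p)
  refine h5.congr' ?_
  filter_upwards [hS.sigma_tendsto.eventually_gt_atTop 0] with n hn
  rw [normMoment_eq]
  field_simp
  ring

lemma IsAdmissible.tendsto_normMoment_of_bounded [IsProbabilityMeasure P] (h : IsAdmissible P ζ g K r A a η)
    (hS : IsBoundedArray P ζ g) (ha : 0 < a) (hη : 0 < η) {M : ℝ}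
    (hM : ∀ n, 1 ≤ n → Rseq P ζ g K r A a η n ≤ M) (p : ℕ) :
    Tendsto (normMoment P ζ g p) atTop (𝓝 (gaussMoment p)) := by
  obtain ⟨c₀, hc₀, hR⟩ := h.exists_le_Rseq ha
  rcases Nat.lt_or_ge 2 p with hp | hp
  · refine h.tendsto_normMoment hS ha hη hp (IsBigO.trans_isLittleO (g := fun _ => (1 : ℝ)) ?_ ?_)
    · refine IsBigO.of_bound (M ^ p) ?_
      filter_upwards [eventually_ge_atTop 1] with n hn
      have h0 := hc₀.le.trans (hR n hn)
      rw [norm_one, mul_one, Real.norm_of_nonneg (by positivity)]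
      exact pow_le_pow_left₀ h0 (hM n hn) p
    · exact isLittleO_const_left.2 (Or.inr (tendsto_norm_atTop_atTop.comp hS.sigma_tendsto))
  interval_cases p
  · refine tendsto_const_nhds.congr fun n => ?_
    rw [gaussMoment_zero, normMoment_eq]
    simp [rowMoment]
  · refine tendsto_const_nhds.congr fun n => ?_
    rw [gaussMoment_one, normMoment_eq]
    simp [rowMoment, hS.integral_rowSum n]
  · refine tendsto_const_nhds.congr' ?_
    filter_upwards [hS.sigma_tendsto.eventually_gt_atTop 0] with n hn
    rw [gaussMoment_add_two 0, gaussMoment_zero, normMoment_eq, hS.rowMoment_two]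
    field_simp
    norm_num

end Admissible

end Rows

/-! ### Uniformly bounded arrays with a uniform mixing rate -/

section UniformRate

variable {Ω : Type*} {X : ℕ → ℕ → Type*} [mΩ : MeasurableSpace Ω] {P : Measure Ω}
  [IsProbabilityMeasure P] {ζ : ∀ n j, Ω → X n j} {g : ∀ n j, X n j → ℝ}
  [mX : ∀ n j, MeasurableSpace (X n j)]

lemma sum_Icc_inv_sq_le {f : ℕ → ℝ} {c : ℝ} (hc : 0 ≤ c) {n : ℕ}
    (hf : ∀ j, 1 ≤ j → j ≤ n → f j ≤ c * (1 / (j : ℝ) ^ 2)) :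
    ∑ j ∈ Finset.Icc 1 n, f j ≤ 2 * c := by
  have e : Finset.Icc 1 n = Finset.Ico 1 (n + 1) := by ext; simp
  calc ∑ j ∈ Finset.Icc 1 n, f j ≤ ∑ j ∈ Finset.Icc 1 n, c * (1 / (j : ℝ) ^ 2) :=
        Finset.sum_le_sum fun j hj => by
          rw [Finset.mem_Icc] at hj
          exact hf j hj.1 hj.2
    _ = c * ∑ j ∈ Finset.range n, 1 / ((j : ℝ) + 1) ^ 2 := by
        rw [← Finset.mul_sum, e, Finset.sum_Ico_eq_sum_range, Nat.add_sub_cancel]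
        congr 1
        refine Finset.sum_congr rfl fun j _ => ?_
        push_cast
        rw [add_comm]
    _ ≤ c * 2 := mul_le_mul_of_nonneg_left (sum_range_inv_sq_le n) hc
    _ = 2 * c := mul_comm _ _

/-- A speed exists as soon as the scale stays bounded. -/
lemma exists_speed_of_bounded {s R : ℕ → ℝ} {c M β : ℝ} (hs : Tendsto s atTop atTop) (hc : 0 < c)
    (hR : ∀ n, 1 ≤ n → c ≤ R n) (hM : ∀ n, 1 ≤ n → R n ≤ M) (hβ : 0 < β) :
    ∃ b : ℕ → ℝ, Tendsto b atTop atTop ∧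
      Tendsto (fun n => b n * (s n / R n ^ 3) ^ (-β)) atTop (𝓝 0) := by
  have hM0 : 0 < M := hc.trans_le ((hR 1 le_rfl).trans (hM 1 le_rfl))
  have hy : Tendsto (fun n => s n / R n ^ 3) atTop atTop := by
    refine tendsto_atTop_mono' atTop ?_ (hs.atTop_div_const (show 0 < M ^ 3 by positivity))
    filter_upwards [hs.eventually_ge_atTop 0, eventually_ge_atTop 1] with n h0 hn
    have h1 : 0 < R n := hc.trans_le (hR n hn)
    have := hM n hn
    gcongr
  refine ⟨fun n => (s n / R n ^ 3) ^ (β / 2),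
    (tendsto_rpow_atTop (show 0 < β / 2 by positivity)).comp hy, ?_⟩
  refine ((tendsto_rpow_neg_atTop (show 0 < β / 2 by positivity)).comp hy).congr' ?_
  filter_upwards [hy.eventually_gt_atTop 0] with n hn
  rw [Function.comp_apply, ← Real.rpow_add hn]
  congr 1
  ring

lemma IsBoundedArray.norm_le_Kinf (hS : IsBoundedArray P ζ g) {n j : ℕ} (hj : 1 ≤ j)
    (hjn : j ≤ n) : (eLpNorm (xi ζ g n j) 2 P).toReal ≤ Kinf P ζ g n := by
  have h2 : MemLp (xi ζ g n j) 2 P := (hS.bounded n j hj hjn).mono_exponent le_top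
  rw [← l2norm_eq_toReal_eLpNorm h2]
  refine Real.sqrt_le_iff.2 ⟨Kinf_nonneg n, ?_⟩
  calc ∫ ω, xi ζ g n j ω ^ 2 ∂P ≤ ∫ _ω, Kinf P ζ g n ^ 2 ∂P := by
        refine integral_mono_ae h2.integrable_sq (integrable_const _) ?_
        filter_upwards [hS.ae_abs_xi_le hj hjn] with ω hω
        exact sq_le_sq' (by linarith [(abs_le.1 hω).1]) (abs_le.1 hω).2
    _ = _ := by simp

/-- Under a uniform mixing rate, constant sequences (with `r` cut off at `n`) are admissible: the
correlation coefficients are summable uniformly in the row. -/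
lemma IsBoundedArray.exists_isAdmissible (hS : IsBoundedArray P ζ g) {a η M A₀ : ℝ} (ha : 0 < a)
    (hη : 0 < η) (hM : ∀ n, 1 ≤ n → Kinf P ζ g n ≤ M)
    (hA₀ : ∀ j : ℕ, 1 ≤ j → phiUnif P ζ j ≤ A₀ * Real.exp (-(a * (j : ℝ) ^ η))) :
    ∃ (K : ℕ → ℝ) (r : ℕ → ℕ) (A : ℕ → ℝ), IsAdmissible P ζ g K r A a η ∧
      ∃ M : ℝ, ∀ n, 1 ≤ n → Rseq P ζ g K r A a η n ≤ M := by
  set k₀ : ℝ := max M 1 with hk₀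
  set A₁ : ℝ := max A₀ 1 with hA₁
  have hk1 : 1 ≤ k₀ := le_max_right _ _
  have hA1 : 1 ≤ A₁ := le_max_right _ _
  have hφ : ∀ n j : ℕ, 1 ≤ j → j ≤ n → phiRow P ζ n j ≤ A₁ * Real.exp (-(a * (j : ℝ) ^ η)) := by
    intro n j hj hjn
    refine (phiRow_le_phiUnif hjn).trans ((hA₀ j hj).trans ?_)
    gcongr
    exact le_max_left _ _
  obtain ⟨e, he⟩ := exists_nat_ge (2 / η)
  rw [div_le_iff₀ hη] at he
  set c : ℝ := 2 * √A₁ * ((e ! : ℝ) / (a / 2) ^ e) with hc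
  have hc0 : 0 ≤ c := by positivity
  have hρ : ∀ n j : ℕ, 1 ≤ j → j ≤ n → rhoRow P ζ n j ≤ c * (1 / (j : ℝ) ^ 2) := by
    intro n j hj hjn
    refine (hS.rhoRow_le (by linarith) (hφ n j hj hjn)).trans ?_
    obtain ⟨i, rfl⟩ : ∃ i, j = i + 1 := ⟨j - 1, by omega⟩
    rw [hc, mul_assoc (2 * √A₁)]
    refine mul_le_mul_of_nonneg_left ?_ (by positivity)
    have := exp_neg_rpow_le (show 0 < a / 2 by positivity) he i
    push_cast at this ⊢
    exact this
  have hsum : ∀ n, ∑ j ∈ Finset.Icc 1 n, rhoRow P ζ n j ≤ 2 * c := fun n =>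
    sum_Icc_inv_sq_le hc0 (hρ n)
  have hsum0 : ∀ n, 0 ≤ ∑ j ∈ Finset.Icc 1 n, rhoRow P ζ n j := fun n =>
    Finset.sum_nonneg fun j _ => rhoRow_nonneg n j
  -- `r₀ ≥ 1` with `2 c / r₀ ≤ 1 / 4`
  set r₀ : ℕ := ⌈8 * c⌉₊ + 1 with hr₀
  have hr₀1 : (1 : ℝ) ≤ r₀ := by exact_mod_cast (show 1 ≤ r₀ by omega)
  have hr₀c : 8 * c ≤ r₀ := by
    have := Nat.le_ceil (8 * c)
    rw [hr₀]; push_cast; linarith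
  set K : ℕ → ℝ := fun _ => k₀ with hK
  set r : ℕ → ℕ := fun n => min r₀ n with hr
  set A : ℕ → ℝ := fun _ => A₁ with hA
  have hD1 : ∀ n, 1 ≤ Dseq P ζ n := fun n => by
    unfold Dseq; linarith [hsum0 n]
  have hD2 : ∀ n, Dseq P ζ n ≤ 1 + 4 * c := fun n => by
    unfold Dseq; linarith [hsum n]
  have hC0 : ∀ n, 0 ≤ Cseq P ζ K n := fun n => by
    have := hsum0 n
    unfold Cseq; positivity
  have hC2 : ∀ n, Cseq P ζ K n ≤ 2 * k₀ * (2 * c) := fun n => by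
    have := hsum n
    unfold Cseq
    gcongr
  have hr1 : ∀ n, 1 ≤ n → (1 : ℝ) ≤ r n := fun n hn => by
    exact_mod_cast (show 1 ≤ min r₀ n from le_min (by omega) hn)
  have hr2 : ∀ n, (r n : ℝ) ≤ r₀ := fun n => by
    exact_mod_cast min_le_left r₀ n
  set Qmax : ℝ := 2 * k₀ ^ 2 * (1 + 4 * c) * r₀ +
    4 * (2 * k₀ * (2 * c)) * k₀ * √((1 + 4 * c) * r₀) with hQmax
  have hQ1 : ∀ n, 1 ≤ n → 1 ≤ Qseq P ζ K r n := by
    intro n hn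
    have h1 : 0 ≤ 4 * Cseq P ζ K n * K n * √(Dseq P ζ n * r n) := by
      have := hC0 n
      positivity
    have h2 : 1 * 1 ^ 2 * 1 * 1 ≤ 2 * K n ^ 2 * Dseq P ζ n * r n := by
      have := hD1 n
      have := hr1 n hn
      have : 1 ≤ K n := hk1
      gcongr
      norm_num
    unfold Qseq
    linarith
  have hQ2 : ∀ n, Qseq P ζ K r n ≤ Qmax := by
    intro n
    have h1 := hD1 n
    have h2 := hD2 n
    have h3 := hr2 n
    have h4 := hC2 n
    have h5 : 0 ≤ K n := zero_le_one.trans hk1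
    unfold Qseq
    rw [hQmax]
    gcongr
  have hR2 : ∀ n, 1 ≤ n →
      Rseq P ζ g K r A a η n ≤ √Qmax * (M + jseq A a η 0 + 1) * A₁ := by
    intro n hn
    have h1 := hQ2 n
    have h2 := hM n hn
    have h3 : 0 ≤ Kinf P ζ g n := Kinf_nonneg n
    have h4 : 1 ≤ jseq A a η n := one_le_jseq ha hA1
    have h5 : jseq A a η 0 = jseq A a η n := rfl
    unfold Rseq
    rw [h5]
    gcongr
  have hR1 : ∀ n, 1 ≤ n → 1 ≤ Rseq P ζ g K r A a η n := fun n hn =>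
    (Real.one_le_sqrt.2 (hQ1 n hn)).trans (sqrt_Qseq_le_Rseq ha hA1)
  refine ⟨K, r, A, ?_, _, hR2⟩
  exact
  { norm_le := fun n j hj hjn => (hS.norm_le_Kinf hj hjn).trans
      ((hM n (hj.trans hjn)).trans (le_max_left _ _))
    r_pos := fun n hn => le_min (by omega) hn
    r_le := fun n _ => min_le_right _ _
    sum_rho_le := by
      filter_upwards [eventually_ge_atTop r₀] with n hn
      have e1 : r n = r₀ := min_eq_left hn
      rw [e1]
      refine (sum_Icc_inv_sq_le (c := 1 / 8) (by norm_num) fun j hj hjn => ?_).trans (by norm_num)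
      have hj0 : (1 : ℝ) ≤ j := by exact_mod_cast hj
      refine (hρ n (r₀ * j) (Nat.mul_pos (by omega) hj) ?_).trans ?_
      · exact (Nat.mul_le_mul_left r₀ hjn).trans (Nat.mul_div_le n r₀)
      · push_cast
        rw [mul_pow, mul_one_div, mul_one_div, div_le_div_iff₀ (by positivity) (by positivity)]
        have h1 : c ≤ 1 / 8 * (r₀ : ℝ) ^ 2 := by nlinarith
        calc c * (j : ℝ) ^ 2 ≤ 1 / 8 * (r₀ : ℝ) ^ 2 * (j : ℝ) ^ 2 := by gcongr
          _ = _ := by ring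
    Q_lower := ⟨1, one_pos, hQ1⟩
    Q_isLittleO := by
      refine IsBigO.trans_isLittleO (g := fun _ => (1 : ℝ)) (IsBigO.of_bound Qmax ?_) ?_
      · filter_upwards [eventually_ge_atTop 1] with n hn
        rw [norm_one, mul_one, Real.norm_of_nonneg (zero_le_one.trans (hQ1 n hn))]
        exact hQ2 n
      · exact isLittleO_const_left.2 (Or.inr (tendsto_norm_atTop_atTop.comp
          ((tendsto_pow_atTop two_ne_zero).comp hS.sigma_tendsto)))
    one_le_A := fun _ _ => hA1
    phi_le := hφ
    j_isLittleO := (isLittleO_const_left (c := jseq A a η 0)).2 (Or.inr (tendsto_norm_atTop_atTop.comp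
      tendsto_natCast_atTop_atTop))
    exists_speed := exists_speed_of_bounded hS.sigma_tendsto one_pos hR1 hR2 (by positivity) }

end UniformRate

end MixArray

end

theorem theorem2p9 {Ω : Type*} [MeasurableSpace Ω] (P : Measure Ω) [IsProbabilityMeasure P]
    {X : ℕ → ℕ → Type*} [∀ n j, MeasurableSpace (X n j)]
    (ζ : ∀ n j, Ω → X n j) (g : ∀ n j, X n j → ℝ) (hS : IsBoundedArray P ζ g)
    (a η : ℝ) (ha : 0 < a) (hη : 0 < η) :
    -- the moment expansion and its consequences, for every admissible choice of `K, r, A`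
    (∀ (K : ℕ → ℝ) (r : ℕ → ℕ) (A : ℕ → ℝ), IsAdmissible P ζ g K r A a η →
      (∃ C : ℝ, 0 < C ∧
        (∀ p : ℕ, 2 < p → ∀ n : ℕ, 1 ≤ n →
          |rowMoment P ζ g p n - sigma P ζ g n ^ p * gaussMoment p| ≤
            rosenthalBound C η (Rseq P ζ g K r A a η n) (sigma P ζ g n) p) ∧
        (∀ p : ℕ, 2 < p →
          (fun n => rosenthalBound C η (Rseq P ζ g K r A a η n) (sigma P ζ g n) p) =O[atTop]
            fun n => Rseq P ζ g K r A a η n ^ p * sigma P ζ g n ^ (p - 1))) ∧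
      (∀ p : ℕ, 2 < p →
        (fun n => Rseq P ζ g K r A a η n ^ p) =o[atTop] (fun n => sigma P ζ g n) →
          Tendsto (normMoment P ζ g p) atTop (𝓝 (gaussMoment p))) ∧
      ((∃ M : ℝ, ∀ n, 1 ≤ n → Rseq P ζ g K r A a η n ≤ M) →
        ∀ p : ℕ, Tendsto (normMoment P ζ g p) atTop (𝓝 (gaussMoment p)))) ∧
    -- uniformly bounded arrays with a uniform mixing rate
    ((∃ M : ℝ, ∀ n, 1 ≤ n → Kinf P ζ g n ≤ M) →
      (∃ A₀ : ℝ, 0 < A₀ ∧ ∀ j : ℕ, 1 ≤ j →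
        phiUnif P ζ j ≤ A₀ * Real.exp (-(a * (j : ℝ) ^ η))) →
      (∃ (K : ℕ → ℝ) (r : ℕ → ℕ) (A : ℕ → ℝ), IsAdmissible P ζ g K r A a η ∧
        ∃ M : ℝ, ∀ n, 1 ≤ n → Rseq P ζ g K r A a η n ≤ M) ∧
      ∀ p : ℕ, Tendsto (normMoment P ζ g p) atTop (𝓝 (gaussMoment p))) := by
  refine ⟨fun K r A h => ⟨?_, fun p hp hR => h.tendsto_normMoment hS ha hη hp hR,
    fun ⟨M, hM⟩ p => h.tendsto_normMoment_of_bounded hS ha hη hM p⟩, ?_⟩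
  · obtain ⟨C, hC, hbound⟩ := h.exists_rosenthalBound hS ha hη
    obtain ⟨c, hc, hR⟩ := h.exists_le_Rseq ha
    exact ⟨C, hC, hbound, fun p _ => isBigO_rosenthalBound hc
      ((eventually_ge_atTop 1).mono fun n hn => hR n hn) hS.sigma_tendsto p⟩
  · rintro ⟨M, hM⟩ ⟨A₀, -, hA₀⟩
    obtain ⟨K, r, A, h, M', hM'⟩ := hS.exists_isAdmissible ha hη hM hA₀
    exact ⟨⟨K, r, A, h, M', hM'⟩, h.tendsto_normMoment_of_bounded hS ha hη hM'⟩
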